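/- **Theorem (Game-based blindness of QF-UBQC).** *Under the decisional LWE assumption against quantum polynomial-time (QPT) distinguishers, UBQC combined with 8-states QFactory (one independent instance per qubit) is computationally adaptively blind.* **Algorithms.** $\lambda$ is the security parameter. A QPT algorithm is a (non-uniform) family of quantum circuits, one for each $\lambda$, of size polynomial in $\lambda$ over a finite universal gate set, which may exchange classical messages with another party. A function is negligible if it decays faster than every inverse polynomial in $\lambda$. **Parameters.** For each $\lambda$ let $n,k,\bar m,\mu\in\mathbb N$, $q=2^k$, $m=\bar m+nk$, and let $\chi$ be a distribution on $\mathbb Z_q$, such that $n,k,\bar m$ are polynomially bounded in $\lambda$, $\bar m\ge nk+\lambda$ and $4(\bar m+1)\mu<q$. Assume LWE: for every polynomially bounded number $\ell$ of samples, no QPT distinguisher tells $(M,Ms+e)$ from $(M,u)$ with non-negligible advantage, where $M\in\mathbb Z_q^{\ell\times n}$, $s\in\mathbb Z_q^n$, $u\in\mathbb Z_q^\ell$ are uniform and $e\sim\chi^\ell$. **4-states QFactory (client).** Sample $A\in\mathbb Z_q^{\bar m\times n}$ uniformly and a trapdoor $R\in\{-1,0,1\}^{nk\times\bar m}$ with independent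 entries ($0$ with probability $\frac12$, $\pm1$ with probability $\frac14$ each), and put $K=\binom{A}{G-RA}$, where $G$ is the gadget matrix, whose row $(i,j)$ is $2^j$ times the $i$-th unit vector ($1\le i\le n$, $0\le j<k$). Sample $B_1\in\{0,1\}$ and $s_0\in\mathbb Z_q^n$ uniformly and $e_0\sim\chi^m$, put $v=(q/2,0,\dots,0)^T$, and send $K$ and the ciphertext $y_0=Ks_0+e_0+B_1v$. The server reports $(y,b)$. Consider the function $(s,e,d,c)\mapsto Ks+e+dv+cy_0$ with $s\in\mathbb Z_q^n$, $e\in\mathbb Z_q^m$ with all entries at most $\mu$ in absolute value, and $d,c\in\{0,1\}$. If $y$ has exactly two preimages $x,x'$ under it, with $d$-components $h(x),h(x')$, then $B_2=B_1\cdot\big(b\cdot(x\oplus x')\big)\oplus h(x)h(x')$, preimages being written as bit strings and $b\cdot(\,\cdot\,)$ being the inner product modulo 2; otherwise $B_2$ is a uniformly random bit. **8-states QFactory (client).** Run two independent 4-states instances, with bits $B_1,B_2$ and $B_1',B_2'$; the server also reports $s_1,s_2\in\{0,1\}$. The client obtains $\theta=L_1\pi+L_2\frac\pi2+L_3\frac\pi4$,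 where $L_1=B_2'\oplus B_2\oplus B_1(s_1\oplus s_2)$, $L_2=B_1'\oplus(B_2\oplus s_2)B_1$, $L_3=B_1$. **QF-UBQC (client).** For each $\lambda$ fix a graph on $N=N(\lambda)$ qubits, $N$ polynomially bounded, with input set $I$, output set $O$ and a flow $f:O^c\to I^c$, the qubits being numbered in an order compatible with the flow (for $i\notin O$: $i\sim f(i)$, $i<f(i)$, and $i<j$ for every neighbour $j\ne i$ of $f(i)$). The secret input is a measurement pattern $\phi\in\{0,\frac\pi4,\dots,\frac{7\pi}4\}^N$. The client runs $N$ independent 8-states QFactory instances in parallel: it sends all the public matrices and ciphertexts and receives all the reports, which give $\theta_1,\dots,\theta_N$. Then, for $i=1,\dots,N$ in turn, it draws a uniform bit $r_i$, sends $$\delta_i=(-1)^{s^X_i}\phi_i+s^Z_i\pi+\theta_i+r_i\pi \pmod{2\pi}$$ and receives $s_i\in\{0,1\}$. Here $\bar s_j=s_j\oplus r_j$, $s^X_i=\bigoplus_{j\notin O,\,f(j)=i}\bar s_j$, and $s^Z_i=\bigoplus_{j\notin O,\,j\ne i,\,f(j)\sim i}\bar s_j$. **Blindness game.** The adversary $\mathcal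 A$ sends two measurement patterns $\phi^{(1)},\phi^{(2)}$ for the graph; a uniform $c\in\{1,2\}$ is drawn; $\mathcal A$, acting as an arbitrary malicious server, interacts with the client on input $\phi^{(c)}$, and finally outputs a guess $c'$. **Conclusion.** For every QPT adversary $\mathcal A$ there is a negligible function $\varepsilon$ such that $\Pr[c'=c]\le\frac12+\varepsilon(\lambda)$ for all $\lambda$. -/

import Mathlib

noncomputable section

/-! ### Asymptotics -/

/-- `f` is bounded by a polynomial in the security parameter. -/
def PolyBounded (f : ℕ → ℕ) : Prop :=
  ∃ p : Polynomial ℕ, ∀ sec : ℕ, f sec ≤ p.eval sec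

/-- `f` is negligible in the security parameter. -/
def Negligible (f : ℕ → ℝ) : Prop :=
  Asymptotics.SuperpolynomialDecay Filter.atTop (fun sec : ℕ => (sec : ℝ)) f

/-! ### Interactive quantum circuits with classical communication -/

/-- Pure, possibly subnormalised, states of `w` qubits in the computational basis. -/
abbrev QState (w : ℕ) : Type := (Fin w → Bool) → ℂ

/-- A finite universal gate set: Hadamard, the `π/8` gate, Pauli X, CNOT and Toffoli. -/
inductive Gate (w : ℕ) : Type where
  | had (i : Fin w) : Gate w
  | phase (i : Fin w) : Gate w
  | flip (i : Fin w) : Gate w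
  | cnot (ctrl tgt : Fin w) (hne : ctrl ≠ tgt) : Gate w
  | toffoli (ctrl₁ ctrl₂ tgt : Fin w) (hne₁ : ctrl₁ ≠ tgt) (hne₂ : ctrl₂ ≠ tgt) : Gate w

/-- The unitary action of a gate. -/
def Gate.apply {w : ℕ} : Gate w → QState w → QState w
  | .had i, ψ => fun x =>
      (1 / (Real.sqrt 2 : ℂ)) *
        (ψ (Function.update x i false) +
          (if x i then -1 else 1) * ψ (Function.update x i true))
  | .phase i, ψ => fun x =>
      (if x i then Complex.exp ((Real.pi : ℂ) * Complex.I / 4) else 1) * ψ x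
  | .flip i, ψ => fun x => ψ (Function.update x i (!(x i)))
  | .cnot i j _, ψ => fun x => ψ (Function.update x j (xor (x j) (x i)))
  | .toffoli i j l _ _, ψ => fun x => ψ (Function.update x l (xor (x l) (x i && x j)))

/-- One instruction of an interactive quantum circuit: a gate, or one round of classical
communication.  In `exchange out inp` the wires `out` are measured in the computational basis, the
outcome is sent to the other party, and the answer is written (by bitwise XOR) on the wires `inp`;
bits of the answer for which there is no wire in `inp` are ignored. -/
inductive Instr (w : ℕ) : Type where
  | gate (g : Gate w) : Instr w
  | exchange (out inp : List (Fin w)) : Instr w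

/-- Number of elementary operations of an instruction. -/
def Instr.size {w : ℕ} : Instr w → ℕ
  | .gate _ => 1
  | .exchange out inp => 1 + out.length + inp.length

/-- An interactive quantum circuit.  All wires start in `|0⟩`; in the end the wire `answer` is
measured. -/
structure QCircuit : Type where
  wires : ℕ
  answer : Fin wires
  prog : List (Instr wires)

/-- The size of a circuit: number of wires plus number of elementary operations. -/
def QCircuit.size (C : QCircuit) : ℕ :=
  C.wires + (C.prog.map Instr.size).sum

/-- A quantum polynomial-time (non-uniform) algorithm: one circuit for each value of the security
parameter, of polynomially bounded size. -/
def IsQPT (A : ℕ → QCircuit) : Prop :=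
  PolyBounded fun sec => (A sec).size

/-- The (deterministic) behaviour of a classical party: its answer, as a function of all the
messages received so far, the oldest one first. -/
abbrev Responder : Type := List (List Bool) → List Bool

/-- XOR the bits of a message into the given wires of a basis state. -/
def xorInto {w : ℕ} (inp : List (Fin w)) (msg : List Bool) (x : Fin w → Bool) : Fin w → Bool :=
  (List.zip inp msg).foldl (fun z p => Function.update z p.1 (xor (z p.1) p.2)) x

/-- The unnormalised state after the wires `out` have been measured with outcome `a`. -/
def project {w : ℕ} (out : List (Fin w)) (a : Fin out.length → Bool) (ψ : QState w) : QState w :=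
  fun x => if ∀ j : Fin out.length, x (out.get j) = a j then ψ x else 0

/-- Probability that the execution of a program, interacting with the responder `S`, ends with the
outcome `o` on the wire `ans`, when the messages `hist` have already been sent and the present
unnormalised state is `ψ`. -/
def runProb {w : ℕ} (S : Responder) (ans : Fin w) (o : Bool) :
    List (Instr w) → List (List Bool) → QState w → ℝ
  | [], _, ψ => ∑ x : Fin w → Bool, if x ans = o then ‖ψ x‖ ^ 2 else 0
  | .gate g :: rest, hist, ψ => runProb S ans o rest hist (g.apply ψ)
  | .exchange out inp :: rest, hist, ψ =>
      ∑ a : Fin out.length → Bool,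
        runProb S ans o rest (hist ++ [List.ofFn a])
          (fun x => project out a ψ (xorInto inp (S (hist ++ [List.ofFn a])) x))

/-- Probability that the circuit `C`, interacting with the responder `S`, outputs the bit `o`. -/
def QCircuit.outProb (C : QCircuit) (S : Responder) (o : Bool) : ℝ :=
  runProb S C.answer o C.prog [] (fun x => if x = fun _ => false then 1 else 0)

/-! ### Discrete probability -/

/-- Expectation of a real function. -/
def expect {α : Type} (p : PMF α) (f : α → ℝ) : ℝ := ∑' a, (p a).toReal * f a

/-- `N` independent samples from `p`. -/
def iid {α : Type} (p : PMF α) : (N : ℕ) → PMF (Fin N → α)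
  | 0 => PMF.pure Fin.elim0
  | N + 1 => p.bind fun a => (iid p N).bind fun f => PMF.pure (Fin.cons a f)

/-- A uniformly random bit. -/
def coin : PMF Bool := PMF.uniformOfFintype Bool

/-! ### Bit strings -/

/-- Integers modulo `2 ^ k`. -/
abbrev Zq (k : ℕ) : Type := ZMod (2 ^ k)

/-- Binary expansion, least significant bit first. -/
def encZq {k : ℕ} (a : Zq k) : List Bool := List.ofFn fun j : Fin k => a.val.testBit j

/-- The number written on the first `k` bits of a string (missing bits are read as zero). -/
def decZq (k : ℕ) (l : List Bool) : Zq k :=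
  ∑ j : Fin k, if l.getD j false then (2 : Zq k) ^ (j : ℕ) else 0

def encVec {m k : ℕ} (y : Fin m → Zq k) : List Bool := (List.ofFn fun r => encZq (y r)).flatten

def decVec (m k : ℕ) (l : List Bool) : Fin m → Zq k := fun r => decZq k (l.drop (r * k))

def encMat {m n k : ℕ} (M : Matrix (Fin m) (Fin n) (Zq k)) : List Bool :=
  (List.ofFn fun r => encVec (M r)).flatten

/-- Inner product modulo two of two bit strings. -/
def dotBits (a b : List Bool) : Bool := (List.zipWith and a b).foldl xor false

/-! ### Learning with errors -/

/-- The string encoding `m` LWE samples `(M, M s + e)` with uniform `M` and `s`, and with the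
coordinates of `e` drawn independently from `χ`. -/
def lweReal (n k m : ℕ) (χ : PMF (Zq k)) : PMF (List Bool) :=
  (PMF.uniformOfFintype (Matrix (Fin m) (Fin n) (Zq k))).bind fun M =>
    (PMF.uniformOfFintype (Fin n → Zq k)).bind fun s =>
      (iid χ m).bind fun e => PMF.pure (encMat M ++ encVec (M.mulVec s + e))

/-- The string encoding `(M, u)` with uniform `M` and `u`. -/
def lweIdeal (n k m : ℕ) : PMF (List Bool) :=
  (PMF.uniformOfFintype (Matrix (Fin m) (Fin n) (Zq k))).bind fun M =>
    (PMF.uniformOfFintype (Fin m → Zq k)).bind fun u => PMF.pure (encMat M ++ encVec u)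

/-- Probability that a circuit outputs `1` when it is given a string drawn from `p`. -/
def acceptProb (D : QCircuit) (p : PMF (List Bool)) : ℝ :=
  expect p fun challenge => D.outProb (fun _ => challenge) true

/-- The decisional LWE assumption against quantum polynomial-time distinguishers, in dimension
`n sec`, modulo `2 ^ k sec`, with error distribution `χ sec`, for every polynomial number of
samples. -/
def LWEHard (n k : ℕ → ℕ) (χ : (sec : ℕ) → PMF (Zq (k sec))) : Prop :=
  ∀ m : ℕ → ℕ, PolyBounded m → ∀ D : ℕ → QCircuit, IsQPT D →
    Negligible fun sec =>
      |acceptProb (D sec) (lweReal (n sec) (k sec) (m sec) (χ sec)) -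
        acceptProb (D sec) (lweIdeal (n sec) (k sec) (m sec))|

/-! ### The LWE-based trapdoor family of QFactory -/

/-- Parameters: LWE dimension `n`, modulus `2 ^ k`, number `mbar` of uniform rows of the public
matrix, bound `bnd` on the entries of the error part of a preimage, error distribution `χ`. -/
structure QFParams : Type where
  n : ℕ
  k : ℕ
  mbar : ℕ
  bnd : ℕ
  χ : PMF (Zq k)

namespace QFParams

variable (P : QFParams)

/-- Number of rows of the public matrix. -/
abbrev m : ℕ := P.mbar + P.n * P.k

/-- The parameters are admissible for the security parameter `sec`: there are enough uniform rows
for the public matrix to be statistically close to uniform, and the trapdoor inverts the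
function on its whole domain. -/
def Admissible (sec : ℕ) : Prop :=
  P.n * P.k + sec ≤ P.mbar ∧ 4 * (P.mbar + 1) * P.bnd < 2 ^ P.k

/-- The gadget matrix: row `(i, j)` is `2 ^ j` times the `i`-th unit vector. -/
def gadget : Matrix (Fin (P.n * P.k)) (Fin P.n) (Zq P.k) :=
  Matrix.of fun r l =>
    if (finProdFinEquiv.symm r).1 = l then 2 ^ ((finProdFinEquiv.symm r).2 : ℕ) else 0

/-- The vector `(q/2, 0, …, 0)`. -/
def halfVec : Fin P.m → Zq P.k := fun r => if (r : ℕ) = 0 then ((2 ^ P.k / 2 : ℕ) : Zq P.k) else 0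

/-- A secret key of 4-states QFactory, with everything that was sampled with it. -/
structure Key : Type where
  /-- the uniform part of the public matrix -/
  A : Matrix (Fin P.mbar) (Fin P.n) (Zq P.k)
  /-- the trapdoor -/
  R : Matrix (Fin (P.n * P.k)) (Fin P.mbar) (Zq P.k)
  /-- the secret and the error of the ciphertext -/
  s₀ : Fin P.n → Zq P.k
  e₀ : Fin P.m → Zq P.k
  /-- the encrypted bit, which is the basis bit `B₁` of the instance -/
  d₀ : Bool

/-- An integer matrix of zeros and ones, read modulo `q`. -/
def bitMatrix {a b : ℕ} (M : Matrix (Fin a) (Fin b) Bool) : Matrix (Fin a) (Fin b) (Zq P.k) :=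
  M.map fun t => if t then 1 else 0

/-- Key generation.  The entries of the trapdoor are differences of two random bits, that is,
`0` with probability `1/2` and `1`, `-1` with probability `1/4` each. -/
def gen : PMF P.Key :=
  (PMF.uniformOfFintype (Matrix (Fin P.mbar) (Fin P.n) (Zq P.k))).bind fun A =>
  (PMF.uniformOfFintype (Matrix (Fin (P.n * P.k)) (Fin P.mbar) Bool)).bind fun R₁ =>
  (PMF.uniformOfFintype (Matrix (Fin (P.n * P.k)) (Fin P.mbar) Bool)).bind fun R₂ =>
  (PMF.uniformOfFintype (Fin P.n → Zq P.k)).bind fun s₀ =>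
  (iid P.χ P.m).bind fun e₀ =>
  coin.bind fun d₀ =>
  PMF.pure ⟨A, P.bitMatrix R₁ - P.bitMatrix R₂, s₀, e₀, d₀⟩

variable {P}

/-- The public matrix, the rows of `A` followed by those of `G - R A`. -/
def Key.pub (κ : P.Key) : Matrix (Fin P.m) (Fin P.n) (Zq P.k) :=
  (Matrix.fromRows κ.A (P.gadget - κ.R * κ.A)).submatrix finSumFinEquiv.symm id

/-- The ciphertext of the basis bit, `y₀ = K s₀ + e₀ + d₀ (q/2, 0, …, 0)`. -/
def Key.cipher (κ : P.Key) : Fin P.m → Zq P.k :=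
  κ.pub.mulVec κ.s₀ + κ.e₀ + (if κ.d₀ then P.halfVec else 0)

/-- What the client sends for one instance: public matrix and ciphertext. -/
def Key.message (κ : P.Key) : List Bool := encMat κ.pub ++ encVec κ.cipher

variable (P)

/-- The space in which preimages live; `d` is the value of the hardcore function `h`. -/
@[ext] structure Preim : Type where
  s : Fin P.n → Zq P.k
  e : Fin P.m → Zq P.k
  d : Bool
  c : Bool

variable {P}

/-- The string representing a preimage, of length `P.preimLen`. -/
def Preim.bits (x : P.Preim) : List Bool := encVec x.s ++ encVec x.e ++ [x.d, x.c]

variable (P)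

abbrev preimLen : ℕ := P.n * P.k + P.m * P.k + 2

variable {P}

/-- Membership in the domain of the function: all error entries are at most `bnd` in absolute
value. -/
def Preim.InDomain (x : P.Preim) : Prop := ∀ r, (x.e r).valMinAbs.natAbs ≤ P.bnd

/-- The function `f (s, e, d, c) = K s + e + d (q/2, 0, …, 0) + c y₀`. -/
def Key.eval (κ : P.Key) (x : P.Preim) : Fin P.m → Zq P.k :=
  κ.pub.mulVec x.s + x.e + (if x.d then P.halfVec else 0) + (if x.c then κ.cipher else 0)

/-- `x` and `z` are the two preimages of `y`, and `y` has no others. -/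
def Key.TwoPreimages (κ : P.Key) (y : Fin P.m → Zq P.k) (x z : P.Preim) : Prop :=
  x ≠ z ∧ ∀ t : P.Preim, (t.InDomain ∧ κ.eval t = y) ↔ (t = x ∨ t = z)

open Classical in
/-- The bit `B₂` that the client computes from the measurement results `y`, `b` reported by the
server: `d₀ · (b · (x ⊕ z)) ⊕ h(x) h(z)` if `y` has exactly two preimages `x`, `z` (the value does
not depend on which of them is called `x`), and the random bit `u` otherwise. -/
def Key.valueBit (κ : P.Key) (y : Fin P.m → Zq P.k) (b : List Bool) (u : Bool) : Bool :=
  if hxz : ∃ xz : P.Preim × P.Preim, κ.TwoPreimages y xz.1 xz.2 then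
    xor (κ.d₀ && dotBits b (List.zipWith xor hxz.choose.1.bits hxz.choose.2.bits))
      (hxz.choose.1.d && hxz.choose.2.d)
  else u

variable (P)

/-! ### 8-states QFactory (client) -/

/-- The randomness of the client in one run of 8-states QFactory: two independent keys, and the two
bits used when the reported image does not have exactly two preimages. -/
structure Key8 : Type where
  κ₁ : P.Key
  κ₂ : P.Key
  u₁ : Bool
  u₂ : Bool

def gen8 : PMF P.Key8 :=
  P.gen.bind fun κ₁ => P.gen.bind fun κ₂ => coin.bind fun u₁ => coin.bind fun u₂ =>
    PMF.pure ⟨κ₁, κ₂, u₁, u₂⟩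

/-- Length of the report `(y, b)` of the server for a 4-states instance. -/
abbrev reportLen : ℕ := P.m * P.k + P.preimLen

/-- Length of the report `(y, b, y', b', s₁, s₂)` of the server for an 8-states instance. -/
abbrev report8Len : ℕ := 2 * P.reportLen + 2

variable {P}

def Key8.message (κ : P.Key8) : List Bool := κ.κ₁.message ++ κ.κ₂.message

/-- The bit `B₂` computed from an encoded report `(y, b)`. -/
def Key.valueBitOf (κ : P.Key) (report : List Bool) (u : Bool) : Bool :=
  κ.valueBit (decVec P.m P.k report) ((report.drop (P.m * P.k)).take P.preimLen) u

/-- The angle `θ = L₁ π + L₂ π/2 + L₃ π/4` (in units of `π/4`) that the client computes from the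
encoded report `(y, b, y', b', s₁, s₂)`. -/
def Key8.angle (κ : P.Key8) (report : List Bool) : Zq 3 :=
  let B₁ := κ.κ₁.d₀
  let C₁ := κ.κ₂.d₀
  let B₂ := κ.κ₁.valueBitOf report κ.u₁
  let C₂ := κ.κ₂.valueBitOf (report.drop P.reportLen) κ.u₂
  let s₁ := report.getD (2 * P.reportLen) false
  let s₂ := report.getD (2 * P.reportLen + 1) false
  let L₁ := xor (xor C₂ B₂) (B₁ && xor s₁ s₂)
  let L₂ := xor C₁ (xor B₂ s₂ && B₁)
  let L₃ := B₁
  (if L₁ then 4 else 0) + (if L₂ then 2 else 0) + (if L₃ then 1 else 0)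

end QFParams

/-! ### Measurement-based computation -/

/-- An MBQC graph on the qubits `0, …, N - 1`, with inputs, outputs and a flow; the qubits are
numbered in an order of measurement compatible with the flow.  Only the values of `flow` outside
`outputs` matter. -/
structure FlowGraph (N : ℕ) : Type where
  graph : SimpleGraph (Fin N)
  inputs : Set (Fin N)
  outputs : Set (Fin N)
  flow : Fin N → Fin N
  flow_not_input : ∀ i, i ∉ outputs → flow i ∉ inputs
  flow_adj : ∀ i, i ∉ outputs → graph.Adj i (flow i)
  flow_lt : ∀ i, i ∉ outputs → i < flow i
  flow_nbr_lt : ∀ i, i ∉ outputs → ∀ j, graph.Adj (flow i) j → j ≠ i → i < j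

namespace FlowGraph

variable {N : ℕ} (G : FlowGraph N)

/-- The X-dependency set of the qubit `i`. -/
def xDep (i : Fin N) : Set (Fin N) := {j | j ∉ G.outputs ∧ G.flow j = i}

/-- The Z-dependency set of the qubit `i`. -/
def zDep (i : Fin N) : Set (Fin N) := {j | j ∉ G.outputs ∧ G.graph.Adj (G.flow j) i ∧ j ≠ i}

end FlowGraph

open Classical in
/-- Parity of the bits `sbar j` over `j ∈ D`. -/
def parityOn {N : ℕ} (D : Set (Fin N)) (sbar : Fin N → Bool) : Bool :=
  decide (Odd (Finset.univ.filter fun j => j ∈ D ∧ sbar j = true).card)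

/-! ### Classical-client UBQC and blindness -/

/-- A measurement pattern on `N` qubits: an angle, in units of `π/4`, for each qubit. -/
abbrev Pattern (N : ℕ) : Type := Fin N → Zq 3

/-- The client of a classical-client UBQC protocol on `N` qubits: the distribution of its coins,
and, for given coins and pattern, its next message as a function of the messages of the server
received so far. -/
structure UBQCClient (N : ℕ) : Type 1 where
  Coins : Type
  dist : PMF Coins
  next : Coins → Pattern N → Responder

/-- The pattern encoded by the `number`-th block of `3 N` bits of a message. -/
def decPattern (N number : ℕ) (msg : List Bool) : Pattern N := decVec N 3 (msg.drop (number * (3 * N)))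

/-- The challenger of the blindness game: the first message of the adversary encodes two patterns,
the second of which is used if `c = true` and the first one otherwise; from then on the
challenger behaves as the client. -/
def blindnessChallenger {N : ℕ} (Cl : UBQCClient N) (c : Bool) (ω : Cl.Coins) : Responder
  | [] => []
  | patterns :: msgs => Cl.next ω (decPattern N (if c then 1 else 0) patterns) msgs

/-- Probability that the adversary guesses the bit `c` of the challenger. -/
def blindnessWinProb {N : ℕ} (Cl : UBQCClient N) (A : QCircuit) : ℝ :=
  expect coin fun c => expect Cl.dist fun ω => A.outProb (blindnessChallenger Cl c ω) c

/-- Computational adaptive blindness of a family of classical-client UBQC protocols. -/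
def AdaptivelyBlind {N : ℕ → ℕ} (Cl : (sec : ℕ) → UBQCClient (N sec)) : Prop :=
  ∀ A : ℕ → QCircuit, IsQPT A →
    ∃ ε : ℕ → ℝ, Negligible ε ∧ ∀ sec, blindnessWinProb (Cl sec) (A sec) ≤ 1 / 2 + ε sec

/-! ### QF-UBQC -/

namespace QFUBQC

variable (P : QFParams) {N : ℕ} (G : FlowGraph N)

/-- Randomness used by the client for one qubit: an 8-states QFactory instance and the one-time
pad `r` of the measurement outcome. -/
structure QubitCoins : Type where
  key : P.Key8
  r : Bool

def qubitCoins : PMF (QubitCoins P) :=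
  P.gen8.bind fun key => coin.bind fun r => PMF.pure ⟨key, r⟩

variable {P}

/-- The measurement angle `δ i = (-1) ^ sX φ i + sZ π + θ i + r i π`, in units of `π/4`.  Here
`reports` is the message with the QFactory reports of all qubits, `outcomes` is the list of messages
with the measurement outcomes reported afterwards, and the corrected outcomes of previous qubits
are `sbar j = s j ⊕ r j`. -/
def delta (ω : Fin N → QubitCoins P) (φ : Pattern N) (reports : List Bool)
    (outcomes : List (List Bool)) (i : Fin N) : Zq 3 :=
  let sbar : Fin N → Bool := fun j => xor ((outcomes.getD j []).getD 0 false) (ω j).r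
  let θ : Zq 3 := (ω i).key.angle (reports.drop (i * P.report8Len))
  (if parityOn (G.xDep i) sbar then -φ i else φ i) + (if parityOn (G.zDep i) sbar then 4 else 0)
    + θ + (if (ω i).r then 4 else 0)

/-- The messages of the client: first all public matrices and ciphertexts; after the reports of all
QFactory instances the angle of the qubit `0`; after each measurement outcome the angle of the next
qubit. -/
def next (ω : Fin N → QubitCoins P) (φ : Pattern N) : Responder
  | [] => (List.ofFn fun i => (ω i).key.message).flatten
  | reports :: outcomes =>
      if hi : outcomes.length < N then
        encZq (delta G ω φ reports outcomes ⟨outcomes.length, hi⟩)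
      else []

variable (P)

/-- The client of QF-UBQC, with one independent 8-states QFactory instance for each qubit. -/
def client : UBQCClient N where
  Coins := Fin N → QubitCoins P
  dist := iid (qubitCoins P) N
  next := next G

end QFUBQC

end

noncomputable section

/-! ### Asymptotic closure properties -/

/-! The proof is a hybrid argument over the qubits. In `hybrid` number `i` the first `i` qubits are
served honestly, while the others get uniform strings in place of their keys and a uniform angle.
Number `N` is the blindness game (`hybridProb_card`); number `0` contains no trace of the pattern,
so it is the same for both patterns (`hybridProb_zero`). Passing from `i + 1` to `i` concerns one
qubit and replaces its two keys one after the other.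

The bit `r i` enters, besides the angle of qubit `i`, only the corrections of later qubits, and
these already have ideal angles. Hence it is a one-time pad on that angle and hides `L₁`, the only
place where the value bit of the second instance occurs. The second trapdoor is now out of use: the
public matrix is replaced by a uniform one (leftover hash lemma) and the ciphertext by a uniform
vector (LWE), after which the second basis bit is independent of everything sent. This bit pads
`L₂`, which removes the value bit of the first instance, and the first key is replaced in the same
way. What remains is an angle made of three independent uniform bits; it is uniform modulo 8 and
absorbs the part that depends on the pattern.

Two points need care. The pads must work against an adaptive quantum server whose reports enter the
masked bits: a coin used in a single answer may be permuted depending on the messages received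
before (`sum_runProb_equiv`). And the LWE distinguishers must be small although they play the
client, decoding the reports for every key that is still in use. They are non-uniform, so all keys
and coins except the challenge are hardwired. The trapdoor leaves one candidate preimage for each
value of the last two components (`QFParams.Key.eq_candidate`), so that a value bit is a function of
eight bits with short straight-line programs (`QFParams.Key.valueBit_eq`,
`QFParams.computes_valueBit`), and `QCircuit.exists_simulate` turns these programs into gates on
classical ancillas. As the hardwired coins vary, one negligible bound is needed for all circuits of
a given size (`LWEHard.exists_uniform_bound`). The total loss is at most `2 N (ε + n k 2 ^ (-sec /
2))`. -/

theorem PolyBounded.mono {f g : ℕ → ℕ} (hg : PolyBounded g) (h : ∀ s, f s ≤ g s) :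
    PolyBounded f := by
  obtain ⟨p, hp⟩ := hg
  exact ⟨p, fun s => (h s).trans (hp s)⟩

theorem PolyBounded.const (c : ℕ) : PolyBounded fun _ => c :=
  ⟨Polynomial.C c, fun s => by simp⟩

theorem PolyBounded.add {f g : ℕ → ℕ} (hf : PolyBounded f) (hg : PolyBounded g) :
    PolyBounded fun s => f s + g s := by
  obtain ⟨p, hp⟩ := hf
  obtain ⟨r, hr⟩ := hg
  exact ⟨p + r, fun s => by simpa using Nat.add_le_add (hp s) (hr s)⟩

theorem PolyBounded.mul {f g : ℕ → ℕ} (hf : PolyBounded f) (hg : PolyBounded g) :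
    PolyBounded fun s => f s * g s := by
  obtain ⟨p, hp⟩ := hf
  obtain ⟨r, hr⟩ := hg
  exact ⟨p * r, fun s => by simpa using Nat.mul_le_mul (hp s) (hr s)⟩

theorem Negligible.add {f g : ℕ → ℝ} (hf : Negligible f) (hg : Negligible g) :
    Negligible fun s => f s + g s :=
  Asymptotics.SuperpolynomialDecay.add hf hg

theorem Negligible.const_mul {f : ℕ → ℝ} (hf : Negligible f) (c : ℝ) :
    Negligible fun s => c * f s :=
  Asymptotics.SuperpolynomialDecay.const_mul hf c

theorem Negligible.mono {f g : ℕ → ℝ} (hg : Negligible g) (h : ∀ s, |f s| ≤ |g s|) :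
    Negligible f :=
  Asymptotics.SuperpolynomialDecay.trans_abs_le hg h

theorem Negligible.polyBounded_mul {f : ℕ → ℝ} {g : ℕ → ℕ} (hf : Negligible f)
    (hg : PolyBounded g) : Negligible fun s => (g s : ℝ) * f s := by
  obtain ⟨p, hp⟩ := hg
  have h := Asymptotics.SuperpolynomialDecay.polynomial_mul hf (p.map (Nat.castRingHom ℝ))
  refine Negligible.mono h fun s => ?_
  have e : (Polynomial.eval (s : ℝ) (p.map (Nat.castRingHom ℝ))) = ((p.eval s : ℕ) : ℝ) := by
    rw [Polynomial.eval_natCast_map]; simp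
  simp only [e, abs_mul, Nat.abs_cast]
  exact mul_le_mul_of_nonneg_right (by exact_mod_cast hp s) (abs_nonneg _)

theorem negligible_pow {r : ℝ} (h0 : 0 ≤ r) (h1 : r < 1) : Negligible fun s => r ^ s := by
  intro n
  exact tendsto_pow_const_mul_const_pow_of_abs_lt_one n (by rwa [abs_of_nonneg h0])

/-! ### Expectations of functions with values in the unit interval -/

section Expect

variable {α β : Type}

/-- In `ENNReal` sums may be exchanged without summability conditions; the later rules for `expect`
go through this form, which is why they ask for values in the unit interval. -/
theorem expect_eq_toReal (p : PMF α) {f : α → ℝ} (hf : ∀ a, f a ∈ Set.Icc (0 : ℝ) 1) :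
    expect p f = (∑' a, p a * ENNReal.ofReal (f a)).toReal := by
  rw [ENNReal.tsum_toReal_eq]
  · simp only [expect, ENNReal.toReal_mul, ENNReal.toReal_ofReal (hf _).1]
  · exact fun a => ENNReal.mul_ne_top (p.apply_ne_top a) ENNReal.ofReal_ne_top

theorem tsum_mul_ofReal_le_one (p : PMF α) {f : α → ℝ} (hf : ∀ a, f a ∈ Set.Icc (0 : ℝ) 1) :
    ∑' a, p a * ENNReal.ofReal (f a) ≤ 1 := by
  rw [← p.tsum_coe]
  refine ENNReal.tsum_le_tsum fun a => ?_
  calc p a * ENNReal.ofReal (f a) ≤ p a * 1 := by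
        gcongr
        exact ENNReal.ofReal_le_one.2 (hf a).2
    _ = p a := mul_one _

theorem ofReal_expect (p : PMF α) {f : α → ℝ} (hf : ∀ a, f a ∈ Set.Icc (0 : ℝ) 1) :
    ENNReal.ofReal (expect p f) = ∑' a, p a * ENNReal.ofReal (f a) := by
  rw [expect_eq_toReal p hf, ENNReal.ofReal_toReal]
  exact ne_top_of_le_ne_top ENNReal.one_ne_top (tsum_mul_ofReal_le_one p hf)

theorem expect_mem (p : PMF α) {f : α → ℝ} (hf : ∀ a, f a ∈ Set.Icc (0 : ℝ) 1) :
    expect p f ∈ Set.Icc (0 : ℝ) 1 := by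
  rw [expect_eq_toReal p hf]
  exact ⟨ENNReal.toReal_nonneg, ENNReal.toReal_le_of_le_ofReal zero_le_one
    (by simpa using tsum_mul_ofReal_le_one p hf)⟩

theorem expect_pure (a : α) (f : α → ℝ) : expect (PMF.pure a) f = f a := by
  classical
  unfold expect
  rw [tsum_eq_single a]
  · simp
  · intro b hb
    simp [PMF.pure_apply, hb]

theorem expect_bind (p : PMF α) (g : α → PMF β) {f : β → ℝ}
    (hf : ∀ b, f b ∈ Set.Icc (0 : ℝ) 1) :
    expect (p.bind g) f = expect p fun a => expect (g a) f := by
  rw [expect_eq_toReal _ hf, expect_eq_toReal _ fun a => expect_mem (g a) hf]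
  congr 1
  simp only [ofReal_expect _ hf, PMF.bind_apply, ← ENNReal.tsum_mul_right, ← ENNReal.tsum_mul_left]
  rw [ENNReal.tsum_comm]
  simp only [mul_assoc]

theorem expect_comm (p : PMF α) (q : PMF β) {f : α → β → ℝ}
    (hf : ∀ a b, f a b ∈ Set.Icc (0 : ℝ) 1) :
    (expect p fun a => expect q fun b => f a b) = expect q fun b => expect p fun a => f a b := by
  rw [expect_eq_toReal _ fun a => expect_mem q (hf a),
    expect_eq_toReal _ fun b => expect_mem p fun a => hf a b]
  congr 1
  simp only [ofReal_expect q (hf _), ofReal_expect p (fun a => hf a _), ← ENNReal.tsum_mul_left]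
  rw [ENNReal.tsum_comm]
  simp only [mul_left_comm]

theorem summable_expect (p : PMF α) {f : α → ℝ} (hf : ∀ a, f a ∈ Set.Icc (0 : ℝ) 1) :
    Summable fun a => (p a).toReal * f a := by
  have h : Summable fun a => (p a).toReal :=
    ENNReal.summable_toReal (by rw [p.tsum_coe]; exact ENNReal.one_ne_top)
  refine Summable.of_nonneg_of_le (fun a => mul_nonneg ENNReal.toReal_nonneg (hf a).1)
    (fun a => ?_) h
  exact mul_le_of_le_one_right ENNReal.toReal_nonneg (hf a).2

theorem expect_const (p : PMF α) (c : ℝ) : (expect p fun _ => c) = c := by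
  unfold expect
  rw [tsum_mul_right, ← ENNReal.tsum_toReal_eq (fun a => p.apply_ne_top a), p.tsum_coe]
  simp

theorem expect_one_sub (p : PMF α) {f : α → ℝ} (hf : ∀ a, f a ∈ Set.Icc (0 : ℝ) 1) :
    (expect p fun a => 1 - f a) = 1 - expect p f := by
  have h := (summable_expect p (f := fun _ => (1 : ℝ)) (fun _ => by simp)).tsum_sub
    (summable_expect p hf)
  have h1 := expect_const p 1
  unfold expect at *
  rw [h1] at h
  rw [← h]
  exact tsum_congr fun a => by ring

/-- Two expectations are as close as their integrands. -/
theorem abs_expect_sub_le (p : PMF α) {f g : α → ℝ} (hf : ∀ a, f a ∈ Set.Icc (0 : ℝ) 1)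
    (hg : ∀ a, g a ∈ Set.Icc (0 : ℝ) 1) {c : ℝ} (h : ∀ a ∈ p.support, |f a - g a| ≤ c) :
    |expect p f - expect p g| ≤ c := by
  have hsub : expect p f - expect p g = ∑' a, (p a).toReal * (f a - g a) := by
    unfold expect
    rw [← (summable_expect p hf).tsum_sub (summable_expect p hg)]
    exact tsum_congr fun a => by ring
  have hp : Summable fun a => (p a).toReal :=
    ENNReal.summable_toReal (by rw [p.tsum_coe]; exact ENNReal.one_ne_top)
  have hle : ∀ a, |(p a).toReal * (f a - g a)| ≤ (p a).toReal * c := fun a => by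
    by_cases ha : p a = 0
    · simp [ha]
    · rw [abs_mul, abs_of_nonneg ENNReal.toReal_nonneg]
      exact mul_le_mul_of_nonneg_left (h a ((p.mem_support_iff a).2 ha)) ENNReal.toReal_nonneg
  have hs : Summable fun a => |(p a).toReal * (f a - g a)| :=
    Summable.of_nonneg_of_le (fun a => abs_nonneg _) hle (hp.mul_right c)
  rw [hsub]
  calc |∑' a, (p a).toReal * (f a - g a)| ≤ ∑' a, |(p a).toReal * (f a - g a)| := by
        simpa [Real.norm_eq_abs] using norm_tsum_le_tsum_norm (f := fun a =>
          (p a).toReal * (f a - g a)) (by simpa [Real.norm_eq_abs] using hs)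
    _ ≤ ∑' a, (p a).toReal * c := hs.tsum_le_tsum hle (hp.mul_right c)
    _ = c := expect_const p c

theorem expect_uniform [Fintype α] [Nonempty α] (f : α → ℝ) :
    expect (PMF.uniformOfFintype α) f = (∑ a, f a) / Fintype.card α := by
  unfold expect
  rw [tsum_fintype, Finset.sum_div]
  refine Finset.sum_congr rfl fun a _ => ?_
  simp [div_eq_inv_mul]

theorem expect_uniform_equiv [Fintype α] [Nonempty α] [Fintype β] [Nonempty β] (e : α ≃ β)
    (f : β → ℝ) :
    (expect (PMF.uniformOfFintype α) fun a => f (e a)) = expect (PMF.uniformOfFintype β) f := by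
  rw [expect_uniform, expect_uniform, Equiv.sum_comp e, Fintype.card_congr e]

theorem expect_coin (f : Bool → ℝ) : expect coin f = (f true + f false) / 2 := by
  unfold coin
  rw [expect_uniform]
  simp

/-- A coordinate of independent samples may be sampled again. -/
theorem expect_iid_update (p : PMF α) :
    ∀ {N : ℕ} (i : Fin N) {f : (Fin N → α) → ℝ}, (∀ ω, f ω ∈ Set.Icc (0 : ℝ) 1) →
      expect (iid p N) f =
        expect (iid p N) fun ω => expect p fun a => f (Function.update ω i a)
  | 0, i, _, _ => i.elim0
  | N + 1, i, f, hf => by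
    have hu : ∀ ω, (expect p fun a => f (Function.update ω i a)) ∈ Set.Icc (0 : ℝ) 1 :=
      fun ω => expect_mem p fun a => hf _
    have expand : ∀ {g : (Fin (N + 1) → α) → ℝ}, (∀ ω, g ω ∈ Set.Icc (0 : ℝ) 1) →
        expect (iid p (N + 1)) g =
          expect p fun a => expect (iid p N) fun ω => g (Fin.cons a ω) := fun hg => by
      rw [iid, expect_bind _ _ hg]
      congr 1
      funext a
      rw [expect_bind _ _ hg]
      simp only [expect_pure]
    rw [expand hf, expand hu]
    refine Fin.cases ?_ (fun j => ?_) i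
    · simp only [Fin.update_cons_zero]
      rw [expect_const]
      rw [expect_comm _ _ fun a ω => hf _]
    · congr 1
      funext a
      rw [expect_iid_update p j fun ω => hf _]
      congr 1
      funext ω
      congr 1
      funext b
      rw [Fin.cons_update]

theorem mem_support_iid (p : PMF α) :
    ∀ {N : ℕ} {ω : Fin N → α}, ω ∈ (iid p N).support → ∀ i, ω i ∈ p.support
  | 0, _, _, i => i.elim0
  | N + 1, ω, h, i => by
    rw [iid, PMF.mem_support_bind_iff] at h
    obtain ⟨a, ha, h⟩ := h
    rw [PMF.mem_support_bind_iff] at h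
    obtain ⟨g, hg, h⟩ := h
    rw [PMF.mem_support_pure_iff] at h
    subst h
    refine Fin.cases ?_ (fun j => ?_) i
    · simpa using ha
    · simpa using mem_support_iid p hg j

end Expect

/-! ### Probabilities of outcomes of interactive circuits -/

section RunProb

variable {w : ℕ}

theorem sum_flip (i : Fin w) (F : (Fin w → Bool) → ℝ) :
    ∑ x, F (Function.update x i (!(x i))) = ∑ x, F x := by
  refine Function.Bijective.sum_comp (Function.Involutive.bijective fun x => ?_) F
  ext j
  by_cases h : j = i
  · subst h; simp
  · simp [h]

theorem sum_update_xor (i : Fin w) (b : (Fin w → Bool) → Bool)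
    (hb : ∀ x c, b (Function.update x i c) = b x) (F : (Fin w → Bool) → ℝ) :
    ∑ x, F (Function.update x i (xor (x i) (b x))) = ∑ x, F x := by
  refine Function.Bijective.sum_comp (Function.Involutive.bijective fun x => ?_) F
  ext j
  by_cases h : j = i
  · subst h; simp [hb]
  · simp [h]

theorem had_pair (u v : ℂ) :
    ‖(1 / (Real.sqrt 2 : ℂ)) * (u + 1 * v)‖ ^ 2 + ‖(1 / (Real.sqrt 2 : ℂ)) * (u + -1 * v)‖ ^ 2 =
      ‖u‖ ^ 2 + ‖v‖ ^ 2 := by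
  have h2 : ‖(1 / (Real.sqrt 2 : ℂ))‖ ^ 2 = 1 / 2 := by
    rw [norm_div, norm_one, Complex.norm_real, Real.norm_of_nonneg (Real.sqrt_nonneg 2), div_pow,
      Real.sq_sqrt zero_le_two, one_pow]
  have hp := parallelogram_law_with_norm ℝ u v
  rw [norm_mul, norm_mul, mul_pow, mul_pow, h2, one_mul, neg_one_mul, ← sub_eq_add_neg]
  nlinarith

theorem Gate.sum_norm_sq_apply (g : Gate w) (ψ : QState w) :
    ∑ x, ‖g.apply ψ x‖ ^ 2 = ∑ x, ‖ψ x‖ ^ 2 := by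
  cases g with
  | had i =>
    -- The Hadamard gate mixes the amplitude at `x` only with that at the flipped string, so norms
    -- are compared pair by pair; the sum over all `x` counts each pair twice on both sides.
    have key : ∀ x : Fin w → Bool,
        ‖(Gate.had i).apply ψ x‖ ^ 2 +
          ‖(Gate.had i).apply ψ (Function.update x i (!(x i)))‖ ^ 2 =
        ‖ψ x‖ ^ 2 + ‖ψ (Function.update x i (!(x i)))‖ ^ 2 := fun x => by
      have hx : Function.update x i (x i) = x := Function.update_eq_self i x
      have hp := had_pair (ψ (Function.update x i false)) (ψ (Function.update x i true))
      cases hxi : x i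
      · rw [hxi] at hx
        rw [hx] at hp
        simp only [Gate.apply, hxi, Function.update_idem, Function.update_self, Bool.not_false,
          if_true, hx]
        simpa using hp
      · rw [hxi] at hx
        rw [hx] at hp
        simp only [Gate.apply, hxi, Function.update_idem, Function.update_self, Bool.not_true,
          if_true, hx]
        simp only [Bool.false_eq_true, if_false]
        linarith
    have h := Finset.sum_congr (s₁ := Finset.univ) rfl fun x _ => key x
    rw [Finset.sum_add_distrib, Finset.sum_add_distrib, sum_flip i fun x => ‖ψ x‖ ^ 2,
      sum_flip i fun x => ‖(Gate.had i).apply ψ x‖ ^ 2] at h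
    linarith
  | phase i =>
    refine Finset.sum_congr rfl fun x _ => ?_
    simp only [Gate.apply, norm_mul]
    split_ifs
    · rw [show (Real.pi : ℂ) * Complex.I / 4 = ((Real.pi / 4 : ℝ) : ℂ) * Complex.I by
        push_cast; ring, Complex.norm_exp_ofReal_mul_I, one_mul]
    · simp
  | flip i => exact sum_flip i fun x => ‖ψ x‖ ^ 2
  | cnot i j hne =>
    exact sum_update_xor j (fun x => x i) (fun x c => by simp [hne]) fun x => ‖ψ x‖ ^ 2
  | toffoli i j l h₁ h₂ =>
    exact sum_update_xor l (fun x => x i && x j) (fun x c => by simp [h₁, h₂])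
      fun x => ‖ψ x‖ ^ 2

theorem xorInto_cons (i : Fin w) (inp : List (Fin w)) (b : Bool) (msg : List Bool)
    (x : Fin w → Bool) :
    xorInto (i :: inp) (b :: msg) x = xorInto inp msg (Function.update x i (xor (x i) b)) := rfl

@[simp] theorem xorInto_nil_left (msg : List Bool) (x : Fin w → Bool) :
    xorInto [] msg x = x := rfl

@[simp] theorem xorInto_nil_right (inp : List (Fin w)) (x : Fin w → Bool) :
    xorInto inp [] x = x := by
  cases inp <;> rfl

theorem sum_xorInto (F : (Fin w → Bool) → ℝ) :
    ∀ (inp : List (Fin w)) (msg : List Bool), ∑ x, F (xorInto inp msg x) = ∑ x, F x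
  | [], _ => by simp
  | _ :: _, [] => by simp
  | i :: inp, b :: msg => by
    simp only [xorInto_cons]
    rw [sum_update_xor i (fun _ => b) (fun _ _ => rfl) fun x => F (xorInto inp msg x)]
    exact sum_xorInto F inp msg

theorem sum_norm_sq_project (out : List (Fin w)) (ψ : QState w) :
    ∑ a, ∑ x, ‖project out a ψ x‖ ^ 2 = ∑ x, ‖ψ x‖ ^ 2 := by
  rw [Finset.sum_comm]
  refine Finset.sum_congr rfl fun x _ => ?_
  rw [Finset.sum_eq_single fun j => x (out.get j)]
  · simp [project]
  · intro a _ ha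
    rw [project, if_neg, norm_zero, zero_pow two_ne_zero]
    exact fun h => ha (funext fun j => (h j).symm)
  · simp

theorem runProb_nonneg (S : Responder) (ans : Fin w) (o : Bool) :
    ∀ (prog : List (Instr w)) (hist : List (List Bool)) (ψ : QState w),
      0 ≤ runProb S ans o prog hist ψ
  | [], _, _ => Finset.sum_nonneg fun x _ => by split_ifs <;> positivity
  | .gate _ :: rest, _, _ => runProb_nonneg S ans o rest _ _
  | .exchange _ _ :: rest, _, _ => Finset.sum_nonneg fun a _ => runProb_nonneg S ans o rest _ _

/-- Gates, complete measurements and the XOR of an answer into wires all preserve the total squared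
norm, whatever the responder does. -/
theorem runProb_true_add_false (S : Responder) (ans : Fin w) :
    ∀ (prog : List (Instr w)) (hist : List (List Bool)) (ψ : QState w),
      runProb S ans true prog hist ψ + runProb S ans false prog hist ψ = ∑ x, ‖ψ x‖ ^ 2
  | [], _, ψ => by
    rw [runProb, runProb, ← Finset.sum_add_distrib]
    refine Finset.sum_congr rfl fun x _ => ?_
    cases x ans <;> simp
  | .gate g :: rest, _, ψ => by
    rw [runProb, runProb, runProb_true_add_false S ans rest, g.sum_norm_sq_apply]
  | .exchange out inp :: rest, hist, ψ => by
    rw [runProb, runProb, ← Finset.sum_add_distrib, ← sum_norm_sq_project out ψ]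
    refine Finset.sum_congr rfl fun a _ => ?_
    rw [runProb_true_add_false S ans rest,
      sum_xorInto fun x => ‖project out a ψ x‖ ^ 2]

theorem QCircuit.outProb_true_add_false (C : QCircuit) (S : Responder) :
    C.outProb S true + C.outProb S false = 1 := by
  rw [QCircuit.outProb, QCircuit.outProb, runProb_true_add_false,
    Finset.sum_eq_single fun _ => false]
  · simp
  · intro b _ hb
    simp [hb]
  · simp

theorem QCircuit.outProb_mem (C : QCircuit) (S : Responder) (o : Bool) :
    C.outProb S o ∈ Set.Icc (0 : ℝ) 1 := by
  have h := C.outProb_true_add_false S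
  have ht : 0 ≤ C.outProb S true := runProb_nonneg _ _ _ _ _ _
  have hf : 0 ≤ C.outProb S false := runProb_nonneg _ _ _ _ _ _
  cases o
  · exact ⟨hf, by linarith⟩
  · exact ⟨ht, by linarith⟩

/-- A run depends only on the answers that are still to come. -/
theorem runProb_congr {S S' : Responder} (ans : Fin w) (o : Bool) :
    ∀ (prog : List (Instr w)) (hist : List (List Bool)) (ψ : QState w),
      (∀ h, hist.length < h.length → S h = S' h) →
        runProb S ans o prog hist ψ = runProb S' ans o prog hist ψ
  | [], _, _, _ => rfl
  | .gate g :: rest, hist, ψ, hS => by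
    rw [runProb, runProb, runProb_congr ans o rest hist _ hS]
  | .exchange out inp :: rest, hist, ψ, hS => by
    rw [runProb, runProb]
    refine Finset.sum_congr rfl fun a _ => ?_
    rw [hS _ (by simp), runProb_congr ans o rest _ _ fun h hh => hS h ?_]
    simp at hh
    omega

/-- If only the answer to the `t`-th message depends on a uniform coin, then the coin may be
permuted in a way that depends on the messages received. -/
theorem sum_runProb_equiv {Ω Ω' : Type} [Fintype Ω] [Fintype Ω'] (S : Ω → Responder)
    (S' : Ω' → Responder) (t : ℕ) (hΩ : Fintype.card Ω = Fintype.card Ω')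
    (hne : ∀ ω ω' hist, hist.length ≠ t → S ω hist = S' ω' hist)
    (heq : ∀ hist, hist.length = t → ∃ e : Ω ≃ Ω', ∀ ω, S ω hist = S' (e ω) hist)
    (ans : Fin w) (o : Bool) :
    ∀ (prog : List (Instr w)) (hist : List (List Bool)) (ψ : QState w),
      ∑ ω, runProb (S ω) ans o prog hist ψ = ∑ ω, runProb (S' ω) ans o prog hist ψ
  | [], _, _ => by simp [runProb, hΩ]
  | .gate g :: rest, hist, ψ => by
    simp only [runProb]
    exact sum_runProb_equiv S S' t hΩ hne heq ans o rest hist _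
  | .exchange out inp :: rest, hist, ψ => by
    simp only [runProb]
    rw [Finset.sum_comm, Finset.sum_comm (γ := Ω')]
    refine Finset.sum_congr rfl fun a _ => ?_
    -- When the answer with the coin is due, the state does not depend on the coin yet, so the
    -- permutation for the present history can be applied; all later answers ignore the coin. At any
    -- other time the answers agree and the induction continues.
    by_cases ht : (hist ++ [List.ofFn a]).length = t
    · obtain ⟨e, he⟩ := heq _ ht
      rw [← Equiv.sum_comp e]
      refine Finset.sum_congr rfl fun ω _ => ?_
      rw [he ω]
      exact runProb_congr ans o rest _ _ fun h hh => hne _ _ _ (by omega)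
    · by_cases hc : IsEmpty Ω'
      · have : IsEmpty Ω := Fintype.card_eq_zero_iff.1 (by rw [hΩ]; exact Fintype.card_eq_zero)
        simp
      · rw [not_isEmpty_iff] at hc
        obtain ⟨ω'⟩ := hc
        obtain ⟨ω₀⟩ : Nonempty Ω :=
          Fintype.card_pos_iff.1 (by rw [hΩ]; exact Fintype.card_pos_iff.2 ⟨ω'⟩)
        have h1 : ∀ ω, S ω (hist ++ [List.ofFn a]) = S' ω' (hist ++ [List.ofFn a]) :=
          fun ω => hne ω ω' _ ht
        have h2 : ∀ ω, S' ω (hist ++ [List.ofFn a]) = S' ω' (hist ++ [List.ofFn a]) :=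
          fun ω => (hne ω₀ ω _ ht).symm.trans (h1 ω₀)
        simp only [h1, h2]
        exact sum_runProb_equiv S S' t hΩ hne heq ans o rest _ _

end RunProb

/-! ### Straight-line programs -/

section SLP

variable {X : Type}

/-- `SLP I l`: the Boolean functions in `l`, the last one first, are the successive values of a
straight-line program that reads the functions in `I`. -/
inductive SLP (I : Set (X → Bool)) : List (X → Bool) → Prop where
  | nil : SLP I []
  | load {l : List (X → Bool)} {f : X → Bool} (hl : SLP I l) (hf : f ∈ I) : SLP I (f :: l)
  | const {l : List (X → Bool)} (hl : SLP I l) (b : Bool) : SLP I ((fun _ => b) :: l)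
  | xor {l : List (X → Bool)} {f g : X → Bool} (hl : SLP I l) (hf : f ∈ l) (hg : g ∈ l) :
      SLP I ((fun x => Bool.xor (f x) (g x)) :: l)
  | and {l : List (X → Bool)} {f g : X → Bool} (hl : SLP I l) (hf : f ∈ l) (hg : g ∈ l) :
      SLP I ((fun x => f x && g x) :: l)

/-- The functions in `O` can be computed from those in `I` by a straight-line program with at most
`s` steps. -/
def Computes (I O : Set (X → Bool)) (s : ℕ) : Prop :=
  ∃ l, SLP I l ∧ (∀ f ∈ O, f ∈ l) ∧ l.length ≤ s

/-- The second program is run after the first one. Its loads from `O` cost nothing, because these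
functions are already in the list; all other steps are copied. -/
theorem SLP.cut {I O : Set (X → Bool)} {l₁ l₂ : List (X → Bool)} (h₁ : SLP I l₁)
    (hO : ∀ f ∈ O, f ∈ l₁) (h₂ : SLP (I ∪ O) l₂) :
    ∃ l, SLP I l ∧ (∀ f ∈ l₁, f ∈ l) ∧ (∀ f ∈ l₂, f ∈ l) ∧ l.length ≤ l₁.length + l₂.length := by
  induction h₂ with
  | nil => exact ⟨l₁, h₁, fun _ h => h, by simp, by simp⟩
  | @load l f _ hf ih =>
    obtain ⟨l', hl', k₁, k₂, hs⟩ := ih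
    rcases hf with hf | hf
    · exact ⟨f :: l', hl'.load hf, fun g hg => List.mem_cons_of_mem _ (k₁ g hg),
        fun g hg => (List.mem_cons.1 hg).elim (fun h => h ▸ List.mem_cons_self)
          fun h => List.mem_cons_of_mem _ (k₂ g h), by simp; omega⟩
    · exact ⟨l', hl', k₁, fun g hg => (List.mem_cons.1 hg).elim (fun h => h ▸ k₁ f (hO f hf))
          fun h => k₂ g h, by simp; omega⟩
  | const _ b ih =>
    obtain ⟨l', hl', k₁, k₂, hs⟩ := ih
    exact ⟨_, hl'.const b, fun g hg => List.mem_cons_of_mem _ (k₁ g hg),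
      fun g hg => (List.mem_cons.1 hg).elim (fun h => h ▸ List.mem_cons_self)
        fun h => List.mem_cons_of_mem _ (k₂ g h), by simp; omega⟩
  | xor _ hf hg ih =>
    obtain ⟨l', hl', k₁, k₂, hs⟩ := ih
    exact ⟨_, hl'.xor (k₂ _ hf) (k₂ _ hg), fun g hg => List.mem_cons_of_mem _ (k₁ g hg),
      fun g hg => (List.mem_cons.1 hg).elim (fun h => h ▸ List.mem_cons_self)
        fun h => List.mem_cons_of_mem _ (k₂ g h), by simp; omega⟩
  | and _ hf hg ih =>
    obtain ⟨l', hl', k₁, k₂, hs⟩ := ih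
    exact ⟨_, hl'.and (k₂ _ hf) (k₂ _ hg), fun g hg => List.mem_cons_of_mem _ (k₁ g hg),
      fun g hg => (List.mem_cons.1 hg).elim (fun h => h ▸ List.mem_cons_self)
        fun h => List.mem_cons_of_mem _ (k₂ g h), by simp; omega⟩

theorem SLP.mono {I J : Set (X → Bool)} (h : I ⊆ J) {l : List (X → Bool)} (hl : SLP I l) :
    SLP J l := by
  induction hl with
  | nil => exact .nil
  | load _ hf ih => exact ih.load (h hf)
  | const _ b ih => exact ih.const b
  | xor _ hf hg ih => exact ih.xor hf hg
  | and _ hf hg ih => exact ih.and hf hg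

namespace Computes

variable {I J O O' : Set (X → Bool)} {s t : ℕ}

theorem mono (h : Computes I O s) (hI : I ⊆ J) (hO : O' ⊆ O) (hs : s ≤ t) : Computes J O' t := by
  obtain ⟨l, hl, hO₁, hl'⟩ := h
  exact ⟨l, hl.mono hI, fun f hf => hO₁ f (hO hf), hl'.trans hs⟩

theorem mono_size (h : Computes I O s) (hs : s ≤ t) : Computes I O t :=
  h.mono subset_rfl subset_rfl hs

theorem mono_in (h : Computes I O s) (hI : I ⊆ J) : Computes J O s :=
  h.mono hI subset_rfl le_rfl

theorem mono_out (h : Computes I O s) (hO : O' ⊆ O) : Computes I O' s :=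
  h.mono subset_rfl hO le_rfl

theorem cut (h : Computes I O s) (h' : Computes (I ∪ O) O' t) : Computes I (O ∪ O') (s + t) := by
  obtain ⟨l, hl, hO, hs⟩ := h
  obtain ⟨l', hl', hO', ht⟩ := h'
  obtain ⟨m, hm, k₁, k₂, hms⟩ := hl.cut hO hl'
  exact ⟨m, hm, fun f hf => hf.elim (fun h => k₁ f (hO f h)) fun h => k₂ f (hO' f h), by omega⟩

theorem union (h : Computes I O s) (h' : Computes I O' t) : Computes I (O ∪ O') (s + t) :=
  h.cut (h'.mono_in Set.subset_union_left)

/-- Composition of straight-line programs. -/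
theorem comp (h : Computes I O s) (h' : Computes O O' t) : Computes I O' (s + t) :=
  (h.cut (h'.mono_in Set.subset_union_right)).mono_out Set.subset_union_right

theorem empty : Computes I ∅ 0 := ⟨[], .nil, by simp, by simp⟩

theorem load {f : X → Bool} (hf : f ∈ I) : Computes I {f} 1 :=
  ⟨[f], SLP.nil.load hf, by simp, by simp⟩

theorem const (b : Bool) : Computes I {fun _ => b} 1 :=
  ⟨_, SLP.nil.const b, by simp, by simp⟩

theorem xor {f g : X → Bool} (hf : Computes I {f} s) (hg : Computes I {g} t) :
    Computes I {fun x => Bool.xor (f x) (g x)} (s + t + 1) := by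
  obtain ⟨l, hl, hO, hs⟩ := hf.union hg
  exact ⟨_, hl.xor (hO f (Or.inl rfl)) (hO g (Or.inr rfl)), by simp, by simpa using hs⟩

theorem and {f g : X → Bool} (hf : Computes I {f} s) (hg : Computes I {g} t) :
    Computes I {fun x => f x && g x} (s + t + 1) := by
  obtain ⟨l, hl, hO, hs⟩ := hf.union hg
  exact ⟨_, hl.and (hO f (Or.inl rfl)) (hO g (Or.inr rfl)), by simp, by simpa using hs⟩

/-- Many functions computed one after the other, each from the previous ones. -/
theorem chain (O : ℕ → Set (X → Bool)) :
    ∀ n, (∀ i < n, Computes (I ∪ ⋃ j < i, O j) (O i) s) → Computes I (⋃ j < n, O j) (n * s)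
  | 0, _ => empty.mono subset_rfl (by simp) (by simp)
  | n + 1, h => by
    have h1 := (chain O n fun i hi => h i (by omega)).cut (h n (by omega))
    refine h1.mono subset_rfl ?_ (by rw [Nat.succ_mul])
    intro f hf
    simp only [Set.mem_iUnion] at hf
    obtain ⟨j, hj, hf⟩ := hf
    rcases Nat.lt_succ_iff_lt_or_eq.1 hj with hj | rfl
    · exact Or.inl (by simp only [Set.mem_iUnion]; exact ⟨j, hj, hf⟩)
    · exact Or.inr hf

theorem iUnion (O : ℕ → Set (X → Bool)) (n : ℕ) (h : ∀ i < n, Computes I (O i) s) :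
    Computes I (⋃ j < n, O j) (n * s) :=
  chain O n fun i hi => (h i hi).mono_in Set.subset_union_left

theorem iUnion_fin {n : ℕ} (O : Fin n → Set (X → Bool)) (h : ∀ i, Computes I (O i) s) :
    Computes I (⋃ j, O j) (n * s) := by
  refine (iUnion (fun i => if hi : i < n then O ⟨i, hi⟩ else ∅) n fun i hi => ?_).mono_out ?_
  · simpa [hi] using h ⟨i, hi⟩
  · intro f hf
    obtain ⟨j, hj⟩ := Set.mem_iUnion.1 hf
    simp only [Set.mem_iUnion]
    exact ⟨j, j.2, by simpa using hj⟩

/-- Number of steps that suffice for any Boolean function of `c` bits. -/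
def fnCost : ℕ → ℕ
  | 0 => 1
  | c + 1 => 3 * fnCost c + 5

/-- Shannon expansion in the first argument: `g = g₀ ⊕ b (g₁ ⊕ g₀)`. The cost is exponential in `c`,
which is harmless since it is applied to boundedly many bits only. -/
theorem fn : ∀ {c : ℕ} (g : (Fin c → Bool) → Bool) (f : Fin c → X → Bool),
    (∀ i, f i ∈ I) → Computes I {fun x => g fun i => f i x} (fnCost c)
  | 0, g, f, _ => by
    have e : (fun x => g fun i => f i x) = fun _ => g Fin.elim0 := by
      funext x
      congr 1
      exact Subsingleton.elim _ _
    rw [e]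
    exact const _
  | c + 1, g, f, hf => by
    have h : ∀ b : Bool, Computes I {fun x => g (Fin.cons b fun i : Fin c => f i.succ x)}
        (fnCost c) := fun b => fn (fun y => g (Fin.cons b y)) (fun i => f i.succ) fun i => hf _
    refine ((h false).xor ((load (hf 0)).and ((h true).xor (h false)))).mono subset_rfl
      (Set.singleton_subset_singleton.2 ?_) (by simp only [fnCost]; omega)
    funext x
    have e : (fun i => f i x) = Fin.cons (f 0 x) fun i : Fin c => f i.succ x :=
      (Fin.cons_self_tail fun i => f i x).symm
    rw [e]
    cases f 0 x <;> cases g (Fin.cons true fun i => f i.succ x) <;>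
      cases g (Fin.cons false fun i => f i.succ x) <;> rfl

theorem fn_le {c s : ℕ} (g : (Fin c → Bool) → Bool) (f : Fin c → X → Bool)
    (hf : ∀ i, Computes I {f i} s) :
    Computes I {fun x => g fun i => f i x} (c * s + fnCost c) :=
  (iUnion_fin (fun i => {f i}) hf).comp (fn g f fun i => Set.mem_iUnion.2 ⟨i, rfl⟩)

/-- The parity of many bits. -/
theorem xor_list {ι : Type} (f : ι → X → Bool) :
    ∀ L : List ι, (∀ i ∈ L, Computes I {f i} s) →
      Computes I {fun x => L.foldr (fun i b => Bool.xor (f i x) b) false} (L.length * (s + 1) + 1)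
  | [], _ => (const false).mono_size (by simp)
  | i :: L, h => by
    refine ((h i (by simp)).xor (xor_list f L fun j hj => h j (by simp [hj]))).mono_size ?_
    simp only [List.length_cons, Nat.succ_mul]
    omega

end Computes

end SLP

/-! ### Circuits with classical ancillas -/

section Embed

open Sum

variable {w W : ℕ} {K : Type} (e : Fin w ⊕ K ≃ Fin W)

/-- The values of the data wires. -/
def dataPart (z : Fin W → Bool) : Fin w → Bool := fun i => z (e (inl i))

/-- The values of the ancillas. -/
def ancPart (z : Fin W → Bool) : K → Bool := fun a => z (e (inr a))

/-- The state `ψ` on the data wires together with ancillas in the basis state `v`. -/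
def embedState [Fintype K] [DecidableEq K] (v : K → Bool) (ψ : QState w) : QState W :=
  fun z => if ancPart e z = v then ψ (dataPart e z) else 0

/-- A gate acting on the data wires. -/
def Gate.lift : Gate w → Gate W
  | .had i => .had (e (inl i))
  | .phase i => .phase (e (inl i))
  | .flip i => .flip (e (inl i))
  | .cnot i j h => .cnot (e (inl i)) (e (inl j)) (by simpa using h)
  | .toffoli i j l h₁ h₂ =>
      .toffoli (e (inl i)) (e (inl j)) (e (inl l)) (by simpa using h₁) (by simpa using h₂)

theorem ancPart_update_inl (z : Fin W → Bool) (i : Fin w) (c : Bool) :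
    ancPart e (Function.update z (e (inl i)) c) = ancPart e z := by
  funext a
  rw [ancPart, Function.update_of_ne (by simp), ancPart]

theorem dataPart_update_inl (z : Fin W → Bool) (i : Fin w) (c : Bool) :
    dataPart e (Function.update z (e (inl i)) c) = Function.update (dataPart e z) i c := by
  funext j
  by_cases h : j = i
  · subst h; simp [dataPart]
  · rw [dataPart, Function.update_of_ne (by simpa using h), Function.update_of_ne h, dataPart]

theorem dataPart_update_inr (z : Fin W → Bool) (k : K) (c : Bool) :
    dataPart e (Function.update z (e (inr k)) c) = dataPart e z := by
  funext a
  rw [dataPart, Function.update_of_ne (by simp), dataPart]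

theorem Gate.lift_apply [Fintype K] [DecidableEq K] (g : Gate w) (v : K → Bool) (ψ : QState w) :
    (g.lift e).apply (embedState e v ψ) = embedState e v (g.apply ψ) := by
  funext z
  have hd : ∀ i, z (e (inl i)) = dataPart e z i := fun _ => rfl
  cases g <;>
    simp only [Gate.lift, Gate.apply, embedState, ancPart_update_inl, dataPart_update_inl, hd] <;>
    split_ifs <;> simp

/-- The action of a list of gates, the first one applied first. -/
def applyAll {n : ℕ} (gs : List (Gate n)) (ψ : QState n) : QState n :=
  gs.foldl (fun φ g => g.apply φ) ψ

theorem applyAll_append {n : ℕ} (gs gs' : List (Gate n)) (ψ : QState n) :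
    applyAll (gs ++ gs') ψ = applyAll gs' (applyAll gs ψ) := by
  simp [applyAll]

theorem runProb_gates {n : ℕ} (S : Responder) (ans : Fin n) (o : Bool) (rest : List (Instr n))
    (hist : List (List Bool)) :
    ∀ (gs : List (Gate n)) (ψ : QState n),
      runProb S ans o (gs.map Instr.gate ++ rest) hist ψ =
        runProb S ans o rest hist (applyAll gs ψ)
  | [], _ => rfl
  | g :: gs, ψ => runProb_gates S ans o rest hist gs (g.apply ψ)

/-- The wire lists of an answer written into data wires from ancillas. -/
def answerGates : List (Fin w) → List K → List (Gate W)
  | i :: inp, k :: ks => answerGates inp ks ++ [.cnot (e (inr k)) (e (inl i)) (by simp)]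
  | _, _ => []

theorem length_answerGates_le : ∀ (inp : List (Fin w)) (ks : List K),
    (answerGates e inp ks).length ≤ inp.length
  | [], _ => by simp [answerGates]
  | _ :: _, [] => by simp [answerGates]
  | _ :: inp, _ :: ks => by simpa [answerGates] using length_answerGates_le inp ks

/-- Copying measured data wires to ancillas. -/
def copyGates : List (Fin w) → List K → List (Gate W)
  | i :: out, k :: ks => .cnot (e (inl i)) (e (inr k)) (by simp) :: copyGates out ks
  | _, _ => []

theorem length_copyGates_le : ∀ (out : List (Fin w)) (ks : List K),
    (copyGates e out ks).length ≤ out.length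
  | [], _ => by simp [copyGates]
  | _ :: _, [] => by simp [copyGates]
  | _ :: inp, _ :: ks => by simpa [copyGates] using length_copyGates_le inp ks


variable [DecidableEq K]

theorem ancPart_update_inr (z : Fin W → Bool) (k : K) (c : Bool) :
    ancPart e (Function.update z (e (inr k)) c) = Function.update (ancPart e z) k c := by
  funext j
  by_cases h : j = k
  · subst h; simp [ancPart]
  · rw [ancPart, Function.update_of_ne (by simpa using h), Function.update_of_ne h, ancPart]

theorem update_xor_eq_iff (k : K) (b : (K → Bool) → Bool)
    (hb : ∀ y c, b (Function.update y k c) = b y) (y v : K → Bool) :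
    Function.update y k (xor (y k) (b y)) = v ↔ y = Function.update v k (xor (v k) (b v)) := by
  constructor
  · rintro rfl
    simp [hb]
  · rintro rfl
    simp [hb]

variable [Fintype K]

/-- Adding to an ancilla a function of the other ancillas. -/
theorem embedState_update_inr (v : K → Bool) (ψ : QState w) (k : K) (b : (K → Bool) → Bool)
    (hb : ∀ y c, b (Function.update y k c) = b y) :
    (fun z => embedState e v ψ
      (Function.update z (e (inr k)) (xor (z (e (inr k))) (b (ancPart e z))))) =
      embedState e (Function.update v k (xor (v k) (b v))) ψ := by
  funext z
  have hd : z (e (inr k)) = ancPart e z k := rfl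
  simp only [embedState, dataPart_update_inr, ancPart_update_inr, hd,
    update_xor_eq_iff k b hb (ancPart e z) v]

/-- Adding an ancilla to a data wire. -/
theorem cnot_inr_inl_apply (v : K → Bool) (ψ : QState w) (k : K) (i : Fin w)
    (h : e (inr k) ≠ e (inl i)) :
    (Gate.cnot (e (inr k)) (e (inl i)) h).apply (embedState e v ψ) =
      embedState e v fun x => ψ (Function.update x i (xor (x i) (v k))) := by
  funext z
  simp only [Gate.apply, embedState, ancPart_update_inl, dataPart_update_inl]
  split_ifs with hz
  · rw [← hz]
    rfl
  · rfl

/-- Adding a data wire whose value is known to an ancilla. -/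
theorem cnot_inl_inr_apply (v : K → Bool) (ψ : QState w) (k : K) (i : Fin w) (b : Bool)
    (hψ : ∀ x, ψ x ≠ 0 → x i = b) (h : e (inl i) ≠ e (inr k)) :
    (Gate.cnot (e (inl i)) (e (inr k)) h).apply (embedState e v ψ) =
      embedState e (Function.update v k (xor (v k) b)) ψ := by
  rw [← embedState_update_inr e v ψ k (fun _ => b) fun _ _ => rfl]
  funext z
  simp only [Gate.apply, embedState, dataPart_update_inr]
  by_cases h0 : ψ (dataPart e z) = 0
  · simp [h0]
  · rw [← hψ _ h0]
    rfl

/-- A gate acts on a state through the argument of the amplitude function, so the gate applied last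
modifies the argument first. This is why `answerGates` lists the gates in reverse order. -/
theorem applyAll_answerGates (v : K → Bool) (ψ : QState w) :
    ∀ (inp : List (Fin w)) (ks : List K),
      applyAll (answerGates e inp ks) (embedState e v ψ) =
        embedState e v fun x => ψ (xorInto inp (ks.map v) x)
  | [], ks => by simp [answerGates, applyAll]
  | _ :: _, [] => by simp [answerGates, applyAll]
  | i :: inp, k :: ks => by
    rw [answerGates, applyAll_append, applyAll_answerGates v ψ inp ks]
    exact cnot_inr_inl_apply e v (fun x => ψ (xorInto inp (ks.map v) x)) k i (by simp)

/-- The hypothesis on `ψ` says that the wires `out` have just been measured with result `msg`. On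
such a state a CNOT into an ancilla creates no entanglement: the ancillas stay in a basis state. -/
theorem applyAll_copyGates (ψ : QState w) :
    ∀ (out : List (Fin w)) (ks : List K) (msg : List Bool) (v : K → Bool), ks.Nodup →
      out.length = ks.length → (∀ x, ψ x ≠ 0 → out.map x = msg) →
      ∃ v', applyAll (copyGates e out ks) (embedState e v ψ) = embedState e v' ψ ∧
        (∀ k ∉ ks, v' k = v k) ∧
          ∀ j (hj : j < ks.length), v' ks[j] = xor (v ks[j]) (msg.getD j false)
  | [], [], msg, v, _, _, _ => ⟨v, rfl, by simp, by simp⟩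
  | i :: out, k :: ks, msg, v, hn, hl, hψ => by
    -- Outcomes of amplitude zero also occur in the sum over outcomes. For them the hypothesis on
    -- `msg` is void, and the ancilla values are prescribed by hand.
    by_cases h0 : ψ = 0
    · refine ⟨fun k' => if h : k' ∈ k :: ks then
        xor (v k') (msg.getD ((k :: ks).idxOf k') false) else v k', ?_, ?_, ?_⟩
      · have z : ∀ v : K → Bool, embedState e v (0 : QState w) = 0 := fun v => by
          funext z; simp [embedState]
        have z' : ∀ gs : List (Gate W), applyAll gs (0 : QState W) = 0 := fun gs => by
          induction gs with
          | nil => rfl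
          | cons g gs ih =>
            rw [applyAll, List.foldl_cons]
            have : g.apply (0 : QState W) = 0 := by
              funext z; cases g <;> simp [Gate.apply]
            rw [this]
            exact ih
        rw [h0, z, z, z']
      · intro k' hk'
        simp only [hk', dite_false]
      · intro j hj
        simp only [List.getElem_mem, dite_true, hn.idxOf_getElem j hj]
    · obtain ⟨x₀, hx₀⟩ := Function.ne_iff.1 h0
      obtain ⟨b, msg, rfl⟩ : ∃ b m, msg = b :: m := ⟨_, _, (hψ x₀ hx₀).symm⟩
      obtain ⟨v', h1, h2, h3⟩ := applyAll_copyGates ψ out ks msg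
        (Function.update v k (xor (v k) b)) hn.of_cons (by simpa using hl)
        fun x hx => (List.cons.inj (hψ x hx)).2
      have hk : k ∉ ks := (List.nodup_cons.1 hn).1
      refine ⟨v', ?_, fun k' hk' => ?_, fun j hj => ?_⟩
      · rw [← h1, copyGates, applyAll, List.foldl_cons,
          cnot_inl_inr_apply e v ψ k i b fun x hx => (List.cons.inj (hψ x hx)).1]
        rfl
      · rw [h2 k' fun h => hk' (List.mem_cons_of_mem _ h), Function.update_of_ne]
        rintro rfl
        exact hk' List.mem_cons_self
      · cases j with
        | zero => simp [h2 k hk]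
        | succ j =>
          have hj' : j < ks.length := by simpa using hj
          simp only [List.getElem_cons_succ, List.getD_cons_succ]
          rw [h3 j hj', Function.update_of_ne]
          rintro h
          exact hk (h ▸ List.getElem_mem hj')

/-- Writing an answer into ancillas. -/
theorem embedState_xorInto (ψ : QState w) :
    ∀ (ks : List K) (msg : List Bool) (v : K → Bool), ks.Nodup →
      ∃ v', (fun z => embedState e v ψ (xorInto (ks.map fun k => e (inr k)) msg z)) =
          embedState e v' ψ ∧
        (∀ k ∉ ks, v' k = v k) ∧
          ∀ j (hj : j < ks.length), v' ks[j] = xor (v ks[j]) (msg.getD j false)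
  | [], msg, v, _ => ⟨v, by simp, by simp, by simp⟩
  | k :: ks, [], v, _ => ⟨v, by simp, by simp, by simp⟩
  | k :: ks, b :: msg, v, hn => by
    obtain ⟨v', h1, h2, h3⟩ := embedState_xorInto ψ ks msg v hn.of_cons
    have hk : k ∉ ks := (List.nodup_cons.1 hn).1
    refine ⟨Function.update v' k (xor (v' k) b), ?_, fun k' hk' => ?_, fun j hj => ?_⟩
    · rw [← embedState_update_inr e v' ψ k (fun _ => b) fun _ _ => rfl, ← h1]
      rfl
    · rw [Function.update_of_ne, h2 k' fun h => hk' (List.mem_cons_of_mem _ h)]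
      rintro rfl
      exact hk' List.mem_cons_self
    · cases j with
      | zero => simp [h2 k hk]
      | succ j =>
        have hj' : j < ks.length := by simpa using hj
        simp only [List.getElem_cons_succ, List.getD_cons_succ]
        rw [Function.update_of_ne, h3 j hj']
        rintro h
        exact hk (h ▸ List.getElem_mem hj')

/-! ### Straight-line programs as circuits -/

/-- The circuit `gs` takes ancillas `v` with `P x v` to `out x v`, which contains the values at `x` of
the functions in `l` on the scratch wires `scr 0, scr 1, …`. -/
structure CompilesTo {X : Type} {B : ℕ} (scr : Fin B → K) (P : X → (K → Bool) → Prop)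
    (l : List (X → Bool)) (gs : List (Gate W)) (out : X → (K → Bool) → K → Bool) : Prop where
  size : gs.length ≤ 2 * l.length
  action : ∀ x v, P x v → ∀ ψ,
    applyAll gs (embedState e v ψ) = embedState e (out x v) ψ
  off : ∀ x v, P x v → ∀ k, k ∉ Set.range scr → out x v k = v k
  zero : ∀ x v, P x v → ∀ b : Fin B, l.length ≤ b → out x v (scr b) = false
  val : ∀ f ∈ l, ∃ b : Fin B, (b : ℕ) < l.length ∧ ∀ x v, P x v → out x v (scr b) = f x

/-- The new step writes into the next scratch wire, which is still zero, and leaves the others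
alone. Earlier values are thus kept, and nothing has to be uncomputed. -/
theorem CompilesTo.cons {X : Type} {B : ℕ} {scr : Fin B → K} (hscr : Function.Injective scr)
    {P : X → (K → Bool) → Prop} {l : List (X → Bool)} {gs : List (Gate W)}
    {out : X → (K → Bool) → K → Bool} (h : CompilesTo e scr P l gs out) (f : X → Bool)
    (hB : l.length < B) (gs' : List (Gate W)) (hgs' : gs'.length ≤ 2)
    (hact : ∀ x v, P x v → ∀ ψ, applyAll gs' (embedState e (out x v) ψ) =
      embedState e (Function.update (out x v) (scr ⟨l.length, hB⟩) (f x)) ψ) :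
    CompilesTo e scr P (f :: l) (gs ++ gs')
      fun x v => Function.update (out x v) (scr ⟨l.length, hB⟩) (f x) where
  size := by
    have := h.size
    simp only [List.length_append, List.length_cons]
    omega
  action x v hv ψ := by rw [applyAll_append, h.action x v hv, hact x v hv]
  off x v hv k hk := by
    rw [Function.update_of_ne, h.off x v hv k hk]
    rintro rfl
    exact hk ⟨_, rfl⟩
  zero x v hv b hb := by
    simp only [List.length_cons] at hb
    rw [Function.update_of_ne, h.zero x v hv b (by omega)]
    intro hc
    have := congrArg Fin.val (hscr hc)
    simp only at this
    omega
  val g hg := by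
    rcases List.mem_cons.1 hg with rfl | hg
    · exact ⟨⟨l.length, hB⟩, by simp, fun x v _ => by simp⟩
    · obtain ⟨b, hb, hv⟩ := h.val g hg
      refine ⟨b, by simp only [List.length_cons]; omega, fun x v hP => ?_⟩
      rw [Function.update_of_ne, hv x v hP]
      intro hc
      have := congrArg Fin.val (hscr hc)
      simp only at this
      omega

/-- Straight-line programs are circuits. -/
theorem SLP.exists_compilesTo {X : Type} {B : ℕ} {scr : Fin B → K} (hscr : Function.Injective scr)
    {P : X → (K → Bool) → Prop} {I : Set (X → Bool)}
    (hI : ∀ f ∈ I, ∃ k, k ∉ Set.range scr ∧ ∀ x v, P x v → v k = f x)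
    (hP : ∀ x v, P x v → ∀ b, v (scr b) = false) {l : List (X → Bool)} (hl : SLP I l)
    (hB : l.length ≤ B) : ∃ gs out, CompilesTo e scr P l gs out := by
  induction hl with
  | nil => exact ⟨[], fun _ v => v, by simp, fun _ _ _ _ => rfl, fun _ _ _ _ _ => rfl,
      fun x v hv b _ => hP x v hv b, by simp⟩
  | @load l f hl hf ih =>
    have hB' : l.length < B := hB
    obtain ⟨gs, out, h⟩ := ih hB'.le
    obtain ⟨k, hk, hkv⟩ := hI f hf
    have hne : k ≠ scr ⟨l.length, hB'⟩ := fun hc => hk ⟨_, hc.symm⟩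
    refine ⟨_, _, h.cons e hscr f hB' [.cnot (e (inr k)) (e (inr (scr ⟨l.length, hB'⟩)))
      (by simpa using hne)] (by simp) fun x v hv ψ => ?_⟩
    have := embedState_update_inr e (out x v) ψ (scr ⟨l.length, hB'⟩) (fun y => y k)
      fun y c => by rw [Function.update_of_ne hne]
    rw [h.zero x v hv ⟨l.length, hB'⟩ le_rfl, h.off x v hv k hk, hkv x v hv, Bool.false_xor] at this
    exact this
  | @const l hl b ih =>
    have hB' : l.length < B := hB
    obtain ⟨gs, out, h⟩ := ih hB'.le
    refine ⟨_, _, h.cons e hscr _ hB' (if b then [.flip (e (inr (scr ⟨l.length, hB'⟩)))] else [])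
      (by split_ifs <;> simp) fun x v hv ψ => ?_⟩
    have := embedState_update_inr e (out x v) ψ (scr ⟨l.length, hB'⟩) (fun y => b)
      fun y c => rfl
    rw [h.zero x v hv ⟨l.length, hB'⟩ le_rfl, Bool.false_xor] at this
    rw [← this]
    cases b
    · simp [applyAll]
    · simp [applyAll, Gate.apply]
  | @xor l f g hl hf hg ih =>
    have hB' : l.length < B := hB
    obtain ⟨gs, out, h⟩ := ih hB'.le
    obtain ⟨a, ha, hav⟩ := h.val f hf
    obtain ⟨b, hb, hbv⟩ := h.val g hg
    have hna : scr a ≠ scr ⟨l.length, hB'⟩ := fun hc => by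
      have := congrArg Fin.val (hscr hc)
      simp only at this
      omega
    have hnb : scr b ≠ scr ⟨l.length, hB'⟩ := fun hc => by
      have := congrArg Fin.val (hscr hc)
      simp only at this
      omega
    refine ⟨_, _, h.cons e hscr _ hB' [.cnot (e (inr (scr a))) (e (inr (scr ⟨l.length, hB'⟩)))
      (by simpa using hna), .cnot (e (inr (scr b))) (e (inr (scr ⟨l.length, hB'⟩)))
      (by simpa using hnb)] (by simp) fun x v hv ψ => ?_⟩
    have h1 := embedState_update_inr e (out x v) ψ (scr ⟨l.length, hB'⟩) (fun y => y (scr a))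
      fun y c => by rw [Function.update_of_ne hna]
    rw [h.zero x v hv ⟨l.length, hB'⟩ le_rfl, Bool.false_xor, hav x v hv] at h1
    have h2 := embedState_update_inr e (Function.update (out x v) (scr ⟨l.length, hB'⟩) (f x)) ψ
      (scr ⟨l.length, hB'⟩) (fun y => y (scr b)) fun y c => by rw [Function.update_of_ne hnb]
    rw [Function.update_of_ne hnb, Function.update_self, Function.update_idem, hbv x v hv] at h2
    rw [← h2, ← h1]
    rfl
  | @and l f g hl hf hg ih =>
    have hB' : l.length < B := hB
    obtain ⟨gs, out, h⟩ := ih hB'.le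
    obtain ⟨a, ha, hav⟩ := h.val f hf
    obtain ⟨b, hb, hbv⟩ := h.val g hg
    have hna : scr a ≠ scr ⟨l.length, hB'⟩ := fun hc => by
      have := congrArg Fin.val (hscr hc)
      simp only at this
      omega
    have hnb : scr b ≠ scr ⟨l.length, hB'⟩ := fun hc => by
      have := congrArg Fin.val (hscr hc)
      simp only at this
      omega
    refine ⟨_, _, h.cons e hscr _ hB' [.toffoli (e (inr (scr a))) (e (inr (scr b)))
      (e (inr (scr ⟨l.length, hB'⟩))) (by simpa using hna) (by simpa using hnb)] (by simp)
      fun x v hv ψ => ?_⟩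
    have h1 := embedState_update_inr e (out x v) ψ (scr ⟨l.length, hB'⟩)
      (fun y => y (scr a) && y (scr b))
      fun y c => by rw [Function.update_of_ne hna, Function.update_of_ne hnb]
    rw [h.zero x v hv ⟨l.length, hB'⟩ le_rfl, Bool.false_xor, hav x v hv, hbv x v hv] at h1
    exact h1

end Embed

/-! ### Simulation of a responder by a circuit -/

section Simulate

open Sum

/-- A challenge together with the messages received so far. -/
abbrev View : Type := List Bool × List (List Bool)

def chBit (j : ℕ) : View → Bool := fun x => x.1.getD j false

def msgBit (t j : ℕ) : View → Bool := fun x => (x.2.getD t []).getD j false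

/-- The first `L` bits of the challenge and the first `J` bits of each of the first `T` messages. -/
def viewBits (L T J : ℕ) : Set (View → Bool) :=
  {f | (∃ j < L, f = chBit j) ∨ ∃ t < T, ∃ j < J, f = msgBit t j}

/-- Ancillas for a challenge of `L` bits, `T` messages of `J` bits and `T` computations with `B`
steps. -/
abbrev Ancilla (L T J B : ℕ) : Type := Fin L ⊕ (Fin T × Fin J) ⊕ (Fin T × Fin B)

structure Loaded {L T J B : ℕ} (x : View) (t : ℕ) (v : Ancilla L T J B → Bool) : Prop where
  ch : ∀ j : Fin L, v (inl j) = chBit j x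
  msg : ∀ (t' : Fin T) (j : Fin J), v (inr (inl (t', j))) = msgBit t' j x
  scratch : ∀ (t' : Fin T) (b : Fin B), t ≤ t' → v (inr (inr (t', b))) = false

/-- An LWE challenge is a constant responder, so the messages sent by the simulating circuit, which
differ from those of the simulated one, do not matter. -/
theorem runProb_const_hist {w : ℕ} (ch : List Bool) (ans : Fin w) (o : Bool) :
    ∀ (prog : List (Instr w)) (hist hist' : List (List Bool)) (ψ : QState w),
      runProb (fun _ => ch) ans o prog hist ψ = runProb (fun _ => ch) ans o prog hist' ψ
  | [], _, _, _ => rfl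
  | .gate g :: rest, hist, hist', ψ => by
    rw [runProb, runProb, runProb_const_hist ch ans o rest hist hist']
  | .exchange out inp :: rest, hist, hist', ψ => by
    rw [runProb, runProb]
    exact Finset.sum_congr rfl fun a _ => runProb_const_hist ch ans o rest _ _ _

variable {w W : ℕ} {K : Type} [DecidableEq K] [Fintype K] (e : Fin w ⊕ K ≃ Fin W)

/-- With no input wires the answer is discarded. An exchange thus serves the simulating circuit as
an intermediate measurement, the gate set containing none. -/
theorem runProb_measure (ch : List Bool) (ans : Fin W) (o : Bool) (rest : List (Instr W))
    (hist : List (List Bool)) (out : List (Fin w)) (v : K → Bool) (ψ : QState w) :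
    runProb (fun _ => ch) ans o (.exchange (out.map fun i => e (inl i)) [] :: rest) hist
        (embedState e v ψ) =
      ∑ a : Fin out.length → Bool,
        runProb (fun _ => ch) ans o rest hist (embedState e v (project out a ψ)) := by
  rw [runProb]
  have hl : (out.map fun i => e (inl i)).length = out.length := List.length_map _
  rw [← Equiv.sum_comp (Equiv.arrowCongr (finCongr hl) (Equiv.refl Bool))]
  refine Finset.sum_congr rfl fun a _ => ?_
  rw [runProb_const_hist ch ans o rest _ hist]
  congr 1
  funext z
  simp only [project, embedState, xorInto_nil_left]
  have hiff : (∀ j, z ((out.map fun i => e (inl i)).get j) = a j) ↔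
      ∀ j, dataPart e z (out.get j) =
        (Equiv.arrowCongr (finCongr hl) (Equiv.refl Bool)) a j := by
    refine ⟨fun h j => ?_, fun h j => ?_⟩
    · have := h (Fin.cast hl.symm j)
      simpa [dataPart] using this
    · have := h (Fin.cast hl j)
      simpa [dataPart] using this
  simp only [hiff]
  split_ifs <;> simp_all

theorem runProb_lift_nil (ch : List Bool) (ans : Fin w) (o : Bool)
    (hist hist' : List (List Bool)) (S : Responder) (v : K → Bool) (ψ : QState w) :
    runProb (fun _ => ch) (e (inl ans)) o [] hist' (embedState e v ψ) =
      runProb S ans o [] hist ψ := by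
  simp only [runProb]
  let E : (Fin w → Bool) × (K → Bool) ≃ (Fin W → Bool) :=
    (Equiv.sumArrowEquivProdArrow (Fin w) K Bool).symm.trans
      (Equiv.arrowCongr e (Equiv.refl Bool))
  have hd : ∀ p, dataPart e (E p) = p.1 := fun p => by
    funext i
    simp [E, dataPart]
    rfl
  have ha : ∀ p, ancPart e (E p) = p.2 := fun p => by
    funext i
    simp [E, ancPart]
    rfl
  rw [← Equiv.sum_comp E, Fintype.sum_prod_type]
  refine Finset.sum_congr rfl fun x _ => ?_
  rw [Finset.sum_eq_single v]
  · have h1 : E (x, v) (e (inl ans)) = x ans := congrFun (hd (x, v)) ans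
    simp [embedState, hd, ha, h1]
  · intro y _ hy
    simp [embedState, ha, hy]
  · simp

theorem exists_forall₂ {α β : Type} {R : α → β → Prop} :
    ∀ l : List α, (∀ a ∈ l, ∃ b, R a b) → ∃ m : List β, List.Forall₂ R l m
  | [], _ => ⟨[], .nil⟩
  | a :: l, h => by
    obtain ⟨b, hb⟩ := h a (by simp)
    obtain ⟨m, hm⟩ := exists_forall₂ l fun a' ha' => h a' (by simp [ha'])
    exact ⟨b :: m, .cons hb hm⟩

theorem getD_append_singleton (hist : List (List Bool)) (msg : List Bool) (t : ℕ) :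
    (hist ++ [msg]).getD t [] = if t = hist.length then msg else hist.getD t [] := by
  rcases lt_trichotomy t hist.length with h | rfl | h
  · rw [if_neg h.ne, List.getD_append _ _ _ _ h]
  · rw [if_pos rfl, List.getD_append_right _ _ _ _ le_rfl]
    simp
  · rw [if_neg h.ne', List.getD_eq_default, List.getD_eq_default]
    · exact h.le
    · simp
      omega

/-- The messages of a circuit in one exchange, and the answers of the simulated responder. -/
theorem exists_simulate_prog {L T J B : ℕ} (e : Fin w ⊕ Ancilla L T J B ≃ Fin W)
    (S : List Bool → Responder)
    (hS : ∀ t < T, ∃ fs : List (View → Bool), Computes (viewBits L T J) {f | f ∈ fs} B ∧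
      ∀ ch hist, hist.length = t + 1 → S ch hist = fs.map fun f => f (ch, hist))
    (ans : Fin w) (o : Bool) :
    ∀ (prog : List (Instr w)) (t : ℕ), t + prog.length ≤ T →
      (∀ i ∈ prog, i.size ≤ J) →
      ∃ prog' : List (Instr W),
        (prog'.map Instr.size).sum ≤ 2 * (prog.map Instr.size).sum + 2 * B * prog.length ∧
        ∀ ch hist hist' v ψ, hist.length = t → Loaded (ch, hist) t v →
          runProb (fun _ => ch) (e (inl ans)) o prog' hist' (embedState e v ψ) =
            runProb (S ch) ans o prog hist ψ
  | [], _, _, _ => ⟨[], by simp, fun ch hist hist' v ψ _ _ => runProb_lift_nil e ch ans o _ _ _ v ψ⟩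
  | .gate g :: rest, t, ht, hJ => by
    simp only [List.length_cons] at ht
    obtain ⟨prog', hs, h⟩ := exists_simulate_prog e S hS ans o rest t (by omega)
      fun i hi => hJ i (List.mem_cons_of_mem _ hi)
    refine ⟨.gate (g.lift e) :: prog', ?_, fun ch hist hist' v ψ hl hv => ?_⟩
    · simp only [List.map_cons, List.sum_cons, Instr.size, List.length_cons, Nat.mul_succ]
      omega
    · rw [runProb, runProb, Gate.lift_apply, h ch hist _ v _ hl hv]
  | .exchange out inp :: rest, t, ht, hJ => by
    simp only [List.length_cons] at ht
    have htT : t < T := by omega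
    have hout : out.length ≤ J := by
      have := hJ (.exchange out inp) (by simp)
      simp only [Instr.size] at this
      omega
    obtain ⟨prog', hs, h⟩ := exists_simulate_prog e S hS ans o rest (t + 1) (by omega)
      fun i hi => hJ i (List.mem_cons_of_mem _ hi)
    obtain ⟨fs, ⟨l, hl, hfl, hlB⟩, hfs⟩ := hS t htT
    -- The exchange number `t` has its own row of message ancillas and its own row of scratch
    -- ancillas, untouched until then.
    let mem : Fin out.length → Ancilla L T J B := fun j => inr (inl (⟨t, htT⟩, Fin.castLE hout j))
    have hmem : Function.Injective mem := fun a b hab => by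
      simpa [mem, Fin.ext_iff] using hab
    let scr : Fin B → Ancilla L T J B := fun b => inr (inr (⟨t, htT⟩, b))
    have hscr : Function.Injective scr := fun a b hab => by simpa [scr] using hab
    obtain ⟨gs, outv, hgs⟩ := hl.exists_compilesTo e hscr
      (P := fun (x : View) v => Loaded x t v) (fun f hf => by
        rcases hf with ⟨j, hj, rfl⟩ | ⟨t', ht', j, hj, rfl⟩
        · exact ⟨inl ⟨j, hj⟩, by simp [scr], fun x v hv => hv.ch ⟨j, hj⟩⟩
        · exact ⟨inr (inl (⟨t', ht'⟩, ⟨j, hj⟩)), by simp [scr],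
            fun x v hv => hv.msg ⟨t', ht'⟩ ⟨j, hj⟩⟩)
      (fun x v hv b => hv.scratch _ _ le_rfl) hlB
    obtain ⟨bs, hbs⟩ := exists_forall₂ (R := fun f (b : Fin B) => ∀ x v, Loaded x t v →
      outv x v (scr b) = f x) fs fun f hf => by
        obtain ⟨b, _, hb⟩ := hgs.val f (hfl f hf)
        exact ⟨b, hb⟩
    -- Measure the outgoing wires, copy the outcome to the ancillas, compute the answer there, and
    -- add it to the incoming wires. This is at most `1 + 2 out + inp + 2 B` operations.
    refine ⟨.exchange (out.map fun i => e (inl i)) [] ::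
      ((copyGates e out (List.ofFn mem) ++ gs ++ answerGates e inp (bs.map scr)).map Instr.gate ++
        prog'), ?_, fun ch hist hist' v ψ hlen hv => ?_⟩
    · have h1 := length_copyGates_le e out (List.ofFn mem)
      have h2 := length_answerGates_le e inp (bs.map scr)
      have h3 := hgs.size
      have h4 : ∀ gs' : List (Gate W), ((gs'.map Instr.gate).map Instr.size).sum = gs'.length :=
        fun gs' => by
          rw [List.map_map]
          simp [Function.comp_def, Instr.size]
      simp only [List.map_cons, List.sum_cons, List.map_append, List.sum_append, h4, Instr.size,
        List.length_cons, Nat.mul_succ, List.length_map, List.length_nil]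
      omega
    · rw [runProb_measure, runProb]
      refine Finset.sum_congr rfl fun a _ => ?_
      rw [runProb_gates, applyAll_append, applyAll_append]
      obtain ⟨v₁, hv₁, hoff, hon⟩ := applyAll_copyGates e (project out a ψ) out (List.ofFn mem)
        (List.ofFn a) v (List.nodup_ofFn.2 hmem) (by simp) fun x hx => by
          have hx' : ∀ j : Fin out.length, x (out.get j) = a j := by
            by_contra hc
            exact hx (if_neg hc)
          refine List.ext_getElem (by simp) fun j h1 h2 => ?_
          simpa using hx' ⟨j, by simpa using h1⟩
      have hv₁' : Loaded (ch, hist ++ [List.ofFn a]) t v₁ := by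
        refine ⟨fun j => ?_, fun t' j => ?_, fun t' b hb => ?_⟩
        · rw [hoff _ (by simp [mem, List.mem_ofFn]), hv.ch]
          rfl
        · simp only [msgBit]
          rw [getD_append_singleton]
          by_cases hmm : inr (inl (t', j)) ∈ List.ofFn mem
          · obtain ⟨i, hi⟩ := (List.mem_ofFn' _ _).1 hmm
            have h5 := hon i (by simp)
            simp only [List.getElem_ofFn] at h5
            simp only [mem, inr.injEq, inl.injEq, Prod.mk.injEq] at hi
            obtain ⟨rfl, rfl⟩ := hi
            simp only [mem] at h5
            rw [h5, hv.msg]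
            simp only [msgBit]
            rw [if_pos hlen.symm, List.getD_eq_default (l := hist) _ (by omega)]
            simp
          · rw [hoff _ hmm, hv.msg]
            simp only [msgBit]
            -- The ancillas of the current row beyond the length of the message are still zero, in
            -- agreement with the default value for missing bits.
            split_ifs with h6
            · have h7 : (out.length) ≤ j := by
                by_contra hc
                refine hmm ((List.mem_ofFn' _ _).2 ⟨⟨j, by omega⟩, ?_⟩)
                simp only [mem, inr.injEq, inl.injEq, Prod.mk.injEq, Fin.ext_iff]
                simp
                omega
              rw [List.getD_eq_default (l := hist) _ (by omega),
                List.getD_eq_default (l := List.ofFn a) _ (by simpa using h7)]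
              simp
            · rfl
        · rw [hoff _ (by simp [mem, List.mem_ofFn]), hv.scratch t' b hb]
      rw [hv₁, hgs.action _ _ hv₁', applyAll_answerGates,
        hfs ch (hist ++ [List.ofFn a]) (by simp [hlen])]
      have hmap : (bs.map scr).map (outv (ch, hist ++ [List.ofFn a]) v₁) =
          fs.map fun f => f (ch, hist ++ [List.ofFn a]) := by
        clear hfs hfl
        induction hbs with
        | nil => rfl
        | cons hb _ ih =>
          simp only [List.map_cons]
          rw [hb _ _ hv₁', ih]
      rw [hmap]
      refine h ch _ _ _ _ (by simp [hlen]) ⟨fun j => ?_, fun t' j => ?_, fun t' b hb => ?_⟩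
      · rw [hgs.off _ _ hv₁' _ (by simp [scr]), hv₁'.ch]
      · rw [hgs.off _ _ hv₁' _ (by simp [scr]), hv₁'.msg]
      · rw [hgs.off _ _ hv₁' _ (by simp [scr, Fin.ext_iff]; omega), hv₁'.scratch _ _ (by omega)]

/-- The size of the circuit that simulates a responder, for a circuit of size `a` and a challenge of
`L` bits, with messages of `J` bits, when the answers are computed in `B` steps. -/
def simSize (a L J B : ℕ) : ℕ := 3 * a + 2 * L + 1 + a * J + 3 * (a * B)

/-- A circuit that interacts with a responder whose answers are computed from a challenge and from
the messages by short straight-line programs is simulated by a circuit that only receives the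
challenge. -/
theorem QCircuit.exists_simulate (C : QCircuit) {L J B : ℕ} (hJ : C.size ≤ J)
    (S : List Bool → Responder)
    (hS : ∀ t < C.prog.length, ∃ fs : List (View → Bool),
      Computes (viewBits L C.prog.length J) {f | f ∈ fs} B ∧
        ∀ ch hist, hist.length = t + 1 → S ch hist = fs.map fun f => f (ch, hist))
    (o : Bool) :
    ∃ D : QCircuit, D.size ≤ simSize C.size L J B ∧
      ∀ ch, D.outProb (fun _ => ch) o = C.outProb (S ch) o := by
  have hsz : ∀ i ∈ C.prog, i.size ≤ C.size := fun i hi =>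
    (List.single_le_sum (by simp) _ (List.mem_map_of_mem hi)).trans (Nat.le_add_left _ _)
  have hT : C.prog.length ≤ C.size := by
    have h1 : ∀ n ∈ C.prog.map Instr.size, 1 ≤ n := fun n hn => by
      obtain ⟨i, _, rfl⟩ := List.mem_map.1 hn
      cases i <;> simp only [Instr.size] <;> omega
    have := List.length_le_sum_of_one_le _ h1
    rw [List.length_map] at this
    exact this.trans (Nat.le_add_left _ _)
  set T := C.prog.length with hTdef
  let e : Fin C.wires ⊕ Ancilla L T J B ≃ Fin (C.wires + (L + (T * J + T * B))) :=
    (Equiv.sumCongr (Equiv.refl _) ((Equiv.sumCongr (Equiv.refl _)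
      ((Equiv.sumCongr finProdFinEquiv finProdFinEquiv).trans finSumFinEquiv)).trans
        finSumFinEquiv)).trans finSumFinEquiv
  obtain ⟨prog', hs, h⟩ := exists_simulate_prog e S hS C.answer o C.prog 0 (by omega)
    fun i hi => (hsz i hi).trans hJ
  let ks : List (Ancilla L T J B) := List.ofFn fun j : Fin L => inl j
  have hks : ks.Nodup := List.nodup_ofFn.2 inl_injective
  -- The first exchange sends the empty message and stores the challenge in its ancillas; it is the
  -- only one whose answer is read.
  refine ⟨⟨_, e (inl C.answer), .exchange [] (ks.map fun k => e (inr k)) :: prog'⟩, ?_,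
    fun ch => ?_⟩
  · have h1 : (C.prog.map Instr.size).sum + C.wires = C.size := by
      rw [QCircuit.size, add_comm]
    have h2 : T * J ≤ C.size * J := Nat.mul_le_mul_right _ hT
    have h3 : T * B ≤ C.size * B := Nat.mul_le_mul_right _ hT
    have h4 : 2 * B * T = 2 * (T * B) := by ring
    rw [← hTdef, h4] at hs
    simp only [QCircuit.size, simSize, List.map_cons, List.sum_cons, Instr.size, List.length_nil,
      List.length_map, ks, List.length_ofFn]
    simp only [QCircuit.size] at h1 h2 h3
    omega
  · obtain ⟨v, hv, hoff, hon⟩ := embedState_xorInto e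
      (fun x : Fin C.wires → Bool => if x = fun _ => false then (1 : ℂ) else 0) ks ch
      (fun _ => false) hks
    have hL : Loaded (ch, []) 0 v := by
      refine ⟨fun j => ?_, fun t' j => ?_, fun t' b _ => ?_⟩
      · have := hon j (by simp [ks])
        simpa [ks, chBit] using this
      · rw [hoff _ (by simp [ks, List.mem_ofFn])]
        simp [msgBit]
      · rw [hoff _ (by simp [ks, List.mem_ofFn])]
    rw [QCircuit.outProb, QCircuit.outProb, ← h ch [] [[]] v _ rfl hL, runProb]
    have : Unique (Fin ([] : List (Fin (C.wires + (L + (T * J + T * B))))).length → Bool) :=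
      inferInstanceAs (Unique (Fin 0 → Bool))
    rw [Fintype.sum_unique, ← hv]
    simp only [List.nil_append]
    congr 1
    funext z
    have h0 : project [] (default : Fin ([] : List (Fin (C.wires + (L + (T * J + T * B))))).length → Bool)
        (fun x => if x = fun _ => false then (1 : ℂ) else 0) =
        embedState e (fun _ => false)
          fun x : Fin C.wires → Bool => if x = fun _ => false then (1 : ℂ) else 0 := by
      funext y
      simp only [project, embedState]
      rw [if_pos (fun j => j.elim0), ← ite_and]
      congr 1
      refine propext ⟨?_, fun hy => ?_⟩
      · rintro rfl
        exact ⟨rfl, rfl⟩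
      · funext i
        obtain ⟨k, rfl⟩ := e.surjective i
        cases k with
        | inl i => exact congrFun hy.2 i
        | inr k => exact congrFun hy.1 k
    exact congrFun h0 _

end Simulate

/-! ### Trapdoor inversion -/

section Rounding

variable {k : ℕ}

theorem natAbs_valMinAbs_sum_le {ι : Type} (s : Finset ι) (f : ι → Zq k) :
    (∑ i ∈ s, f i).valMinAbs.natAbs ≤ ∑ i ∈ s, (f i).valMinAbs.natAbs := by
  classical
  induction s using Finset.induction_on with
  | empty => simp
  | insert a s ha ih =>
    rw [Finset.sum_insert ha, Finset.sum_insert ha]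
    have h := ZMod.natAbs_valMinAbs_add_le (f a) (∑ i ∈ s, f i)
    have h' := Int.natAbs_add_le (f a).valMinAbs (∑ i ∈ s, f i).valMinAbs
    omega

/-- Rounding removes an error of less than `q / 4`. -/
theorem testBit_round (hk : 0 < k) (β : ℕ) (hβ : β < 2) (η : Zq k)
    (hη : 4 * η.valMinAbs.natAbs < 2 ^ k) :
    ((2 ^ (k - 1) : Zq k) * β + η + ((2 ^ k / 4 : ℕ) : Zq k)).val.testBit (k - 1) =
      decide (β = 1) := by
  obtain ⟨l, rfl⟩ : ∃ l, k = l + 1 := ⟨k - 1, by omega⟩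
  simp only [Nat.add_sub_cancel]
  set h := η.valMinAbs with hh
  have hcast : ((h : ℤ) : Zq (l + 1)) = η := ZMod.coe_valMinAbs η
  have hq : (2 : ℕ) ^ (l + 1) = 2 * 2 ^ l := by rw [pow_succ]; ring
  -- Adding `q / 4` moves the noise from `(-q/4, q/4)` into `[0, q/2)`, below the top bit. For `k =
  -- 1` the quotient `q / 4` is `0`, but then the hypothesis forces `η = 0`.
  have hsmall : 0 ≤ h + ((2 ^ (l + 1) / 4 : ℕ) : ℤ) ∧
      h + ((2 ^ (l + 1) / 4 : ℕ) : ℤ) < ((2 ^ l : ℕ) : ℤ) := by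
    cases l with
    | zero => simp at hη ⊢; omega
    | succ l =>
      have h4 : (2 : ℕ) ^ (l + 1 + 1) = 4 * 2 ^ l := by rw [pow_succ, pow_succ]; ring
      have h2 : (2 : ℕ) ^ (l + 1) = 2 * 2 ^ l := by rw [pow_succ]; ring
      rw [h4] at hη ⊢
      rw [h2]
      omega
  obtain ⟨a, ha⟩ := Int.eq_ofNat_of_zero_le hsmall.1
  have ha' : a < 2 ^ l := by
    have := hsmall.2
    rw [ha] at this
    exact_mod_cast this
  have hval : ((2 ^ l : Zq (l + 1)) * β + η + ((2 ^ (l + 1) / 4 : ℕ) : Zq (l + 1))) =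
      ((2 ^ l * β + a : ℕ) : Zq (l + 1)) := by
    have : ((h + ((2 ^ (l + 1) / 4 : ℕ) : ℤ) : ℤ) : Zq (l + 1)) = ((a : ℤ) : Zq (l + 1)) := by
      rw [ha]
    rw [Int.cast_add, hcast, Int.cast_natCast, Int.cast_natCast] at this
    rw [add_assoc, this]
    push_cast
    ring
  rw [hval, ZMod.val_natCast, Nat.mod_eq_of_lt (by nlinarith [Nat.two_pow_pos l])]
  rw [Nat.testBit_eq_decide_div_mod_eq, Nat.mul_add_div (Nat.two_pow_pos l),
    Nat.div_eq_of_lt ha', add_zero, Nat.mod_eq_of_lt hβ]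

/-- Reconstruction of a number from noisy multiples of its products with powers of two, starting
with the least significant bit: the number formed by the first `t` bits. -/
def decodeAcc (u : ℕ → Zq k) : ℕ → Zq k
  | 0 => 0
  | t + 1 => decodeAcc u t +
      if (u (k - 1 - t) + -(2 ^ (k - 1 - t)) * decodeAcc u t
        + ((2 ^ k / 4 : ℕ) : Zq k)).val.testBit (k - 1) then 2 ^ t else 0

/-- Once the low `t` bits of `s` are known, their share is subtracted from `2 ^ (k-1-t) * s`. Bit
number `t` is left at the top position, the higher bits vanish modulo `2 ^ k`, and rounding reads it
off. -/
theorem decodeAcc_eq (u : ℕ → Zq k) (s : Zq k) (η : ℕ → Zq k)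
    (hη : ∀ j < k, 4 * (η j).valMinAbs.natAbs < 2 ^ k) (hu : ∀ j < k, u j = 2 ^ j * s + η j) :
    ∀ t ≤ k, decodeAcc u t = ((s.val % 2 ^ t : ℕ) : Zq k)
  | 0, _ => by simp [decodeAcc, Nat.mod_one]
  | t + 1, ht => by
    have ih := decodeAcc_eq u s η hη hu t (by omega)
    have h2k : (2 ^ (k - 1 - t) : Zq k) * 2 ^ t = 2 ^ (k - 1) := by
      rw [← pow_add]
      congr 1
      omega
    have hz : (2 ^ (k - 1) : Zq k) * 2 = 0 := by
      rw [← pow_succ, show k - 1 + 1 = k by omega]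
      have := ZMod.natCast_self (2 ^ k)
      push_cast at this
      exact this
    have hs : s = ((s.val % 2 ^ t : ℕ) : Zq k) + 2 ^ t * ((s.val / 2 ^ t % 2 : ℕ) : Zq k) +
        2 ^ t * 2 * ((s.val / 2 ^ t / 2 : ℕ) : Zq k) := by
      have h1 : s.val = s.val % 2 ^ t + 2 ^ t * (s.val / 2 ^ t % 2 + 2 * (s.val / 2 ^ t / 2)) := by
        rw [Nat.mod_add_div, Nat.mod_add_div]
      calc s = ((s.val : ℕ) : Zq k) := (ZMod.natCast_zmod_val s).symm
        _ = _ := by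
          conv_lhs => rw [h1]
          push_cast
          ring
    have hbit := testBit_round (k := k) (by omega) (s.val / 2 ^ t % 2) (Nat.mod_lt _ two_pos)
      (η (k - 1 - t)) (hη _ (by omega))
    have harg : u (k - 1 - t) + -(2 ^ (k - 1 - t)) * decodeAcc u t =
        2 ^ (k - 1) * ((s.val / 2 ^ t % 2 : ℕ) : Zq k) + η (k - 1 - t) := by
      rw [hu _ (by omega), ih]
      linear_combination (2 ^ (k - 1 - t)) * hs + ((s.val / 2 ^ t % 2 : ℕ) : Zq k) * h2k +
        2 * ((s.val / 2 ^ t / 2 : ℕ) : Zq k) * h2k + ((s.val / 2 ^ t / 2 : ℕ) : Zq k) * hz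
    rw [decodeAcc, harg, hbit, ih, Nat.mod_pow_succ]
    rcases Nat.mod_two_eq_zero_or_one (s.val / 2 ^ t) with h | h <;> simp [h]

theorem decodeAcc_eq_self (u : ℕ → Zq k) (s : Zq k) (η : ℕ → Zq k)
    (hη : ∀ j < k, 4 * (η j).valMinAbs.natAbs < 2 ^ k) (hu : ∀ j < k, u j = 2 ^ j * s + η j) :
    decodeAcc u k = s := by
  rw [decodeAcc_eq u s η hη hu k le_rfl, Nat.mod_eq_of_lt (ZMod.val_lt s), ZMod.natCast_zmod_val]

end Rounding

/-! ### Inversion of the QFactory function by means of the trapdoor -/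

namespace QFParams

variable {P : QFParams}

/-- The entries of the trapdoor are in `{-1, 0, 1}`. -/
def Key.Ternary (κ : P.Key) : Prop := ∃ R₁ R₂, κ.R = P.bitMatrix R₁ - P.bitMatrix R₂

theorem Key.ternary_of_mem_support {κ : P.Key} (h : κ ∈ P.gen.support) : κ.Ternary := by
  simp only [gen, PMF.mem_support_bind_iff, PMF.mem_support_pure_iff] at h
  obtain ⟨A, _, R₁, _, R₂, _, s, _, e, _, d, _, rfl⟩ := h
  exact ⟨R₁, R₂, rfl⟩

theorem Key.Ternary.natAbs_le {κ : P.Key} (h : κ.Ternary) (b : Fin (P.n * P.k)) (a : Fin P.mbar)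
    (x : Zq P.k) : (κ.R b a * x).valMinAbs.natAbs ≤ x.valMinAbs.natAbs := by
  obtain ⟨R₁, R₂, h⟩ := h
  have hR : κ.R b a = (if R₁ b a then 1 else 0) - (if R₂ b a then 1 else 0) := by
    rw [h]
    rfl
  rw [hR]
  cases R₁ b a <;> cases R₂ b a <;> simp [ZMod.natAbs_valMinAbs_neg]

/-- The image with the contributions of the last two components of a preimage removed. -/
def Key.shifted (κ : P.Key) (y : Fin P.m → Zq P.k) (d c : Bool) : Fin P.m → Zq P.k :=
  fun r => y r + -((if d then P.halfVec r else 0) + (if c then κ.cipher r else 0))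

/-- The trapdoor applied to an image. -/
def Key.untrap (κ : P.Key) (y : Fin P.m → Zq P.k) (b : Fin (P.n * P.k)) : Zq P.k :=
  y (finSumFinEquiv (Sum.inr b)) + ∑ a, κ.R b a * y (finSumFinEquiv (Sum.inl a))

/-- The noisy products of the `i`-th entry of the secret with the powers of two. -/
def Key.noisy (κ : P.Key) (y : Fin P.m → Zq P.k) (i : Fin P.n) (j : ℕ) : Zq P.k :=
  if hj : j < P.k then κ.untrap y (finProdFinEquiv (i, ⟨j, hj⟩)) else 0

def Key.secret (κ : P.Key) (y : Fin P.m → Zq P.k) (i : Fin P.n) : Zq P.k :=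
  decodeAcc (κ.noisy y i) P.k

def Key.error (κ : P.Key) (y : Fin P.m → Zq P.k) (r : Fin P.m) : Zq P.k :=
  y r + ∑ l, -κ.pub r l * κ.secret y l

/-- The only possible preimage in the domain with given last two components. -/
def Key.candidate (κ : P.Key) (y : Fin P.m → Zq P.k) (d c : Bool) : P.Preim :=
  ⟨κ.secret (κ.shifted y d c), κ.error (κ.shifted y d c), d, c⟩

/-- The error is defined as what is missing to reach `y`, so the equation holds for every `y`. Only
the domain condition decides whether a candidate is a preimage. -/
theorem Key.eval_candidate (κ : P.Key) (y : Fin P.m → Zq P.k) (d c : Bool) :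
    κ.eval (κ.candidate y d c) = y := by
  funext r
  have h : κ.error (κ.shifted y d c) r =
      κ.shifted y d c r - κ.pub.mulVec (κ.secret (κ.shifted y d c)) r := by
    rw [error, Matrix.mulVec, dotProduct, sub_eq_add_neg, ← Finset.sum_neg_distrib]
    simp only [neg_mul]
  simp only [eval, candidate, Pi.add_apply, h, shifted]
  cases d <;> cases c <;> simp; ring

/-- The trapdoor relation `(G - R A) + R A = G`: what remains are noisy multiples of the secret by
powers of two. -/
theorem Key.untrap_pub (κ : P.Key) (s : Fin P.n → Zq P.k) (e : Fin P.m → Zq P.k) (i : Fin P.n)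
    (j : Fin P.k) :
    κ.untrap (κ.pub.mulVec s + e) (finProdFinEquiv (i, j)) =
      2 ^ (j : ℕ) * s i + κ.untrap e (finProdFinEquiv (i, j)) := by
  have h1 : ∀ a, κ.pub.mulVec s (finSumFinEquiv (Sum.inl a)) = κ.A.mulVec s a := fun a => by
    simp [pub, Matrix.mulVec, dotProduct]
  have h2 : ∀ b, κ.pub.mulVec s (finSumFinEquiv (Sum.inr b)) =
      (P.gadget - κ.R * κ.A).mulVec s b := fun b => by
    simp [pub, Matrix.mulVec, dotProduct]
  have h3 : P.gadget.mulVec s (finProdFinEquiv (i, j)) = 2 ^ (j : ℕ) * s i := by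
    simp only [gadget, Matrix.mulVec, dotProduct, Matrix.of_apply, Equiv.symm_apply_apply,
      ite_mul, zero_mul, Finset.sum_ite_eq, Finset.mem_univ, if_true]
  simp only [untrap, Pi.add_apply, h1, h2, Matrix.sub_mulVec, Pi.sub_apply, h3,
    ← Matrix.mulVec_mulVec, mul_add, Finset.sum_add_distrib]
  have h4 : κ.R.mulVec (κ.A.mulVec s) (finProdFinEquiv (i, j)) =
      ∑ a, κ.R (finProdFinEquiv (i, j)) a * κ.A.mulVec s a := rfl
  rw [h4]
  ring

/-- For ternary `R` the noise after applying the trapdoor is at most `(mbar + 1) * bnd`, which is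
below `q / 4`. So the secret is decoded correctly, and the error is then determined. -/
theorem Key.eq_candidate {κ : P.Key} (hκ : κ.Ternary)
    (hP : 4 * (P.mbar + 1) * P.bnd < 2 ^ P.k) {t : P.Preim} (ht : t.InDomain) :
    t = κ.candidate (κ.eval t) t.d t.c := by
  have hsh : κ.shifted (κ.eval t) t.d t.c = κ.pub.mulVec t.s + t.e := by
    funext r
    simp only [shifted, eval, Pi.add_apply]
    cases t.d <;> cases t.c <;> simp
  have hsec : κ.secret (κ.shifted (κ.eval t) t.d t.c) = t.s := by
    funext i
    refine decodeAcc_eq_self _ _ (fun j => κ.noisy t.e i j) (fun j hj => ?_) fun j hj => ?_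
    · simp only [noisy, hj, dite_true, untrap]
      have h1 := ZMod.natAbs_valMinAbs_add_le
        (t.e (finSumFinEquiv (Sum.inr (finProdFinEquiv (i, ⟨j, hj⟩)))))
        (∑ a, κ.R (finProdFinEquiv (i, ⟨j, hj⟩)) a * t.e (finSumFinEquiv (Sum.inl a)))
      have h2 := Int.natAbs_add_le
        (t.e (finSumFinEquiv (Sum.inr (finProdFinEquiv (i, ⟨j, hj⟩))))).valMinAbs
        (∑ a, κ.R (finProdFinEquiv (i, ⟨j, hj⟩)) a * t.e (finSumFinEquiv (Sum.inl a))).valMinAbs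
      have h3 := natAbs_valMinAbs_sum_le Finset.univ fun a =>
        κ.R (finProdFinEquiv (i, ⟨j, hj⟩)) a * t.e (finSumFinEquiv (Sum.inl a))
      have h4 : ∑ a, (κ.R (finProdFinEquiv (i, ⟨j, hj⟩)) a *
          t.e (finSumFinEquiv (Sum.inl a))).valMinAbs.natAbs ≤ ∑ _a : Fin P.mbar, P.bnd :=
        Finset.sum_le_sum fun a _ => (hκ.natAbs_le _ _ _).trans (ht _)
      rw [Finset.sum_const, Finset.card_univ, Fintype.card_fin, smul_eq_mul] at h4
      have h5 := ht (finSumFinEquiv (Sum.inr (finProdFinEquiv (i, ⟨j, hj⟩))))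
      nlinarith
    · simp only [noisy, hj, dite_true, hsh]
      exact κ.untrap_pub t.s t.e i ⟨j, hj⟩
  ext1
  · exact hsec.symm
  · simp only [candidate]
    funext r
    rw [error, hsec, hsh]
    simp [Matrix.mulVec, dotProduct]
  · rfl
  · rfl

end QFParams

/-! ### Circuits for arithmetic modulo powers of two -/

section Arith

variable {X : Type} {k : ℕ} {I : Set (X → Bool)} {s t : ℕ}

/-- The bits of a function with values in `Zq k`. -/
def bitsOf (z : X → Zq k) : Set (X → Bool) := ⋃ j < k, {fun x => (z x).val.testBit j}

/-- The bits of a function with values in vectors. -/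
def bitsVec {n : ℕ} (z : X → Fin n → Zq k) : Set (X → Bool) := ⋃ r, bitsOf fun x => z x r

theorem mem_bitsOf (z : X → Zq k) {j : ℕ} (hj : j < k) :
    (fun x => (z x).val.testBit j) ∈ bitsOf z := by
  simp only [bitsOf, Set.mem_iUnion]
  exact ⟨j, hj, rfl⟩

theorem bitsOf_subset_bitsVec {n : ℕ} (z : X → Fin n → Zq k) (r : Fin n) :
    (bitsOf fun x => z x r) ⊆ bitsVec z :=
  Set.subset_iUnion (fun r => bitsOf fun x => z x r) r

theorem Computes.bitsOf {z : X → Zq k}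
    (h : ∀ j < k, Computes I {fun x => (z x).val.testBit j} s) : Computes I (bitsOf z) (k * s) :=
  Computes.iUnion _ k h

theorem Computes.bitsVec {n : ℕ} {z : X → Fin n → Zq k}
    (h : ∀ r, Computes I (_root_.bitsOf fun x => z x r) s) :
    Computes I (bitsVec z) (n * s) :=
  Computes.iUnion_fin _ h

theorem Computes.of_subset_bitsOf {z : X → Zq k} : Computes (_root_.bitsOf z) (_root_.bitsOf z) (k * 1) :=
  Computes.bitsOf fun _ hj => Computes.load (mem_bitsOf z hj)

theorem Computes.zconst (c : Zq k) : Computes I (_root_.bitsOf fun _ : X => c) (k * 1) :=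
  Computes.bitsOf fun _ _ => Computes.const _

theorem Computes.zcond {b : X → Bool} (hb : Computes I {b} s) (c : Zq k) :
    Computes I (_root_.bitsOf fun x => if b x then c else 0) (s + k * 3) := by
  refine hb.comp (Computes.bitsOf fun j _ => ?_)
  have h := (Computes.load (I := {b}) rfl).and (Computes.const (I := {b}) (c.val.testBit j))
  refine h.mono_out (Set.singleton_subset_singleton.2 ?_)
  funext x
  cases b x <;> simp

/-- Steps of an addition. -/
def addCost (k : ℕ) : ℕ := 200 * k

/-- The carry into the `j`-th bit of a sum. -/
def carryBit (z z' : X → Zq k) (j : ℕ) (x : X) : Bool :=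
  BitVec.carry j (BitVec.ofNat k (z x).val) (BitVec.ofNat k (z' x).val) false

theorem testBit_val_eq_getLsbD (a : Zq k) (j : ℕ) :
    a.val.testBit j = (BitVec.ofNat k a.val).getLsbD j := by
  rw [BitVec.getLsbD_ofNat]
  by_cases hj : j < k
  · simp [hj]
  · have : a.val.testBit j = false :=
      Nat.testBit_lt_two_pow ((ZMod.val_lt a).trans_le (Nat.pow_le_pow_right two_pos (by omega)))
    simp [this]

theorem testBit_val_add (z z' : X → Zq k) {j : ℕ} (hj : j < k) (x : X) :
    (z x + z' x).val.testBit j =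
      xor ((z x).val.testBit j) (xor ((z' x).val.testBit j) (carryBit z z' j x)) := by
  have h : BitVec.ofNat k (z x + z' x).val =
      BitVec.ofNat k (z x).val + BitVec.ofNat k (z' x).val := by
    apply BitVec.eq_of_toNat_eq
    simp [ZMod.val_add]
  rw [testBit_val_eq_getLsbD, h, BitVec.getLsbD_add hj, ← testBit_val_eq_getLsbD,
    ← testBit_val_eq_getLsbD]
  rfl

/-- Ripple-carry addition: a chain of carries, each the majority of the previous carry and two bits,
followed by the parity of three bits in each position. -/
theorem Computes.zadd {z z' : X → Zq k} (hz : Computes I (_root_.bitsOf z) s)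
    (hz' : Computes I (_root_.bitsOf z') t) :
    Computes I (_root_.bitsOf fun x => z x + z' x) (s + t + addCost k) := by
  refine (hz.union hz').comp ?_
  set J := _root_.bitsOf z ∪ _root_.bitsOf z'
  have hc : Computes J (⋃ j < k, {carryBit z z' j}) (k * fnCost 3) := by
    refine Computes.chain (fun j => {carryBit z z' j}) k fun i hi => ?_
    cases i with
    | zero =>
      refine (Computes.const false).mono subset_rfl (Set.singleton_subset_singleton.2 ?_)
        (by decide)
      funext x
      simp [carryBit]
    | succ i =>
      refine (Computes.fn (fun b => Bool.atLeastTwo (b 0) (b 1) (b 2)) ![fun x => (z x).val.testBit i,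
        fun x => (z' x).val.testBit i, carryBit z z' i] fun l => ?_).mono_out
          (Set.singleton_subset_singleton.2 ?_)
      · fin_cases l
        · exact Or.inl (Or.inl (mem_bitsOf z (by omega)))
        · exact Or.inl (Or.inr (mem_bitsOf z' (by omega)))
        · right
          simp only [Set.mem_iUnion]
          exact ⟨i, by omega, rfl⟩
      · funext x
        simp only [carryBit, BitVec.carry_succ, testBit_val_eq_getLsbD]
        rfl
  refine (hc.cut (Computes.bitsOf (z := fun x => z x + z' x) (s := fnCost 3) fun j hj => ?_)).mono
    subset_rfl Set.subset_union_right ?_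
  · refine (Computes.fn (fun b => Bool.xor (b 0) (Bool.xor (b 1) (b 2)))
      ![fun x => (z x).val.testBit j, fun x => (z' x).val.testBit j, carryBit z z' j]
        fun l => ?_).mono_out (Set.singleton_subset_singleton.2 ?_)
    · fin_cases l
      · exact Or.inl (Or.inl (mem_bitsOf z hj))
      · exact Or.inl (Or.inr (mem_bitsOf z' hj))
      · right
        simp only [Set.mem_iUnion]
        exact ⟨j, hj, rfl⟩
    · funext x
      exact testBit_val_add z z' hj x
  -- Each position needs two functions of three bits, that is `2 * fnCost 3 = 184` steps, rounded up
  -- to `200` in `addCost`.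
  · simp only [fnCost, addCost]
    omega

theorem Computes.zsum {T : ℕ} {z : Fin T → X → Zq k}
    (h : ∀ i, Computes I (_root_.bitsOf (z i)) s) :
    Computes I (_root_.bitsOf fun x => ∑ i, z i x) (T * (s + addCost k) + k) := by
  induction T with
  | zero => simpa using Computes.zconst (0 : Zq k)
  | succ T ih =>
    simp only [Fin.sum_univ_succ]
    refine ((h 0).zadd (ih fun i => h i.succ)).mono_size ?_
    rw [Nat.succ_mul]
    omega

/-- Steps of a multiplication by a constant. -/
def mulCost (k : ℕ) : ℕ := k * (1 + k * 3 + addCost k) + k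

theorem Zq.eq_sum_bits (a : Zq k) :
    a = ∑ j : Fin k, if a.val.testBit j then (2 : Zq k) ^ (j : ℕ) else 0 := by
  have h : ∀ t, ((a.val % 2 ^ t : ℕ) : Zq k) =
      ∑ j ∈ Finset.range t, if a.val.testBit j then (2 : Zq k) ^ j else 0 := fun t => by
    induction t with
    | zero => simp [Nat.mod_one]
    | succ t ih =>
      rw [Nat.mod_pow_succ, Finset.sum_range_succ, ← ih, Nat.testBit_eq_decide_div_mod_eq]
      rcases Nat.mod_two_eq_zero_or_one (a.val / 2 ^ t) with h | h <;> simp [h]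
  rw [← Finset.sum_range (fun j => if a.val.testBit j then (2 : Zq k) ^ j else 0), ← h,
    Nat.mod_eq_of_lt (ZMod.val_lt a), ZMod.natCast_zmod_val]

/-- One factor is a constant, because keys are hardwired; the product is then a sum of constants
selected by the bits of the other factor. -/
theorem Computes.zmul {z : X → Zq k} (hz : Computes I (_root_.bitsOf z) s) (c : Zq k) :
    Computes I (_root_.bitsOf fun x => c * z x) (s + mulCost k) := by
  refine hz.comp ?_
  have h := Computes.zsum (T := k) (I := _root_.bitsOf z)
    (z := fun j x => if (z x).val.testBit j then c * (2 : Zq k) ^ (j : ℕ) else 0)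
    fun j => (Computes.load (mem_bitsOf z j.2)).zcond _
  have e : (fun x => c * z x) =
      fun x => ∑ j : Fin k, if (z x).val.testBit j then c * (2 : Zq k) ^ (j : ℕ) else 0 := by
    funext x
    conv_lhs => rw [Zq.eq_sum_bits (z x), Finset.mul_sum]
    simp only [mul_ite, mul_zero]
  rw [e]
  exact h

/-- The comparison proceeds from the low bits upwards: a new top bit decides unless it agrees with
that of `c`, and then the comparison of the lower parts stands. A step is a function of two bits,
and `fnCost 2 = 29`. -/
theorem Computes.zle {z : X → Zq k} (hz : Computes I (_root_.bitsOf z) s) (c : ℕ) (hc : c < 2 ^ k) :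
    Computes I {fun x => decide ((z x).val ≤ c)} (s + (k + 1) * 30) := by
  refine hz.comp ?_
  have h : Computes (_root_.bitsOf z)
      (⋃ j < k + 1, {fun x => decide ((z x).val % 2 ^ j ≤ c % 2 ^ j)}) ((k + 1) * 30) := by
    refine Computes.chain (fun j => {fun x => decide ((z x).val % 2 ^ j ≤ c % 2 ^ j)}) (k + 1)
      fun i hi => ?_
    cases i with
    | zero =>
      refine (Computes.const true).mono subset_rfl (Set.singleton_subset_singleton.2 ?_)
        (by decide)
      funext x
      simp [Nat.mod_one]
    | succ i =>
      refine (Computes.fn (fun b => if c.testBit i then !(b 0) || b 1 else !(b 0) && b 1)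
        ![fun x => (z x).val.testBit i, fun x => decide ((z x).val % 2 ^ i ≤ c % 2 ^ i)]
          fun l => ?_).mono subset_rfl (Set.singleton_subset_singleton.2 ?_) (by decide)
      · fin_cases l
        · exact Or.inl (mem_bitsOf z (by omega))
        · right
          simp only [Set.mem_iUnion]
          exact ⟨i, by omega, rfl⟩
      · funext x
        simp only [Matrix.cons_val_zero, Matrix.cons_val_one, Nat.mod_pow_succ,
          Nat.testBit_eq_decide_div_mod_eq]
        have h1 := Nat.mod_lt (z x).val (Nat.two_pow_pos i)
        have h2 := Nat.mod_lt c (Nat.two_pow_pos i)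
        rcases Nat.mod_two_eq_zero_or_one ((z x).val / 2 ^ i) with h3 | h3 <;>
          rcases Nat.mod_two_eq_zero_or_one (c / 2 ^ i) with h4 | h4 <;>
          simp [h3, h4] <;> omega
  refine h.mono_out (Set.singleton_subset_iff.2 ?_)
  simp only [Set.mem_iUnion]
  refine ⟨k, by omega, ?_⟩
  rw [Set.mem_singleton_iff]
  funext x
  rw [Nat.mod_eq_of_lt (ZMod.val_lt _), Nat.mod_eq_of_lt hc]

end Arith

/-! ### Circuits for the bits of the client -/

section Lists

variable {X : Type} {I O : Set (X → Bool)} {s t : ℕ}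

theorem Computes.fn_fintype {ι : Type} [Fintype ι] (g : (ι → Bool) → Bool) (f : ι → X → Bool)
    (hf : ∀ i, Computes I {f i} s) :
    Computes I {fun x => g fun i => f i x} (Fintype.card ι * s + fnCost (Fintype.card ι)) := by
  have h := Computes.fn_le (fun b => g fun i => b (Fintype.equivFin ι i))
    (fun j => f ((Fintype.equivFin ι).symm j)) fun j => hf _
  simpa using h

theorem Computes.forall_fin : ∀ {n : ℕ} (f : Fin n → X → Bool), (∀ r, Computes I {f r} s) →
    Computes I {fun x => decide (∀ r, f r x = true)} (n * (s + 1) + 1)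
  | 0, f, _ => by
    have h := Computes.const (I := I) true
    simpa using h
  | n + 1, f, h => by
    refine ((h 0).and (Computes.forall_fin (fun r : Fin n => f r.succ) fun r => h _)).mono
      subset_rfl (Set.singleton_subset_singleton.2 ?_) ?_
    · funext x
      simp only [Fin.forall_fin_succ, Bool.decide_and, Bool.decide_eq_true]
    · rw [Nat.succ_mul]
      omega

/-- A list of fixed length whose entries are functions in `O`. -/
def ListIn (O : Set (X → Bool)) (g : X → List Bool) : Prop :=
  ∃ fs : List (X → Bool), (∀ f ∈ fs, f ∈ O) ∧ ∀ x, g x = fs.map fun f => f x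

theorem ListIn.append {g g' : X → List Bool} (h : ListIn O g) (h' : ListIn O g') :
    ListIn O fun x => g x ++ g' x := by
  obtain ⟨fs, h1, h2⟩ := h
  obtain ⟨fs', h1', h2'⟩ := h'
  refine ⟨fs ++ fs', fun f hf => ?_, fun x => by simp [h2, h2']⟩
  exact (List.mem_append.1 hf).elim (h1 f) (h1' f)

theorem ListIn.ofFn {n : ℕ} (f : Fin n → X → Bool) (h : ∀ j, f j ∈ O) :
    ListIn O fun x => List.ofFn fun j => f j x := by
  refine ⟨List.ofFn f, fun g hg => ?_, fun x => by simp [List.map_ofFn, Function.comp_def]⟩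
  obtain ⟨j, rfl⟩ := (List.mem_ofFn' _ _).1 hg
  exact h j

theorem ListIn.flatten_ofFn : ∀ {n : ℕ} (g : Fin n → X → List Bool), (∀ j, ListIn O (g j)) →
    ListIn O fun x => (List.ofFn fun j => g j x).flatten
  | 0, _, _ => ⟨[], by simp, by simp⟩
  | n + 1, g, h => by
    simpa [List.ofFn_succ] using (h 0).append (ListIn.flatten_ofFn (fun j => g j.succ) fun j => h _)

theorem ListIn.mono {O' : Set (X → Bool)} (hO : O ⊆ O') {g : X → List Bool} (h : ListIn O g) :
    ListIn O' g := by
  obtain ⟨fs, h1, h2⟩ := h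
  exact ⟨fs, fun f hf => hO (h1 f hf), h2⟩

theorem ListIn.encVec {n k : ℕ} (z : X → Fin n → Zq k) :
    ListIn (bitsVec z) fun x => encVec (z x) :=
  ListIn.flatten_ofFn _ fun r => ListIn.ofFn _ fun j =>
    bitsOf_subset_bitsVec z r (mem_bitsOf _ j.2)

theorem length_encVec {n k : ℕ} (z : Fin n → Zq k) : (encVec z).length = n * k := by
  simp [encVec, encZq, List.length_flatten, List.map_ofFn, Function.comp_def]

theorem foldl_xor (l : List Bool) (a : Bool) : l.foldl xor a = xor a (l.foldr xor false) := by
  induction l generalizing a with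
  | nil => simp
  | cons b l ih => simp [ih]

theorem dotBits_eq (a b : List Bool) : dotBits a b = (List.zipWith and a b).foldr xor false := by
  simp [dotBits, foldl_xor]

theorem dotBits_zipWith_xor : ∀ a b c : List Bool, b.length = c.length →
    dotBits a (List.zipWith xor b c) = xor (dotBits a b) (dotBits a c)
  | [], _, _, _ => by simp [dotBits]
  | _ :: _, [], [], _ => by simp [dotBits]
  | x :: a, y :: b, z :: c, h => by
    have ih := dotBits_zipWith_xor a b c (by simpa using h)
    simp only [dotBits_eq, List.zipWith_cons_cons, List.foldr_cons] at ih ⊢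
    rw [ih]
    cases x <;> cases y <;> cases z <;> simp

/-- A report that is too short may be padded with zeros, since they contribute nothing to the inner
product. This gives a list of fixed length, as straight-line programs require. -/
theorem dotBits_take : ∀ (n : ℕ) (l b : List Bool), b.length = n →
    dotBits (l.take n) b = dotBits (List.ofFn fun j : Fin n => l.getD j false) b
  | 0, l, b, h => by simp
  | n + 1, [], [], h => by simp at h
  | n + 1, [], y :: b, h => by
    have ih := dotBits_take n [] b (by simpa using h)
    simp only [dotBits_eq, List.ofFn_succ, List.take_nil, List.zipWith_cons_cons, List.foldr_cons] at ih ⊢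
    simp only [List.zipWith_nil_left, List.foldr_nil, List.getD_nil] at ih ⊢
    simpa using ih.symm
  | n + 1, x :: l, [], h => by simp at h
  | n + 1, x :: l, y :: b, h => by
    have ih := dotBits_take n l b (by simpa using h)
    simp only [dotBits_eq, List.ofFn_succ, List.take_succ_cons, List.zipWith_cons_cons,
      List.foldr_cons] at ih ⊢
    rw [ih]
    simp

theorem Computes.dotBits {g h : X → List Bool} (hg : ListIn O g) (hh : ListIn O h) {n : ℕ}
    (hn : ∀ x, (h x).length ≤ n) :
    Computes O {fun x => _root_.dotBits (g x) (h x)} (n * 4 + 1) := by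
  obtain ⟨fs, hf, hf'⟩ := hg
  obtain ⟨fs', hg, hg'⟩ := hh
  have key := Computes.xor_list (I := O) (s := 3) (fun p : (X → Bool) × (X → Bool) => fun x => p.1 x && p.2 x)
    (List.zip fs fs') fun p hp =>
      (Computes.load (hf _ (List.of_mem_zip hp).1)).and (Computes.load (hg _ (List.of_mem_zip hp).2))
  by_cases hX : Nonempty X
  · obtain ⟨x₀⟩ := hX
    have hl := hn x₀
    rw [hg', List.length_map] at hl
    refine key.mono subset_rfl (Set.singleton_subset_singleton.2 ?_) ?_
    · funext x
      rw [dotBits_eq, hf', hg', List.zipWith_map, ← List.map_uncurry_zip_eq_zipWith, List.foldr_map]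
      rfl
    · have : (List.zip fs fs').length ≤ n := by
        rw [List.length_zip]
        omega
      gcongr
  · refine (Computes.const false).mono subset_rfl (Set.singleton_subset_singleton.2 ?_) (by omega)
    funext x
    exact (hX ⟨x⟩).elim

end Lists

/-! ### The value bit in terms of the four candidate preimages -/

namespace QFParams

variable (P : QFParams)

/-- Translation by `b` maps the residues of absolute value at most `b` to the interval from `0` to
`2 b`, so that one comparison suffices. -/
theorem natAbs_valMinAbs_le_iff {k b : ℕ} (hb : 2 * b < 2 ^ k) (z : Zq k) :
    z.valMinAbs.natAbs ≤ b ↔ (z + (b : Zq k)).val ≤ 2 * b := by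
  constructor
  · intro h
    obtain ⟨v, hv⟩ := Int.eq_ofNat_of_zero_le (show 0 ≤ z.valMinAbs + b by omega)
    have hz : z + (b : Zq k) = ((v : ℕ) : Zq k) := by
      have := congrArg (fun i : ℤ => (i : Zq k)) hv
      simpa using this
    rw [hz, ZMod.val_natCast, Nat.mod_eq_of_lt (by omega)]
    omega
  · intro h
    have : z.valMinAbs = ((z + (b : Zq k)).val : ℤ) - b := by
      rw [ZMod.valMinAbs_spec]
      refine ⟨by simp, ?_⟩
      constructor
      · push_cast
        have : (2 : ℤ) * b < 2 ^ k := by exact_mod_cast hb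
        omega
      · push_cast
        have : (2 : ℤ) * b < 2 ^ k := by exact_mod_cast hb
        omega
    rw [this]
    omega

variable {P}

open Classical in
/-- Whether there is a preimage in the domain with the given last two components. -/
def Key.flag (κ : P.Key) (y : Fin P.m → Zq P.k) (p : Bool × Bool) : Bool :=
  decide (κ.candidate y p.1 p.2).InDomain

def Key.dot (κ : P.Key) (y : Fin P.m → Zq P.k) (b : List Bool) (p : Bool × Bool) : Bool :=
  dotBits b (κ.candidate y p.1 p.2).bits

/-- The value bit in terms of the candidates for preimages. -/
def combineBits (d u : Bool) (F D : Bool × Bool → Bool) : Bool :=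
  if (Finset.univ.filter fun p => F p = true).card = 2 then
    xor (d && decide (Odd (Finset.univ.filter fun p => F p = true ∧ D p = true).card))
      (decide (∀ p, F p = true → p.1 = true))
  else u

theorem Preim.length_bits (x : P.Preim) : x.bits.length = P.preimLen := by
  simp only [Preim.bits, List.length_append, length_encVec, List.length_cons, List.length_nil]

/-- The preimages of `y` are the flagged ones among four candidates. By bilinearity the inner
product with `x ⊕ z` is the parity of the flagged inner products, and `h(x) h(z) = 1` means that all
flagged candidates have `d = 1`. The right side is symmetric and involves no choice of `x` and `z`.
-/
theorem Key.valueBit_eq {κ : P.Key} (hκ : κ.Ternary) (hP : 4 * (P.mbar + 1) * P.bnd < 2 ^ P.k)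
    (y : Fin P.m → Zq P.k) (b : List Bool) (u : Bool) :
    κ.valueBit y b u = combineBits κ.d₀ u (κ.flag y) (κ.dot y b) := by
  have hcand : ∀ t : P.Preim, (t.InDomain ∧ κ.eval t = y) →
      t = κ.candidate y t.d t.c ∧ κ.flag y (t.d, t.c) = true := fun t ht => by
    have := eq_candidate hκ hP ht.1
    rw [ht.2] at this
    refine ⟨this, ?_⟩
    simp only [flag, decide_eq_true_eq, ← this]
    exact ht.1
  have hflag : ∀ p, κ.flag y p = true → (κ.candidate y p.1 p.2).InDomain ∧
      κ.eval (κ.candidate y p.1 p.2) = y := fun p hp =>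
    ⟨by simpa [flag] using hp, κ.eval_candidate y p.1 p.2⟩
  by_cases hxz : ∃ xz : P.Preim × P.Preim, κ.TwoPreimages y xz.1 xz.2
  · rw [valueBit, dif_pos hxz]
    obtain ⟨hne, hall⟩ := hxz.choose_spec
    set x := hxz.choose.1
    set z := hxz.choose.2
    obtain ⟨hx, hxf⟩ := hcand x ((hall x).2 (Or.inl rfl))
    obtain ⟨hz, hzf⟩ := hcand z ((hall z).2 (Or.inr rfl))
    -- A preimage is the candidate belonging to its own last two components, so distinct preimages
    -- differ in these.
    have hpne : (x.d, x.c) ≠ (z.d, z.c) := fun h => by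
      simp only [Prod.mk.injEq] at h
      rw [h.1, h.2, ← hz] at hx
      exact hne hx
    have hset : ∀ p, κ.flag y p = true ↔ p = (x.d, x.c) ∨ p = (z.d, z.c) := fun p => by
      constructor
      · intro hp
        rcases (hall _).1 (hflag p hp) with h | h
        · exact Or.inl (by rw [← h]; rfl)
        · exact Or.inr (by rw [← h]; rfl)
      · rintro (rfl | rfl)
        · exact hxf
        · exact hzf
    have hF : (Finset.univ.filter fun p => κ.flag y p = true) = {(x.d, x.c), (z.d, z.c)} := by
      ext p
      simp [hset]
    rw [combineBits, if_pos (by rw [hF, Finset.card_pair hpne])]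
    congr 1
    · congr 1
      have hFD : (Finset.univ.filter fun p => κ.flag y p = true ∧ κ.dot y b p = true) =
          ({(x.d, x.c), (z.d, z.c)} : Finset (Bool × Bool)).filter fun p => κ.dot y b p = true := by
        ext p
        simp [hset]
      rw [dotBits_zipWith_xor _ _ _ (by rw [Preim.length_bits, Preim.length_bits]), hFD]
      have hdx : κ.dot y b (x.d, x.c) = dotBits b x.bits := by rw [dot, ← hx]
      have hdz : κ.dot y b (z.d, z.c) = dotBits b z.bits := by rw [dot, ← hz]
      rw [Finset.filter_insert, Finset.filter_singleton, hdx, hdz]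
      cases dotBits b x.bits <;> cases dotBits b z.bits <;> simp [Finset.card_pair hpne]
    · rw [Bool.eq_iff_iff]
      simp only [hset, Bool.and_eq_true, decide_eq_true_eq]
      constructor
      · rintro ⟨h1, h2⟩ p (rfl | rfl)
        · exact h1
        · exact h2
      · exact fun h => ⟨h _ (Or.inl rfl), h _ (Or.inr rfl)⟩
  · rw [valueBit, dif_neg hxz, combineBits, if_neg]
    intro hc
    obtain ⟨p, p', hne, hF⟩ := Finset.card_eq_two.1 hc
    have hset : ∀ r, κ.flag y r = true ↔ r = p ∨ r = p' := fun r => by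
      have := congrArg (fun S => r ∈ S) hF
      simpa using this
    refine hxz ⟨(κ.candidate y p.1 p.2, κ.candidate y p'.1 p'.2), fun h => hne ?_, fun t => ?_⟩
    · have h1 := congrArg Preim.d h
      have h2 := congrArg Preim.c h
      exact Prod.ext h1 h2
    · constructor
      · intro ht
        obtain ⟨h1, h2⟩ := hcand t ht
        rcases (hset _).1 h2 with h | h
        · left; rw [h1, ← h]
        · right; rw [h1, ← h]
      · rintro (rfl | rfl)
        · exact hflag p ((hset p).2 (Or.inl rfl))
        · exact hflag p' ((hset p').2 (Or.inr rfl))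

end QFParams

/-! ### Straight-line programs for the trapdoor inversion and the value bit -/

namespace QFParams

variable {P : QFParams} {X : Type} {I : Set (X → Bool)} {s t : ℕ}

theorem _root_.Computes.zload {n k : ℕ} (z : X → Fin n → Zq k) (r : Fin n) :
    Computes (bitsVec z) (bitsOf fun x => z x r) (k * 1) :=
  Computes.of_subset_bitsOf.mono_in (bitsOf_subset_bitsVec z r)

variable (P)

def shiftCost : ℕ := P.m * (P.k * 1 + P.k * 1 + addCost P.k)

def untrapCost : ℕ :=
  P.n * P.k * (P.k * 1 + (P.mbar * (P.k * 1 + mulCost P.k + addCost P.k) + P.k) + addCost P.k)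

def secretCost : ℕ :=
  P.n * ((P.k + 1) * (10 * P.k + mulCost P.k + 3 * addCost P.k))

def errorCost : ℕ :=
  P.m * (P.k * 1 + (P.n * (P.k * 1 + mulCost P.k + addCost P.k) + P.k) + addCost P.k)

def flagCost : ℕ := P.m * (P.k * 1 + P.k * 1 + addCost P.k + (P.k + 1) * 30 + 1) + 1

def candidateCost : ℕ :=
  P.shiftCost + (P.untrapCost + P.secretCost + P.errorCost)

def dotCost : ℕ := P.preimLen * 1 + (P.n * (P.k * 1) + P.m * (P.k * 1) + 2) + (P.preimLen * 4 + 1)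

/-- Steps for the bit that the client computes from a report of the server. -/
def valueCost : ℕ :=
  8 * (P.candidateCost + P.flagCost + P.dotCost + P.preimLen) + Computes.fnCost 8

variable {P}

theorem computes_shifted (κ : P.Key) (y : X → Fin P.m → Zq P.k) (d c : Bool) :
    Computes (bitsVec y) (bitsVec fun x => κ.shifted (y x) d c) P.shiftCost :=
  Computes.bitsVec fun r => (Computes.zload y r).zadd
    (Computes.zconst (-((if d then P.halfVec r else 0) + (if c then κ.cipher r else 0))))

theorem computes_untrap (κ : P.Key) (y : X → Fin P.m → Zq P.k) :
    Computes (bitsVec y) (bitsVec fun x => κ.untrap (y x)) P.untrapCost :=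
  Computes.bitsVec fun b => (Computes.zload y _).zadd
    (Computes.zsum fun a => (Computes.zload y _).zmul (κ.R b a))

/-- Each stage of `decodeAcc` uses the preceding one twice. Computing the stages as a chain shares
these values and avoids an exponential cost. -/
theorem computes_secret (κ : P.Key) (y : X → Fin P.m → Zq P.k) :
    Computes (bitsVec fun x => κ.untrap (y x)) (bitsVec fun x => κ.secret (y x)) P.secretCost := by
  refine Computes.bitsVec fun i => ?_
  have h := Computes.chain (I := bitsVec fun x => κ.untrap (y x))
    (s := 10 * P.k + mulCost P.k + 3 * addCost P.k)
    (fun t => bitsOf fun x => decodeAcc (κ.noisy (y x) i) t) (P.k + 1) fun t ht => ?_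
  · refine h.mono_out fun f hf => ?_
    simp only [Set.mem_iUnion]
    exact ⟨P.k, by omega, hf⟩
  · cases t with
    | zero => exact (Computes.zconst (0 : Zq P.k)).mono_size (by omega)
    | succ t =>
      set J := (bitsVec fun x => κ.untrap (y x)) ∪
        ⋃ j < t + 1, bitsOf fun x => decodeAcc (κ.noisy (y x) i) j with hJ
      have hacc : Computes J (bitsOf fun x => decodeAcc (κ.noisy (y x) i) t) (P.k * 1) := by
        refine Computes.of_subset_bitsOf.mono_in fun f hf => Or.inr ?_
        simp only [Set.mem_iUnion]
        exact ⟨t, by omega, hf⟩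
      have hu : Computes J (bitsOf fun x => κ.noisy (y x) i (P.k - 1 - t)) (P.k * 1) := by
        have hlt : P.k - 1 - t < P.k := by omega
        simp only [Key.noisy, hlt, dite_true]
        exact (Computes.zload (fun x => κ.untrap (y x)) _).mono_in Set.subset_union_left
      have hsum := (hu.zadd (hacc.zmul (-(2 ^ (P.k - 1 - t))))).zadd
        (Computes.zconst (I := J) ((2 ^ P.k / 4 : ℕ) : Zq P.k))
      have hbit := hsum.mono_out (Set.singleton_subset_iff.2
        (mem_bitsOf _ (show P.k - 1 < P.k by omega)))
      exact (hacc.zadd (hbit.zcond (2 ^ t))).mono_size (by omega)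

theorem computes_error (κ : P.Key) (y : X → Fin P.m → Zq P.k) :
    Computes (bitsVec y ∪ bitsVec fun x => κ.secret (y x)) (bitsVec fun x => κ.error (y x))
      P.errorCost :=
  Computes.bitsVec fun r => ((Computes.zload y r).mono_in Set.subset_union_left).zadd
    (Computes.zsum fun l =>
      ((Computes.zload (fun x => κ.secret (y x)) l).mono_in Set.subset_union_right).zmul
        (-κ.pub r l))

theorem computes_candidate (κ : P.Key) (y : X → Fin P.m → Zq P.k) (d c : Bool) :
    Computes (bitsVec y) ((bitsVec fun x => (κ.candidate (y x) d c).s) ∪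
      bitsVec fun x => (κ.candidate (y x) d c).e) P.candidateCost := by
  refine (computes_shifted κ y d c).comp ?_
  set y' := fun x => κ.shifted (y x) d c
  have hs := (computes_untrap κ y').comp (computes_secret κ y')
  exact hs.cut (computes_error κ y')

theorem computes_flag (κ : P.Key) (hP : 4 * (P.mbar + 1) * P.bnd < 2 ^ P.k)
    (y : X → Fin P.m → Zq P.k) (p : Bool × Bool) :
    Computes (bitsVec y) {fun x => κ.flag (y x) p} (P.candidateCost + P.flagCost) := by
  refine ((computes_candidate κ y p.1 p.2).mono_out Set.subset_union_right).comp ?_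
  have hb : 2 * P.bnd < 2 ^ P.k := by nlinarith
  have h := Computes.forall_fin (I := bitsVec fun x => (κ.candidate (y x) p.1 p.2).e)
    (fun r x => decide (((κ.candidate (y x) p.1 p.2).e r + (P.bnd : Zq P.k)).val ≤ 2 * P.bnd))
    fun r => ((Computes.zload _ r).zadd (Computes.zconst ((P.bnd : ℕ) : Zq P.k))).zle _ hb
  refine h.mono_out (Set.singleton_subset_singleton.2 ?_)
  funext x
  simp only [Key.flag, Preim.InDomain, natAbs_valMinAbs_le_iff hb, decide_eq_true_eq]

theorem computes_dot (κ : P.Key) (y : X → Fin P.m → Zq P.k) (b : X → List Bool)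
    (hb : ∀ j < P.preimLen, Computes I {fun x => (b x).getD j false} 1)
    (hy : Computes I (bitsVec y) s) (p : Bool × Bool) :
    Computes I {fun x => κ.dot (y x) ((b x).take P.preimLen) p}
      (s + P.candidateCost + P.dotCost) := by
  have hc := hy.comp (computes_candidate κ y p.1 p.2)
  have hbits := Computes.iUnion (fun j => {fun x => (b x).getD j false}) P.preimLen hb
  have hd : Computes I ({fun _ => p.1} ∪ {fun _ => p.2}) 2 :=
    (Computes.const (I := I) p.1).union (Computes.const p.2)
  have hall := (hbits.union hc).union hd
  have hdot := Computes.dotBits (O := ((⋃ j < P.preimLen, {fun x => (b x).getD j false}) ∪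
      ((bitsVec fun x => (κ.candidate (y x) p.1 p.2).s) ∪
      bitsVec fun x => (κ.candidate (y x) p.1 p.2).e)) ∪ ({fun _ => p.1} ∪ {fun _ => p.2}))
    (g := fun x => List.ofFn fun j : Fin P.preimLen => (b x).getD j false)
    (h := fun x => (κ.candidate (y x) p.1 p.2).bits) (n := P.preimLen)
    (ListIn.ofFn _ fun j => Or.inl (Or.inl (by
      simp only [Set.mem_iUnion]
      exact ⟨j, j.2, rfl⟩)))
    (((ListIn.encVec _).mono fun f hf => Or.inl (Or.inr (Or.inl hf))).append
      ((ListIn.encVec _).mono fun f hf => Or.inl (Or.inr (Or.inr hf))) |>.append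
      ⟨[fun _ => p.1, fun _ => p.2], List.forall_mem_cons.2 ⟨Or.inr (Or.inl rfl),
        List.forall_mem_singleton.2 (Or.inr (Or.inr rfl))⟩, fun x => rfl⟩)
    fun x => (Preim.length_bits _).le
  refine (hall.comp hdot).mono subset_rfl (Set.singleton_subset_singleton.2 ?_) ?_
  · funext x
    rw [Key.dot, dotBits_take _ _ _ (Preim.length_bits _)]
  · simp only [dotCost]
    omega

/-- By `Key.valueBit_eq` the bit is a function of four flags and four inner products, whence the
eight inputs. -/
theorem computes_valueBit {κ : P.Key} (hκ : κ.Ternary)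
    (hP : 4 * (P.mbar + 1) * P.bnd < 2 ^ P.k) (u : Bool) (y : X → Fin P.m → Zq P.k)
    (b : X → List Bool) (hb : ∀ j < P.preimLen, Computes I {fun x => (b x).getD j false} 1)
    (hy : Computes I (bitsVec y) s) :
    Computes I {fun x => κ.valueBit (y x) ((b x).take P.preimLen) u} (8 * s + P.valueCost) := by
  have h := Computes.fn_fintype (I := I) (ι := (Bool × Bool) ⊕ (Bool × Bool))
    (s := s + P.candidateCost + P.flagCost + P.dotCost)
    (fun v => combineBits κ.d₀ u (fun p => v (Sum.inl p)) fun p => v (Sum.inr p))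
    (Sum.elim (fun p x => κ.flag (y x) p) fun p x => κ.dot (y x) ((b x).take P.preimLen) p)
    fun i => by
      cases i with
      | inl p => exact (hy.comp (computes_flag κ hP y p)).mono_size (by omega)
      | inr p => exact (computes_dot κ y b hb hy p).mono_size (by omega)
  refine h.mono subset_rfl (Set.singleton_subset_singleton.2 ?_) ?_
  · funext x
    rw [κ.valueBit_eq hκ hP]
    rfl
  · simp only [Fintype.card_sum, Fintype.card_prod, Fintype.card_bool, valueCost, Nat.reduceMul,
      Nat.reduceAdd]
    omega

end QFParams

/-! ### Decoding of reports, functions of angles, parities -/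

section Reports

variable {X : Type} {I : Set (X → Bool)} {s : ℕ}

theorem getD_drop (l : List Bool) (a j : ℕ) : (l.drop a).getD j false = l.getD (a + j) false := by
  simp [List.getD_eq_getElem?_getD]

/-- Steps for decoding a vector. -/
def decCost (k : ℕ) : ℕ := k * (1 + k * 3 + addCost k) + k

theorem computes_decVec_apply {m k : ℕ} (g : X → List Bool) (r : Fin m)
    (hg : ∀ j < m * k, Computes I {fun x => (g x).getD j false} 1) :
    Computes I (bitsOf fun x => decVec m k (g x) r) (decCost k) := by
  refine Computes.zsum fun j => Computes.zcond ?_ _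
  simp only [getD_drop]
  refine hg _ ?_
  calc (r : ℕ) * k + j < r * k + k := by omega
    _ = (r + 1) * k := by ring
    _ ≤ m * k := Nat.mul_le_mul_right _ r.2

theorem computes_decVec {m k : ℕ} (g : X → List Bool)
    (hg : ∀ j < m * k, Computes I {fun x => (g x).getD j false} 1) :
    Computes I (bitsVec fun x => decVec m k (g x)) (m * decCost k) :=
  Computes.bitsVec fun r => computes_decVec_apply g r hg

theorem QFParams.computes_valueBitOf {P : QFParams} {κ : P.Key} (hκ : κ.Ternary)
    (hP : 4 * (P.mbar + 1) * P.bnd < 2 ^ P.k) (u : Bool) (g : X → List Bool)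
    (hg : ∀ j < P.reportLen, Computes I {fun x => (g x).getD j false} 1) :
    Computes I {fun x => κ.valueBitOf (g x) u} (8 * (P.m * decCost P.k) + P.valueCost) :=
  QFParams.computes_valueBit hκ hP u (fun x => decVec P.m P.k (g x))
    (fun x => (g x).drop (P.m * P.k))
    (fun j hj => by
      simp only [getD_drop]
      exact hg _ (Nat.add_lt_add_left hj _))
    (computes_decVec g fun j hj => hg j (by simp only [reportLen]; omega))

/-- Steps for an angle that is a function of an angle and of `c` bits. -/
def angleCost (c s : ℕ) : ℕ := 3 * ((3 + c) * s + Computes.fnCost (3 + c))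

/-- An angle is three bits, so arithmetic modulo 8 needs no circuits of its own: any function of an
angle and a bounded number of further bits has constant cost. -/
theorem computes_angle_fn {ι : Type} [Fintype ι] (h : Zq 3 → (ι → Bool) → Zq 3) {z : X → Zq 3}
    (hz : Computes I (bitsOf z) s) (f : ι → X → Bool) (hf : ∀ i, Computes I {f i} s) :
    Computes I (bitsOf fun x => h (z x) fun i => f i x) (angleCost (Fintype.card ι) s) := by
  refine Computes.bitsOf fun b _ => ?_
  have := Computes.fn_fintype (I := I) (ι := Fin 3 ⊕ ι) (s := s)
    (fun v => (h (∑ j : Fin 3, if v (Sum.inl j) then (2 : Zq 3) ^ (j : ℕ) else 0)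
      fun i => v (Sum.inr i)).val.testBit b)
    (Sum.elim (fun j x => (z x).val.testBit j) f) fun i => by
      cases i with
      | inl j => exact hz.mono_out (Set.singleton_subset_iff.2 (mem_bitsOf z j.2))
      | inr i => exact hf i
  refine this.mono subset_rfl (Set.singleton_subset_singleton.2 ?_) (by simp)
  funext x
  exact congrArg (fun a => (h a fun i => f i x).val.testBit b) (Zq.eq_sum_bits (z x))

theorem decide_odd_sum {ι : Type} (p : ι → Bool) : ∀ L : List ι,
    decide (Odd (L.map fun i => if p i then 1 else 0).sum) =
      L.foldr (fun i b => xor (p i) b) false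
  | [] => by simp
  | i :: L => by
    have ih := decide_odd_sum p L
    simp only [List.map_cons, List.sum_cons, List.foldr_cons, ← ih]
    cases hp : p i
    · simp
    · have h (n : ℕ) : Odd (1 + n) ↔ ¬Odd n := by
        rw [add_comm, Nat.odd_add_one]
      simp only [if_true, h, Bool.true_xor, decide_not]

open Classical in
theorem parityOn_eq {N : ℕ} (D : Set (Fin N)) (sbar : Fin N → Bool) :
    parityOn D sbar =
      (List.finRange N).foldr (fun j b => xor (decide (j ∈ D) && sbar j) b) false := by
  rw [← decide_odd_sum, parityOn]
  rw [Finset.card_filter, ← List.sum_ofFn, List.ofFn_eq_map]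
  simp

open Classical in
theorem computes_parityOn {N : ℕ} (D : Set (Fin N)) (sbar : X → Fin N → Bool)
    (h : ∀ j ∈ D, Computes I {fun x => sbar x j} s) :
    Computes I {fun x => parityOn D (sbar x)} (N * (s + 2) + 1) := by
  have key := Computes.xor_list (I := I) (s := s + 1) (fun j x => decide (j ∈ D) && sbar x j)
    (List.finRange N) fun j _ => by
      by_cases hj : j ∈ D
      · simpa [hj] using (h j hj).mono_size (Nat.le_succ s)
      · simpa [hj] using (Computes.const (I := I) false).mono_size (by omega)
  refine key.mono subset_rfl (Set.singleton_subset_singleton.2 ?_) (by simp)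
  funext x
  exact parityOn_eq D (sbar x)

end Reports

/-! ### Straight-line programs for the measurement angles -/

namespace QFUBQC

variable {P : QFParams} {N : ℕ} (G : FlowGraph N)

/-- The part of a measurement angle that comes from the pattern and from previous outcomes. -/
def baseAngle (ω : Fin N → QubitCoins P) (φ : Pattern N) (outcomes : List (List Bool))
    (i : Fin N) : Zq 3 :=
  (if parityOn (G.xDep i) fun j => xor ((outcomes.getD j []).getD 0 false) (ω j).r
    then -φ i else φ i) +
  (if parityOn (G.zDep i) fun j => xor ((outcomes.getD j []).getD 0 false) (ω j).r then 4 else 0)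

/-- The angle of an 8-states instance as a function of the bits that determine it. -/
def angleFn (B₁ C₁ B₂ C₂ s₁ s₂ : Bool) : Zq 3 :=
  (if xor (xor C₂ B₂) (B₁ && xor s₁ s₂) then 4 else 0) +
    (if xor C₁ (xor B₂ s₂ && B₁) then 2 else 0) + (if B₁ then 1 else 0)

theorem delta_eq (ω : Fin N → QubitCoins P) (φ : Pattern N) (reports : List Bool)
    (outcomes : List (List Bool)) (i : Fin N) :
    delta G ω φ reports outcomes i = baseAngle G ω φ outcomes i +
      (ω i).key.angle (reports.drop (i * P.report8Len)) + (if (ω i).r then 4 else 0) := rfl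

theorem lt_of_mem_xDep {i j : Fin N} (h : j ∈ G.xDep i) : j < i := by
  obtain ⟨h1, rfl⟩ := h
  exact G.flow_lt j h1

theorem lt_of_mem_zDep {i j : Fin N} (h : j ∈ G.zDep i) : j < i :=
  G.flow_nbr_lt j h.1 i h.2.1 (Ne.symm h.2.2)

theorem parityOn_congr {D : Set (Fin N)} {b b' : Fin N → Bool} (h : ∀ j ∈ D, b j = b' j) :
    parityOn D b = parityOn D b' := by
  unfold parityOn
  congr 3
  ext j
  simp only [Finset.mem_filter, Finset.mem_univ, true_and]
  constructor
  · rintro ⟨h1, h2⟩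
    exact ⟨h1, (h j h1) ▸ h2⟩
  · rintro ⟨h1, h2⟩
    exact ⟨h1, (h j h1).symm ▸ h2⟩

/-- Here the flow enters: both dependency sets of a qubit consist of earlier qubits, so neither its
own pad nor a later one occurs. -/
theorem baseAngle_congr {ω ω' : Fin N → QubitCoins P} {i : Fin N}
    (h : ∀ j < i, (ω j).r = (ω' j).r) (φ : Pattern N) (outcomes : List (List Bool)) :
    baseAngle G ω φ outcomes i = baseAngle G ω' φ outcomes i := by
  unfold baseAngle
  rw [parityOn_congr (D := G.xDep i) fun j hj => by rw [h j (lt_of_mem_xDep G hj)],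
    parityOn_congr (D := G.zDep i) fun j hj => by rw [h j (lt_of_mem_zDep G hj)]]

variable (P N) in
/-- Steps for the part of an angle that comes from the pattern. -/
def baseCost : ℕ := angleCost 2 (decCost 3 + (N * 6 + 1))

variable (P N) in
/-- Steps for an angle. -/
def deltaCost : ℕ :=
  angleCost 4 (baseCost N + (8 * (P.m * decCost P.k) + P.valueCost) + 1)

section View

variable {L T J : ℕ} 

theorem computes_msgBit {t j : ℕ} (ht : t < T) (hj : j < J) :
    Computes (viewBits L T J) {fun x => (x.2.getD t []).getD j false} 1 :=
  Computes.load (Or.inr ⟨t, ht, j, hj, rfl⟩)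

/-- Message `0` holds two patterns of `3 N` bits each, message `1` the reports, and message `j + 2`
the outcome of qubit `j`. Only outcomes of qubits before `i` are read, so messages with numbers up
to `i + 1` suffice. -/
theorem computes_baseAngle (ω : Fin N → QubitCoins P) (i : Fin N) (number : ℕ)
    (hnum : number ≤ 1) (hT : i + 1 < T) (hJ : 6 * N ≤ J) :
    Computes (viewBits L T J)
      (bitsOf fun x => baseAngle G ω (decPattern N number (x.2.getD 0 [])) (x.2.drop 2) i)
      (baseCost N) := by
  have hN : 0 < N := i.pos
  have hφ : Computes (viewBits L T J) (bitsOf fun x => decPattern N number (x.2.getD 0 []) i)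
      (decCost 3) := by
    refine computes_decVec_apply (fun x : View => (x.2.getD 0 []).drop (number * (3 * N))) i
      fun j hj => ?_
    simp only [getD_drop]
    refine computes_msgBit (by omega) ?_
    have : number * (3 * N) ≤ 1 * (3 * N) := Nat.mul_le_mul_right _ hnum
    omega
  have hpar : ∀ D : Set (Fin N), (∀ j ∈ D, j < i) → Computes (viewBits L T J)
      {fun x => parityOn D fun j =>
        xor (((x.2.drop 2).getD j []).getD 0 false) (ω j).r} (N * 6 + 1) := fun D hD => by
    refine (computes_parityOn (s := 4) D _ fun j hj => ?_)
    have hji : (j : ℕ) < i := hD j hj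
    have e : ∀ x : View, (x.2.drop 2).getD j [] = x.2.getD (2 + j) [] := fun x => by
      simp [List.getD_eq_getElem?_getD]
    simp only [e]
    exact ((computes_msgBit (by omega) (by omega)).xor (Computes.const _)).mono_size (by omega)
  have h := computes_angle_fn (I := viewBits L T J) (ι := Bool) (s := decCost 3 + (N * 6 + 1))
    (fun a v => (if v false then -a else a) + (if v true then 4 else 0))
    (hφ.mono_size (by omega))
    (fun b x => if b then
      parityOn (G.zDep i) fun j => xor (((x.2.drop 2).getD j []).getD 0 false) (ω j).r else
      parityOn (G.xDep i) fun j => xor (((x.2.drop 2).getD j []).getD 0 false) (ω j).r)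
    fun b => by
      cases b
      · exact (hpar _ fun j hj => lt_of_mem_xDep G hj).mono_size (by omega)
      · exact (hpar _ fun j hj => lt_of_mem_zDep G hj).mono_size (by omega)
  exact h

/-- An angle that depends on the bits of the report of the `i`-th instance. -/
theorem computes_reportAngle (hP : 4 * (P.mbar + 1) * P.bnd < 2 ^ P.k)
    (h : Zq 3 → Bool → Bool → Bool → Bool → Zq 3) {κ₁ κ₂ : P.Key} (hκ₁ : κ₁.Ternary)
    (hκ₂ : κ₂.Ternary) (u₁ u₂ : Bool) (ω : Fin N → QubitCoins P) (i : Fin N) (number : ℕ)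
    (hnum : number ≤ 1) (hT : i + 1 < T) (hJ : 6 * N ≤ J) (hJ' : N * P.report8Len ≤ J) :
    Computes (viewBits L T J)
      (bitsOf fun x =>
        let report := (x.2.getD 1 []).drop (i * P.report8Len)
        h (baseAngle G ω (decPattern N number (x.2.getD 0 [])) (x.2.drop 2) i)
          (κ₁.valueBitOf report u₁) (κ₂.valueBitOf (report.drop P.reportLen) u₂)
          (report.getD (2 * P.reportLen) false) (report.getD (2 * P.reportLen + 1) false))
      (deltaCost P N) := by
  have hN : 0 < N := i.pos
  have hrep : ∀ j < P.report8Len, Computes (viewBits L T J)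
      {fun x => ((x.2.getD 1 []).drop (i * P.report8Len)).getD j false} 1 := fun j hj => by
    simp only [getD_drop]
    refine computes_msgBit (by omega) ?_
    calc (i : ℕ) * P.report8Len + j < i * P.report8Len + P.report8Len := by omega
      _ = (i + 1) * P.report8Len := by ring
      _ ≤ N * P.report8Len := Nat.mul_le_mul_right _ i.2
      _ ≤ J := hJ'
  have h8 : P.report8Len = 2 * P.reportLen + 2 := rfl
  have hc : Fintype.card (Fin 4) = 4 := rfl
  have := computes_angle_fn (I := viewBits L T J) (ι := Fin 4)
    (s := baseCost N + (8 * (P.m * decCost P.k) + P.valueCost) + 1)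
    (fun a v => h a (v 0) (v 1) (v 2) (v 3))
    ((computes_baseAngle G ω i number hnum hT hJ).mono_size (by omega))
    ![fun x => κ₁.valueBitOf ((x.2.getD 1 []).drop (i * P.report8Len)) u₁,
      fun x => κ₂.valueBitOf (((x.2.getD 1 []).drop (i * P.report8Len)).drop P.reportLen) u₂,
      fun x => ((x.2.getD 1 []).drop (i * P.report8Len)).getD (2 * P.reportLen) false,
      fun x => ((x.2.getD 1 []).drop (i * P.report8Len)).getD (2 * P.reportLen + 1) false]
    fun l => by
      fin_cases l
      · exact (QFParams.computes_valueBitOf hκ₁ hP u₁ _ fun j hj => hrep j (by omega)).mono_size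
          (by omega)
      · refine (QFParams.computes_valueBitOf hκ₂ hP u₂ (fun x : View =>
          ((x.2.getD 1 []).drop (i * P.report8Len)).drop P.reportLen) fun j hj => ?_).mono_size
          (by omega)
        have := hrep (P.reportLen + j) (by omega)
        simp only [getD_drop] at this ⊢
        exact this
      · exact (hrep _ (by omega)).mono_size (by omega)
      · exact (hrep _ (by omega)).mono_size (by omega)
  exact this

end View

end QFUBQC

/-! ### Leftover hash lemma for subset sums -/

section LeftoverHash

/-- Expectation over a uniformly random element. -/
abbrev avg (α : Type) [Fintype α] [Nonempty α] (f : α → ℝ) : ℝ :=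
  expect (PMF.uniformOfFintype α) f

theorem avg_prod {α β : Type} [Fintype α] [Nonempty α] [Fintype β] [Nonempty β]
    (f : α × β → ℝ) : avg (α × β) f = avg α fun a => avg β fun b => f (a, b) := by
  simp only [avg, expect_uniform]
  rw [Fintype.sum_prod_type, Fintype.card_prod, Nat.cast_mul, ← Finset.sum_div, div_div, mul_comm]

variable {V : Type} [AddCommGroup V] [Fintype V] {a : ℕ}

/-- The sum of the vectors selected by `r`. -/
def subsetSum (A : Fin a → V) (r : Fin a → Bool) : V := ∑ i, if r i then A i else 0

/-- The difference of the two subset sums is a homomorphism in `A`, and it is onto because some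
vector occurs in it with coefficient `1` or `-1`. All its fibres, among them the kernel, therefore
have the same size. -/
theorem card_collision [DecidableEq V] {r r' : Fin a → Bool} (h : r ≠ r') :
    (Finset.univ.filter fun A : Fin a → V => subsetSum A r = subsetSum A r').card *
      Fintype.card V = Fintype.card V ^ a := by
  obtain ⟨i, hi⟩ := Function.ne_iff.1 h
  let φ : (Fin a → V) → V := fun A => subsetSum A r - subsetSum A r'
  have hadd : ∀ A B, φ (A + B) = φ A + φ B := fun A B => by
    simp only [φ, subsetSum, Pi.add_apply]
    have : ∀ t : Fin a → Bool, (∑ i, if t i then A i + B i else 0) =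
        (∑ i, if t i then A i else 0) + ∑ i, if t i then B i else 0 := fun t => by
      rw [← Finset.sum_add_distrib]
      exact Finset.sum_congr rfl fun j _ => by split_ifs <;> simp
    rw [this, this]
    abel
  have hsurj : ∀ v, ∃ B, φ B = v := fun v => by
    have hs : ∀ (c : V) (t : Fin a → Bool),
        subsetSum (Pi.single i c) t = if t i then c else 0 := fun c t => by
      rw [subsetSum, Finset.sum_eq_single i]
      · simp
      · intro j _ hj
        simp [hj]
      · simp
    cases hri : r i
    · have hr'i : r' i = true := by
        cases h' : r' i
        · exact absurd (hri.trans h'.symm) hi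
        · rfl
      exact ⟨Pi.single i (-v), by simp [φ, hs, hri, hr'i]⟩
    · have hr'i : r' i = false := by
        cases h' : r' i
        · rfl
        · exact absurd (hri.trans h'.symm) hi
      exact ⟨Pi.single i v, by simp [φ, hs, hri, hr'i]⟩
  have hfib : ∀ v, (Finset.univ.filter fun A => φ A = v).card =
      (Finset.univ.filter fun A => φ A = 0).card := fun v => by
    obtain ⟨B, rfl⟩ := hsurj v
    refine Finset.card_bij' (fun A _ => A - B) (fun A _ => A + B) ?_ ?_ ?_ ?_
    · intro A hA
      simp only [Finset.mem_filter, Finset.mem_univ, true_and] at hA ⊢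
      have := hadd (A - B) B
      rw [sub_add_cancel, hA] at this
      simpa using this
    · intro A hA
      simp only [Finset.mem_filter, Finset.mem_univ, true_and] at hA ⊢
      rw [hadd, hA, zero_add]
    · intro A _
      simp
    · intro A _
      simp
  have htot := Finset.card_eq_sum_card_fiberwise (f := φ) (s := Finset.univ) (t := Finset.univ)
    (by simp)
  simp only [hfib, Finset.sum_const, Finset.card_univ, smul_eq_mul, Fintype.card_pi_const] at htot
  rw [htot, mul_comm]
  congr 2
  ext A
  simp [φ, sub_eq_zero]

/-- The statistical error in the leftover hash lemma. -/
def hashError (q a : ℕ) : ℝ := Real.sqrt (q / 2 ^ a)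

/-- Collision probabilities control the deviation from uniform in the square mean over `A` and `v`;
Cauchy-Schwarz against a test function with values in the unit interval gives the bound. -/
theorem abs_avg_subsetSum_sub_le [Nonempty V] (g : (Fin a → V) → V → ℝ)
    (hg : ∀ A v, g A v ∈ Set.Icc (0 : ℝ) 1) :
    |(avg (Fin a → V) fun A => avg (Fin a → Bool) fun r => g A (subsetSum A r)) -
      avg (Fin a → V) fun A => avg V fun v => g A v| ≤ hashError (Fintype.card V) a := by
  classical
  set q : ℝ := (Fintype.card V : ℝ) with hq
  have hq0 : 0 < q := by
    rw [hq]
    exact_mod_cast Fintype.card_pos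
  let c : (Fin a → V) → V → ℝ := fun A v => ∑ r : Fin a → Bool, if subsetSum A r = v then 1 else 0
  have hc1 : ∀ A, ∑ v, c A v = 2 ^ a := fun A => by
    simp only [c]
    rw [Finset.sum_comm]
    simp
  have hcg : ∀ A, ∑ r, g A (subsetSum A r) = ∑ v, c A v * g A v := fun A => by
    simp only [c, Finset.sum_mul]
    rw [Finset.sum_comm]
    refine Finset.sum_congr rfl fun r _ => ?_
    simp
  -- This sum counts collisions: the `2 ^ a` pairs `r = r'` collide for all `q ^ a` choices of `A`,
  -- any other pair for a fraction `1 / q` of them.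
  have hc2 : ∑ A, ∑ v, c A v ^ 2 ≤ 2 ^ a * q ^ a + 4 ^ a * (q ^ a / q) := by
    have h1 : ∀ A, ∑ v, c A v ^ 2 = ∑ r : Fin a → Bool, ∑ r' : Fin a → Bool,
        if subsetSum A r = subsetSum A r' then (1 : ℝ) else 0 := fun A => by
      simp only [c, sq, Finset.sum_mul_sum]
      rw [Finset.sum_comm]
      refine Finset.sum_congr rfl fun r _ => ?_
      rw [Finset.sum_comm]
      refine Finset.sum_congr rfl fun r' _ => ?_
      rw [Finset.sum_eq_single (subsetSum A r)]
      · simp [eq_comm]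
      · intro v _ hv
        simp [hv.symm]
      · simp
    have h2 : ∀ r r' : Fin a → Bool,
        (∑ A : Fin a → V, if subsetSum A r = subsetSum A r' then (1 : ℝ) else 0) ≤
          (if r = r' then q ^ a else 0) + q ^ a / q := fun r r' => by
      by_cases h : r = r'
      · subst h
        simp only [if_true, Finset.sum_const, Finset.card_univ, Fintype.card_pi_const, nsmul_eq_mul,
          mul_one, Nat.cast_pow]
        have : 0 ≤ q ^ a / q := by positivity
        linarith
      · rw [if_neg h, zero_add, le_div_iff₀ hq0, Finset.sum_boole]
        have := card_collision (V := V) h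
        rw [hq]
        exact_mod_cast this.le
    calc ∑ A, ∑ v, c A v ^ 2
        = ∑ r : Fin a → Bool, ∑ r' : Fin a → Bool, ∑ A : Fin a → V,
            if subsetSum A r = subsetSum A r' then (1 : ℝ) else 0 := by
          simp only [h1]
          rw [Finset.sum_comm]
          exact Finset.sum_congr rfl fun r _ => Finset.sum_comm
      _ ≤ ∑ r : Fin a → Bool, ∑ r' : Fin a → Bool, ((if r = r' then q ^ a else 0) + q ^ a / q) :=
          Finset.sum_le_sum fun r _ => Finset.sum_le_sum fun r' _ => h2 r r'
      _ = 2 ^ a * q ^ a + 4 ^ a * (q ^ a / q) := by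
          simp only [Finset.sum_add_distrib, Finset.sum_ite_eq, Finset.mem_univ, if_true,
            Finset.sum_const, Finset.card_univ, Fintype.card_pi_const, Fintype.card_bool,
            nsmul_eq_mul]
          push_cast
          rw [show (4 : ℝ) = 2 * 2 by norm_num, mul_pow]
          ring
  -- The deviation of the law of the subset sum from the uniform law. Subtracting the mean cancels
  -- the contribution of the pairs `r ≠ r'`.
  let x : (Fin a → V) → V → ℝ := fun A v => c A v / 2 ^ a - 1 / q
  have hx2 : ∑ A, ∑ v, x A v ^ 2 ≤ q ^ a / 2 ^ a := by
    have h1 : ∀ A, ∑ v, x A v ^ 2 = (∑ v, c A v ^ 2) / 4 ^ a - 1 / q := fun A => by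
      have h2 : ∀ v, x A v ^ 2 = c A v ^ 2 / 4 ^ a - 2 / (2 ^ a * q) * c A v + 1 / q ^ 2 := fun v => by
        simp only [x]
        rw [show (4 : ℝ) = 2 * 2 by norm_num, mul_pow]
        field_simp
        ring
      simp only [h2, Finset.sum_add_distrib, Finset.sum_sub_distrib, ← Finset.sum_div,
        ← Finset.mul_sum, hc1, Finset.sum_const, Finset.card_univ, nsmul_eq_mul, ← hq]
      field_simp
      ring
    simp only [h1, Finset.sum_sub_distrib, ← Finset.sum_div, Finset.sum_const, Finset.card_univ,
      Fintype.card_pi_const, nsmul_eq_mul, Nat.cast_pow, ← hq]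
    have h3 := div_le_div_of_nonneg_right hc2 (show (0 : ℝ) ≤ 4 ^ a by positivity)
    have h4 : (2 ^ a * q ^ a + 4 ^ a * (q ^ a / q)) / 4 ^ a = q ^ a / 2 ^ a + q ^ a * 1 / q := by
      rw [show (4 : ℝ) = 2 * 2 by norm_num, mul_pow]
      field_simp
    linarith
  have hD : (avg (Fin a → V) fun A => avg (Fin a → Bool) fun r => g A (subsetSum A r)) -
      (avg (Fin a → V) fun A => avg V fun v => g A v) = (∑ A, ∑ v, g A v * x A v) / q ^ a := by
    simp only [avg, expect_uniform, Fintype.card_pi_const, Fintype.card_bool, Nat.cast_pow, ← hq,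
      hcg]
    rw [← sub_div, ← Finset.sum_sub_distrib]
    congr 1
    refine Finset.sum_congr rfl fun A _ => ?_
    rw [Finset.sum_div, Finset.sum_div, ← Finset.sum_sub_distrib]
    refine Finset.sum_congr rfl fun v _ => ?_
    simp only [x]
    push_cast
    ring
  rw [hD, hashError]
  refine Real.abs_le_sqrt ?_
  have hcs : (∑ A, ∑ v, g A v * x A v) ^ 2 ≤
      (∑ A, ∑ v, g A v ^ 2) * ∑ A, ∑ v, x A v ^ 2 := by
    have := Finset.sum_mul_sq_le_sq_mul_sq (Finset.univ : Finset ((Fin a → V) × V))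
      (fun p => g p.1 p.2) fun p => x p.1 p.2
    simpa only [Fintype.sum_prod_type] using this
  have hg2 : ∑ A, ∑ v, g A v ^ 2 ≤ q ^ a * q := by
    calc ∑ A, ∑ v, g A v ^ 2 ≤ ∑ _A : Fin a → V, ∑ _v : V, (1 : ℝ) := by
          refine Finset.sum_le_sum fun A _ => Finset.sum_le_sum fun v _ => ?_
          exact pow_le_one₀ (hg A v).1 (hg A v).2
      _ = q ^ a * q := by simp [hq]
  have hx0 : 0 ≤ ∑ A, ∑ v, x A v ^ 2 :=
    Finset.sum_nonneg fun A _ => Finset.sum_nonneg fun v _ => sq_nonneg _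
  rw [div_pow, div_le_iff₀ (by positivity)]
  calc (∑ A, ∑ v, g A v * x A v) ^ 2 ≤ (q ^ a * q) * (q ^ a / 2 ^ a) :=
        hcs.trans (mul_le_mul hg2 hx2 hx0 (by positivity))
    _ = q / 2 ^ a * (q ^ a) ^ 2 := by ring

theorem avg_fin_succ {α : Type} [Fintype α] [Nonempty α] {M : ℕ} (f : (Fin (M + 1) → α) → ℝ) :
    avg (Fin (M + 1) → α) f = avg α fun x => avg (Fin M → α) fun y => f (Fin.cons x y) := by
  rw [← avg_prod fun p : α × (Fin M → α) => f (Fin.cons p.1 p.2)]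
  exact (expect_uniform_equiv (Fin.consEquiv fun _ => α) f).symm

/-- Many subset sums of the same vectors. -/
theorem abs_avg_subsetSums_sub_le [Nonempty V] : ∀ {M : ℕ} (g : (Fin a → V) → (Fin M → V) → ℝ),
    (∀ A v, g A v ∈ Set.Icc (0 : ℝ) 1) →
    |(avg (Fin a → V) fun A => avg (Fin M → Fin a → Bool) fun R => g A fun i => subsetSum A (R i)) -
      avg (Fin a → V) fun A => avg (Fin M → V) fun v => g A v| ≤
        M * hashError (Fintype.card V) a
  | 0, g, hg => by
    have h : ∀ A : Fin a → V, (avg (Fin 0 → Fin a → Bool) fun R => g A fun i => subsetSum A (R i)) =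
        avg (Fin 0 → V) fun v => g A v := fun A => by
      simp only [avg, expect_uniform, Fintype.sum_unique, Fintype.card_unique]
      congr 2
      exact Subsingleton.elim _ _
    simp [h]
  | M + 1, g, hg => by
    have hcons : ∀ (A : Fin a → V) (r : Fin a → Bool) (R : Fin M → Fin a → Bool),
        (fun i => subsetSum A ((Fin.cons r R : Fin (M + 1) → Fin a → Bool) i)) =
          (Fin.cons (subsetSum A r) fun i => subsetSum A (R i) : Fin (M + 1) → V) := fun A r R => by
      funext i
      refine Fin.cases rfl (fun j => rfl) i
    simp only [avg_fin_succ (α := Fin a → Bool), avg_fin_succ (α := V), hcons]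
    have hmem : ∀ A v, g A v ∈ Set.Icc (0 : ℝ) 1 := hg
    -- All sums but the first are replaced by the induction hypothesis with the first selection `r`
    -- held fixed, and then the first one alone.
    have h1 : |(avg (Fin a → V) fun A => avg (Fin a → Bool) fun r => avg (Fin M → Fin a → Bool)
          fun R => g A (Fin.cons (subsetSum A r) fun i => subsetSum A (R i))) -
        avg (Fin a → V) fun A => avg (Fin a → Bool) fun r => avg (Fin M → V) fun v =>
          g A (Fin.cons (subsetSum A r) v)| ≤ M * hashError (Fintype.card V) a := by
      simp only [avg]
      rw [expect_comm _ _ fun A r => expect_mem _ fun R => hg _ _,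
        expect_comm (PMF.uniformOfFintype (Fin a → V)) _ fun A r => expect_mem _ fun R => hg _ _]
      exact abs_expect_sub_le _ (fun r => expect_mem _ fun A => expect_mem _ fun R => hg _ _)
        (fun r => expect_mem _ fun A => expect_mem _ fun R => hg _ _)
        fun r _ => abs_avg_subsetSums_sub_le (fun A v => g A (Fin.cons (subsetSum A r) v))
          fun A v => hg _ _
    have h2 : |(avg (Fin a → V) fun A => avg (Fin a → Bool) fun r => avg (Fin M → V) fun v =>
          g A (Fin.cons (subsetSum A r) v)) -
        avg (Fin a → V) fun A => avg V fun r => avg (Fin M → V) fun v =>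
          g A (Fin.cons r v)| ≤ hashError (Fintype.card V) a :=
      abs_avg_subsetSum_sub_le (fun A r => avg (Fin M → V) fun v => g A (Fin.cons r v))
        fun A v => expect_mem _ fun v => hg _ _
    have h3 := abs_sub_le
      (avg (Fin a → V) fun A => avg (Fin a → Bool) fun r => avg (Fin M → Fin a → Bool)
          fun R => g A (Fin.cons (subsetSum A r) fun i => subsetSum A (R i)))
      (avg (Fin a → V) fun A => avg (Fin a → Bool) fun r => avg (Fin M → V) fun v =>
          g A (Fin.cons (subsetSum A r) v))
      (avg (Fin a → V) fun A => avg V fun r => avg (Fin M → V) fun v => g A (Fin.cons r v))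
    push_cast
    linarith

end LeftoverHash

/-! ### Near-uniformity of the public matrix -/

namespace QFParams

variable (P : QFParams)

/-- The public matrix is statistically close to uniform. -/
theorem abs_avg_pub_sub_le (F : Matrix (Fin P.m) (Fin P.n) (Zq P.k) → ℝ)
    (hF : ∀ M, F M ∈ Set.Icc (0 : ℝ) 1) :
    |(avg (Matrix (Fin P.mbar) (Fin P.n) (Zq P.k)) fun A =>
        avg (Matrix (Fin (P.n * P.k)) (Fin P.mbar) Bool) fun R₁ =>
        avg (Matrix (Fin (P.n * P.k)) (Fin P.mbar) Bool) fun R₂ =>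
          F ((Matrix.fromRows A (P.gadget - (P.bitMatrix R₁ - P.bitMatrix R₂) * A)).submatrix
            finSumFinEquiv.symm id)) - avg (Matrix (Fin P.m) (Fin P.n) (Zq P.k)) F| ≤
      (P.n * P.k : ℕ) * hashError (2 ^ (P.n * P.k)) P.mbar := by
  let build : (Fin P.mbar → Fin P.n → Zq P.k) → (Fin (P.n * P.k) → Fin P.n → Zq P.k) →
      Matrix (Fin P.m) (Fin P.n) (Zq P.k) := fun A W =>
    (Matrix.fromRows (Matrix.of A) (Matrix.of W)).submatrix finSumFinEquiv.symm id
  -- Only `R₁` supplies the randomness for the hash. With `R₂` fixed, the lower block is `(G + R₂ A)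
  -- - R₁ A`, whose rows are translated negatives of subset sums of the rows of `A`.
  let low : (Fin P.mbar → Fin P.n → Zq P.k) → Matrix (Fin (P.n * P.k)) (Fin P.mbar) Bool →
      (Fin (P.n * P.k) → Fin P.n → Zq P.k) → Fin (P.n * P.k) → Fin P.n → Zq P.k := fun A R₂ v =>
    (fun i => (P.gadget + P.bitMatrix R₂ * Matrix.of A) i) - v
  have hcard : Fintype.card (Fin P.n → Zq P.k) = 2 ^ (P.n * P.k) := by
    rw [Fintype.card_pi_const, ZMod.card, ← pow_mul, mul_comm]
  have key : ∀ R₂, |(avg (Fin P.mbar → Fin P.n → Zq P.k) fun A =>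
      avg (Fin (P.n * P.k) → Fin P.mbar → Bool) fun R₁ =>
        F (build A (low A R₂ fun i => subsetSum A (R₁ i)))) -
      avg (Fin P.mbar → Fin P.n → Zq P.k) fun A =>
        avg (Fin (P.n * P.k) → Fin P.n → Zq P.k) fun v => F (build A (low A R₂ v))| ≤
      (P.n * P.k : ℕ) * hashError (2 ^ (P.n * P.k)) P.mbar := fun R₂ => by
    have := abs_avg_subsetSums_sub_le (fun A v => F (build A (low A R₂ v))) fun A v => hF _
    rwa [hcard] at this
  have hreal : ∀ (A : Matrix (Fin P.mbar) (Fin P.n) (Zq P.k)) R₁ R₂,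
      (Matrix.fromRows A (P.gadget - (P.bitMatrix R₁ - P.bitMatrix R₂) * A)).submatrix
        finSumFinEquiv.symm id = build A (low A R₂ fun i => subsetSum A (R₁ i)) := fun A R₁ R₂ => by
    have h1 : P.bitMatrix R₁ * A = Matrix.of fun i => subsetSum (V := Fin P.n → Zq P.k) A (R₁ i) := by
      ext i j
      simp only [Matrix.mul_apply, bitMatrix, Matrix.map_apply, Matrix.of_apply, subsetSum,
        Finset.sum_apply, ite_mul, one_mul, zero_mul]
      exact Finset.sum_congr rfl fun l _ => by split_ifs <;> rfl
    have h2 : P.gadget - (P.bitMatrix R₁ - P.bitMatrix R₂) * A =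
        Matrix.of (low A R₂ fun i => subsetSum A (R₁ i)) := by
      rw [Matrix.sub_mul, h1, sub_sub_eq_add_sub]
      rfl
    rw [h2]
    rfl
  have hideal : ∀ R₂, (avg (Fin P.mbar → Fin P.n → Zq P.k) fun A =>
        avg (Fin (P.n * P.k) → Fin P.n → Zq P.k) fun v => F (build A (low A R₂ v))) =
      avg (Matrix (Fin P.m) (Fin P.n) (Zq P.k)) F := fun R₂ => by
    have h1 : ∀ A, (avg (Fin (P.n * P.k) → Fin P.n → Zq P.k) fun v => F (build A (low A R₂ v))) =
        avg (Fin (P.n * P.k) → Fin P.n → Zq P.k) fun W => F (build A W) := fun A =>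
      -- For fixed `A`, subtracting a uniform vector from a constant gives a uniform vector.
      expect_uniform_equiv (Equiv.subLeft fun i => (P.gadget + P.bitMatrix R₂ * Matrix.of A) i)
        fun W => F (build A W)
    simp only [h1]
    rw [← avg_prod fun p : (Fin P.mbar → Fin P.n → Zq P.k) × (Fin (P.n * P.k) → Fin P.n → Zq P.k) =>
      F (build p.1 p.2)]
    let e : ((Fin P.mbar → Fin P.n → Zq P.k) × (Fin (P.n * P.k) → Fin P.n → Zq P.k)) ≃
        Matrix (Fin P.m) (Fin P.n) (Zq P.k) :=
      (Equiv.sumArrowEquivProdArrow _ _ _).symm.trans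
        (Equiv.arrowCongr finSumFinEquiv (Equiv.refl (Fin P.n → Zq P.k)))
    rw [avg, avg, ← expect_uniform_equiv e F]
    congr 1
  simp only [hreal]
  have h1 : (avg (Matrix (Fin P.mbar) (Fin P.n) (Zq P.k)) fun A =>
        avg (Matrix (Fin (P.n * P.k)) (Fin P.mbar) Bool) fun R₁ =>
        avg (Matrix (Fin (P.n * P.k)) (Fin P.mbar) Bool) fun R₂ =>
          F (build A (low A R₂ fun i => subsetSum A (R₁ i)))) =
      avg (Matrix (Fin (P.n * P.k)) (Fin P.mbar) Bool) fun R₂ =>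
        avg (Fin P.mbar → Fin P.n → Zq P.k) fun A =>
          avg (Fin (P.n * P.k) → Fin P.mbar → Bool) fun R₁ =>
            F (build A (low A R₂ fun i => subsetSum A (R₁ i))) := by
    have h2 : ∀ A : Matrix (Fin P.mbar) (Fin P.n) (Zq P.k),
        (avg (Matrix (Fin (P.n * P.k)) (Fin P.mbar) Bool) fun R₁ =>
          avg (Matrix (Fin (P.n * P.k)) (Fin P.mbar) Bool) fun R₂ =>
            F (build A (low A R₂ fun i => subsetSum A (R₁ i)))) =
        avg (Matrix (Fin (P.n * P.k)) (Fin P.mbar) Bool) fun R₂ =>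
          avg (Fin (P.n * P.k) → Fin P.mbar → Bool) fun R₁ =>
            F (build A (low A R₂ fun i => subsetSum A (R₁ i))) := fun A =>
      expect_comm _ _ fun R₁ R₂ => hF _
    simp only [h2]
    exact expect_comm _ _ fun A R₂ => expect_mem _ fun R₁ => hF _
  rw [h1, ← expect_const (PMF.uniformOfFintype (Matrix (Fin (P.n * P.k)) (Fin P.mbar) Bool))
    (avg (Matrix (Fin P.m) (Fin P.n) (Zq P.k)) F)]
  refine abs_expect_sub_le _ (fun R₂ => expect_mem _ fun A => expect_mem _ fun R₁ => hF _)
    (fun R₂ => expect_mem _ hF) fun R₂ _ => ?_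
  have := key R₂
  rw [hideal R₂] at this
  exact this

end QFParams

/-- With `q = n k` and `a = mbar`, the requirement `n k + sec ≤ mbar` makes the error of each hashed
row at most `2 ^ (-sec / 2)`. -/
theorem hashError_le {q a sec : ℕ} (h : q + sec ≤ a) :
    hashError (2 ^ q) a ≤ (Real.sqrt (1 / 2)) ^ sec := by
  rw [hashError, Real.sqrt_le_left (by positivity), ← pow_mul, mul_comm, pow_mul,
    Real.sq_sqrt (by norm_num), div_le_iff₀ (by positivity), one_div, inv_pow,
    inv_mul_eq_div, le_div_iff₀ (by positivity)]
  have : (2 : ℕ) ^ q * 2 ^ sec ≤ 2 ^ a := by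
    rw [← pow_add]
    exact Nat.pow_le_pow_right two_pos h
  exact_mod_cast this

/-! ### Replacing a 4-states instance by uniform strings -/

section Advantage

/-- Advantage of an LWE distinguisher. -/
def lweAdvantage (n k m : ℕ) (χ : PMF (Zq k)) (D : QCircuit) : ℝ :=
  |acceptProb D (lweReal n k m χ) - acceptProb D (lweIdeal n k m)|

/-- Under the LWE assumption, the advantages of all distinguishers of a polynomially bounded size are
uniformly negligible. -/
theorem LWEHard.exists_uniform_bound {n k : ℕ → ℕ} {χ : (sec : ℕ) → PMF (Zq (k sec))}
    (h : LWEHard n k χ) {m B : ℕ → ℕ} (hm : PolyBounded m) (hB : PolyBounded B) :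
    ∃ ε : ℕ → ℝ, Negligible ε ∧ ∀ sec D, D.size ≤ B sec →
      lweAdvantage (n sec) (k sec) (m sec) (χ sec) D ≤ ε sec := by
  have hle : ∀ sec D, lweAdvantage (n sec) (k sec) (m sec) (χ sec) D ≤ 1 := fun sec D => by
    have h1 := expect_mem (lweReal (n sec) (k sec) (m sec) (χ sec))
      (f := fun c => D.outProb (fun _ => c) true) fun c => D.outProb_mem _ _
    have h2 := expect_mem (lweIdeal (n sec) (k sec) (m sec))
      (f := fun c => D.outProb (fun _ => c) true) fun c => D.outProb_mem _ _
    rw [lweAdvantage, acceptProb, acceptProb, abs_le]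
    constructor <;> linarith [h1.1, h1.2, h2.1, h2.2]
  -- For each parameter a circuit with at least half of the largest advantage is chosen; these form
  -- one non-uniform family, to which the assumption applies. The bound `B sec + 1` makes room for
  -- the one-wire circuit, so that the set of advantages is not empty.
  have hex : ∀ sec, ∃ D₀ : QCircuit, D₀.size ≤ B sec + 1 ∧ ∀ D : QCircuit, D.size ≤ B sec →
      lweAdvantage (n sec) (k sec) (m sec) (χ sec) D ≤
        2 * lweAdvantage (n sec) (k sec) (m sec) (χ sec) D₀ := fun sec => by
    set S : Set ℝ := lweAdvantage (n sec) (k sec) (m sec) (χ sec) '' {D | D.size ≤ B sec + 1}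
    have hbdd : BddAbove S := ⟨1, by rintro _ ⟨D, _, rfl⟩; exact hle sec D⟩
    have hne : S.Nonempty := ⟨_, ⟨1, 0, []⟩, by simp [QCircuit.size], rfl⟩
    have hnn : ∀ D, 0 ≤ lweAdvantage (n sec) (k sec) (m sec) (χ sec) D := fun D => abs_nonneg _
    by_cases hS : 0 < sSup S
    · obtain ⟨_, ⟨D₀, hD₀, rfl⟩, hlt⟩ := exists_lt_of_lt_csSup hne (half_lt_self hS)
      refine ⟨D₀, hD₀, fun D hD => ?_⟩
      have := le_csSup hbdd ⟨D, le_trans hD (Nat.le_succ _), rfl⟩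
      linarith
    · refine ⟨⟨1, 0, []⟩, by simp [QCircuit.size], fun D hD => ?_⟩
      have := le_csSup hbdd ⟨D, le_trans hD (Nat.le_succ _), rfl⟩
      linarith [hnn ⟨1, 0, []⟩]
  choose D₀ hsize hD₀ using hex
  refine ⟨fun sec => 2 * lweAdvantage (n sec) (k sec) (m sec) (χ sec) (D₀ sec), ?_, hD₀⟩
  exact (h m hm D₀ ((hB.add (PolyBounded.const 1)).mono hsize)).const_mul 2

end Advantage

/-! ### Bit positions in encoded challenges -/

section Encoding

theorem encVec_eq_ofFn {m k : ℕ} (y : Fin m → Zq k) :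
    encVec y = List.ofFn fun i : Fin (m * k) => (y i.divNat).val.testBit (i.modNat : ℕ) := by
  rw [List.ofFn_mul, encVec]
  congr 2
  funext r
  rw [encZq]
  congr 1
  funext j
  have hk : 0 < k := j.pos
  have h1 : (r * k + j : ℕ) / k = r := by
    rw [mul_comm, Nat.mul_add_div hk, Nat.div_eq_of_lt j.2, add_zero]
  have h2 : (r * k + j : ℕ) % k = j := by
    rw [mul_comm, Nat.mul_add_mod, Nat.mod_eq_of_lt j.2]
  simp only [Fin.divNat, Fin.modNat, h1, h2]

/-- Adding `q / 2` flips the top bit, and the carry is lost. So encrypting a bit changes at most one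
bit of the encoded challenge. -/
theorem testBit_add_half {k : ℕ} (a : Zq k) {j : ℕ} (hj : j < k) :
    (a + ((2 ^ k / 2 : ℕ) : Zq k)).val.testBit j = xor (a.val.testBit j) (decide (j = k - 1)) := by
  obtain ⟨l, rfl⟩ : ∃ l, k = l + 1 := ⟨k - 1, by omega⟩
  have h : a + ((2 ^ (l + 1) / 2 : ℕ) : Zq (l + 1)) = ((2 ^ l + a.val : ℕ) : Zq (l + 1)) := by
    have e : (2 : ℕ) ^ (l + 1) / 2 = 2 ^ l := by
      rw [pow_succ, Nat.mul_div_cancel _ two_pos]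
    rw [e, Nat.cast_add, ZMod.natCast_zmod_val, add_comm a]
  rw [h, ZMod.val_natCast, Nat.testBit_mod_two_pow]
  rcases Nat.lt_succ_iff_lt_or_eq.1 hj with h1 | rfl
  · rw [Nat.testBit_two_pow_add_gt h1]
    simp [hj, h1.ne]
  · rw [Nat.testBit_two_pow_add_eq]
    simp

theorem length_encMat {m n k : ℕ} (M : Matrix (Fin m) (Fin n) (Zq k)) :
    (encMat M).length = m * (n * k) := by
  simp [encMat, length_encVec, List.length_flatten, List.map_ofFn, Function.comp_def]

end Encoding

namespace QFParams

variable (P : QFParams)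

/-- Length of an encoded LWE challenge, and of the message of the client for one instance. -/
abbrev messageLen : ℕ := P.m * (P.n * P.k) + P.m * P.k

/-- The message obtained from a challenge by adding the bit `d`, times `q / 2`, to the first entry of
the ciphertext. -/
def addBit (d : Bool) (ch : List Bool) : List Bool :=
  List.ofFn fun j : Fin P.messageLen =>
    xor (ch.getD j false) (d && decide ((j : ℕ) = P.m * (P.n * P.k) + (P.k - 1)))

/-- Expansions start with the least significant bit, so the top bit of the first entry of the
ciphertext stands `k - 1` places after the encoded matrix. -/
theorem addBit_enc (d : Bool) (M : Matrix (Fin P.m) (Fin P.n) (Zq P.k)) (y : Fin P.m → Zq P.k) :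
    P.addBit d (encMat M ++ encVec y) =
      encMat M ++ encVec (y + if d then P.halfVec else 0) := by
  rw [addBit, List.ofFn_add]
  congr 1
  · refine List.ext_getElem (by simp [length_encMat]) fun j h1 h2 => ?_
    have hj : j < P.m * (P.n * P.k) := by simpa using h1
    simp only [List.getElem_ofFn, Fin.val_castLE]
    rw [List.getD_append _ _ _ _ h2, List.getD_eq_getElem _ _ h2]
    have : j ≠ P.m * (P.n * P.k) + (P.k - 1) := by omega
    simp [this]
  · rw [encVec_eq_ofFn (y + if d then P.halfVec else 0)]
    congr 1
    funext j
    have hlen := length_encMat M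
    simp only [Fin.val_natAdd]
    rw [List.getD_append_right _ _ _ _ (by omega), hlen, Nat.add_sub_cancel_left, encVec_eq_ofFn,
      List.getD_eq_getElem _ _ (by simp)]
    simp only [List.getElem_ofFn, Nat.add_right_inj, Fin.eta]
    have hk : 0 < P.k := by
      by_contra hc
      have : P.k = 0 := by omega
      have := j.2
      simp_all
    cases d
    · simp
    · simp only [Bool.true_and, if_true, Pi.add_apply, halfVec]
      have hdiv : (j.divNat : ℕ) = j / P.k := rfl
      have hmod : (j.modNat : ℕ) = j % P.k := rfl
      rw [hdiv]
      split_ifs with h0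
      · rw [testBit_add_half _ (by rw [hmod]; exact Nat.mod_lt _ hk)]
        have : (j : ℕ) % P.k = j := Nat.mod_eq_of_lt (by
          rcases (Nat.div_eq_zero_iff).1 h0 with h | h <;> omega)
        rw [hmod, this]
      · have : (j : ℕ) ≠ P.k - 1 := fun h => h0 (by rw [h]; exact Nat.div_eq_of_lt (by omega))
        simp [this]

/-- Error of the replacement of a key by uniform strings, for distinguishing circuits with advantage
at most `ε` against LWE. -/
def hopError (ε : ℝ) : ℝ := ε + (P.n * P.k : ℕ) * hashError (2 ^ (P.n * P.k)) P.mbar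

theorem expect_gen (f : P.Key → ℝ) (hf : ∀ κ, f κ ∈ Set.Icc (0 : ℝ) 1) :
    expect P.gen f =
      avg (Matrix (Fin P.mbar) (Fin P.n) (Zq P.k)) fun A =>
        avg (Matrix (Fin (P.n * P.k)) (Fin P.mbar) Bool) fun R₁ =>
        avg (Matrix (Fin (P.n * P.k)) (Fin P.mbar) Bool) fun R₂ =>
        avg (Fin P.n → Zq P.k) fun s₀ => expect (iid P.χ P.m) fun e₀ => expect coin fun d₀ =>
          f ⟨A, P.bitMatrix R₁ - P.bitMatrix R₂, s₀, e₀, d₀⟩ := by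
  simp only [gen, expect_bind _ _ hf, expect_pure]

/-- The key of a 4-states instance may be replaced by uniform strings if the trapdoor is not used. -/
theorem abs_expect_gen_sub_le {B : ℕ} {ε : ℝ}
    (hε : ∀ D : QCircuit, D.size ≤ B → lweAdvantage P.n P.k P.m P.χ D ≤ ε)
    (F : List Bool → Bool → ℝ) (hF : ∀ l d, F l d ∈ Set.Icc (0 : ℝ) 1)
    (hD : ∀ d, ∃ D : QCircuit, D.size ≤ B ∧
      ∀ ch, D.outProb (fun _ => ch) true = F (P.addBit d ch) d) :
    |(expect P.gen fun κ => F κ.message κ.d₀) -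
      avg (Matrix (Fin P.m) (Fin P.n) (Zq P.k)) fun M => avg (Fin P.m → Zq P.k) fun y =>
        expect coin fun d => F (encMat M ++ encVec y) d| ≤ P.hopError ε := by
  let H : Matrix (Fin P.m) (Fin P.n) (Zq P.k) → ℝ := fun M =>
    avg (Fin P.n → Zq P.k) fun s => expect (iid P.χ P.m) fun e => expect coin fun d =>
      F (encMat M ++ encVec (M.mulVec s + e + if d then P.halfVec else 0)) d
  have hH : ∀ M, H M ∈ Set.Icc (0 : ℝ) 1 := fun M =>
    expect_mem _ fun s => expect_mem _ fun e => expect_mem _ fun d => hF _ _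
  have h1 := P.abs_avg_pub_sub_le H hH
  have h2 : (expect P.gen fun κ => F κ.message κ.d₀) =
      avg (Matrix (Fin P.mbar) (Fin P.n) (Zq P.k)) fun A =>
        avg (Matrix (Fin (P.n * P.k)) (Fin P.mbar) Bool) fun R₁ =>
        avg (Matrix (Fin (P.n * P.k)) (Fin P.mbar) Bool) fun R₂ =>
          H ((Matrix.fromRows A (P.gadget - (P.bitMatrix R₁ - P.bitMatrix R₂) * A)).submatrix
            finSumFinEquiv.symm id) := by
    rw [P.expect_gen _ fun κ => hF _ _]
    rfl
  have h3 : avg (Matrix (Fin P.m) (Fin P.n) (Zq P.k)) H = expect coin fun d =>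
      avg (Matrix (Fin P.m) (Fin P.n) (Zq P.k)) fun M => avg (Fin P.n → Zq P.k) fun s =>
        expect (iid P.χ P.m) fun e =>
          F (encMat M ++ encVec (M.mulVec s + e + if d then P.halfVec else 0)) d := by
    simp only [H]
    rw [expect_comm coin _ fun d M => expect_mem _ fun s => expect_mem _ fun e => hF _ _]
    congr 1
    funext M
    rw [expect_comm coin _ fun d s => expect_mem _ fun e => hF _ _]
    congr 1
    funext s
    rw [expect_comm coin _ fun d e => hF _ _]
  have h4 : (avg (Matrix (Fin P.m) (Fin P.n) (Zq P.k)) fun M => avg (Fin P.m → Zq P.k) fun y =>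
        expect coin fun d => F (encMat M ++ encVec y) d) = expect coin fun d =>
      avg (Matrix (Fin P.m) (Fin P.n) (Zq P.k)) fun M => avg (Fin P.m → Zq P.k) fun y =>
        F (encMat M ++ encVec (y + if d then P.halfVec else 0)) d := by
    rw [expect_comm coin _ fun d M => expect_mem _ fun y => hF _ _]
    congr 1
    funext M
    refine (expect_comm _ coin (f := fun y d => F (encMat M ++ encVec y) d)
      fun y d => hF _ _).trans ?_
    congr 1
    funext d
    -- A uniform vector absorbs the summand `d * (q / 2)`, so in the ideal case the message is
    -- independent of `d`.
    exact (expect_uniform_equiv (Equiv.addRight (if d then P.halfVec else 0))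
      fun y => F (encMat M ++ encVec y) d).symm
  have h5 : |avg (Matrix (Fin P.m) (Fin P.n) (Zq P.k)) H -
      avg (Matrix (Fin P.m) (Fin P.n) (Zq P.k)) fun M => avg (Fin P.m → Zq P.k) fun y =>
        expect coin fun d => F (encMat M ++ encVec y) d| ≤ ε := by
    rw [h3, h4]
    refine abs_expect_sub_le _ (fun d => expect_mem _ fun M => expect_mem _ fun s =>
      expect_mem _ fun e => hF _ _) (fun d => expect_mem _ fun M => expect_mem _ fun y => hF _ _)
      fun d _ => ?_
    -- For each fixed value of the encrypted bit, the game is a distinguisher of LWE samples from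
    -- uniform ones.
    obtain ⟨D, hsize, hout⟩ := hD d
    have h6 := hε D hsize
    have hm : ∀ l, F (P.addBit d l) d ∈ Set.Icc (0 : ℝ) 1 := fun l => hF _ _
    rw [lweAdvantage, acceptProb, acceptProb, lweReal, lweIdeal] at h6
    simp only [hout] at h6
    simp only [expect_bind _ _ hm, expect_pure, addBit_enc] at h6
    exact h6
  rw [h2, hopError]
  calc _ ≤ _ := abs_sub_le _ (avg (Matrix (Fin P.m) (Fin P.n) (Zq P.k)) H) _
    _ ≤ _ := add_le_add h1 h5
    _ = _ := add_comm _ _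

end QFParams

/-! ### Hybrid games -/

section GameResponder

variable {N : ℕ}

/-- A challenger that first sends the strings `msg j` and then the angles `ang j`. -/
def gameResponder (second : Bool) (msg : Fin N → List Bool)
    (ang : Fin N → Pattern N → List Bool → List (List Bool) → Zq 3) : Responder
  | [] => []
  | [_] => (List.ofFn msg).flatten
  | patterns :: reports :: outcomes =>
      if hi : outcomes.length < N then
        encZq (ang ⟨outcomes.length, hi⟩ (decPattern N (if second then 1 else 0) patterns)
          reports outcomes)
      else []

theorem blindnessChallenger_client (P : QFParams) (G : FlowGraph N) (c : Bool)
    (ω : Fin N → QFUBQC.QubitCoins P) :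
    blindnessChallenger (QFUBQC.client P G) c ω =
      gameResponder c (fun j => (ω j).key.message)
        fun j φ reports outcomes => QFUBQC.delta G ω φ reports outcomes j := by
  funext hist
  match hist with
  | [] => rfl
  | [_] => rfl
  | _ :: _ :: _ => rfl

/-- The angle of one qubit may be permuted by coins that are used nowhere else. -/
theorem avg_outProb_gameResponder (C : QCircuit) (second : Bool) (msg : Fin N → List Bool)
    (ang : Fin N → Pattern N → List Bool → List (List Bool) → Zq 3) (i : Fin N)
    {Ω Ω' : Type} [Fintype Ω] [Nonempty Ω] [Fintype Ω'] [Nonempty Ω']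
    (η : Ω → Pattern N → List Bool → List (List Bool) → Zq 3)
    (η' : Ω' → Pattern N → List Bool → List (List Bool) → Zq 3)
    (h : ∀ φ reports outcomes, ∃ e : Ω ≃ Ω', ∀ x,
      η x φ reports outcomes = η' (e x) φ reports outcomes) :
    (avg Ω fun x => C.outProb (gameResponder second msg (Function.update ang i (η x))) true) =
      avg Ω' fun x => C.outProb (gameResponder second msg (Function.update ang i (η' x))) true := by
  have hcard : Fintype.card Ω = Fintype.card Ω' := by
    obtain ⟨e, _⟩ := h (fun _ => 0) [] []
    exact Fintype.card_congr e
  simp only [avg, expect_uniform, hcard, QCircuit.outProb]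
  congr 1
  -- The angle of qubit `i` answers a history of `i + 2` messages: the patterns, the reports and `i`
  -- outcomes.
  refine sum_runProb_equiv _ _ (i + 2) hcard (fun x x' hist hlen => ?_) (fun hist hlen => ?_)
    _ _ _ _ _
  · match hist with
    | [] => rfl
    | [_] => rfl
    | p :: r :: o =>
      simp only [gameResponder]
      by_cases ho : o.length < N
      · rw [dif_pos ho, dif_pos ho]
        have hne : (⟨o.length, ho⟩ : Fin N) ≠ i := fun hc => by
          have := congrArg Fin.val hc
          simp only [List.length_cons] at hlen this
          omega
        rw [Function.update_of_ne hne, Function.update_of_ne hne]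
      · rw [dif_neg ho, dif_neg ho]
  · match hist with
    | [] => simp at hlen
    | [_] => simp at hlen
    | p :: r :: o =>
      obtain ⟨e, he⟩ := h (decPattern N (if second then 1 else 0) p) r o
      refine ⟨e, fun x => ?_⟩
      have hio : o.length = i := by simpa using hlen
      have hi : (⟨o.length, by omega⟩ : Fin N) = i := Fin.ext hio
      simp only [gameResponder]
      rw [dif_pos (by omega), dif_pos (by omega), hi, Function.update_self, Function.update_self,
        he]

end GameResponder

namespace QFUBQC

variable {P : QFParams} {N : ℕ} (G : FlowGraph N)

variable (P) in
/-- Uniform strings with the format of a public matrix and a ciphertext. -/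
abbrev Strings : Type := Matrix (Fin P.m) (Fin P.n) (Zq P.k) × (Fin P.m → Zq P.k)

def Strings.enc (x : Strings P) : List Bool := encMat x.1 ++ encVec x.2

variable (P) in
/-- Uniform replacements for the message and for the angle of a qubit. -/
abbrev IdealCoins : Type := (Strings P × Strings P) × Zq 3

/-- Coins of both kinds are drawn for every qubit, though each qubit uses one kind only; all hybrids
then live on the same probability space. -/
def hybridMsg (i : ℕ) (ω : Fin N → QubitCoins P) (μ : Fin N → IdealCoins P) (j : Fin N) :
    List Bool :=
  if (j : ℕ) < i then (ω j).key.message else (μ j).1.1.enc ++ (μ j).1.2.enc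

def hybridAng (i : ℕ) (ω : Fin N → QubitCoins P) (μ : Fin N → IdealCoins P) (j : Fin N) :
    Pattern N → List Bool → List (List Bool) → Zq 3 :=
  fun φ reports outcomes =>
    if (j : ℕ) < i then delta G ω φ reports outcomes j else (μ j).2

/-- The challenger that treats only the first `i` qubits as the client does. -/
def hybrid (second : Bool) (i : ℕ) (ω : Fin N → QubitCoins P) (μ : Fin N → IdealCoins P) :
    Responder :=
  gameResponder second (hybridMsg i ω μ) (hybridAng G i ω μ)

/-- The challenger of a hybrid with another message and another angle for the qubit `i`. -/
def hop (second : Bool) (i : Fin N) (ω : Fin N → QubitCoins P) (μ : Fin N → IdealCoins P)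
    (l : List Bool) (η : Pattern N → List Bool → List (List Bool) → Zq 3) : Responder :=
  gameResponder second (Function.update (hybridMsg i ω μ) i l)
    (Function.update (hybridAng G i ω μ) i η)

/-- An angle that consists of the part that comes from the pattern and of a function of the
report. -/
def withBase (i : Fin N) (ω : Fin N → QubitCoins P) (θ : List Bool → Zq 3) :
    Pattern N → List Bool → List (List Bool) → Zq 3 :=
  fun φ reports outcomes => baseAngle G ω φ outcomes i + θ (reports.drop (i * P.report8Len))

/-- New coins for qubit `i` change only its own message and angle: earlier angles do not depend on
its pad, and later angles are ideal. -/
theorem hybrid_succ_update (second : Bool) (i : Fin N) (ω : Fin N → QubitCoins P)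
    (μ : Fin N → IdealCoins P) (a : QubitCoins P) (b : IdealCoins P) :
    hybrid G second (i + 1) (Function.update ω i a) (Function.update μ i b) =
      hop G second i ω μ a.key.message
        (withBase G i ω fun report => a.key.angle report + if a.r then 4 else 0) := by
  have hupd : ∀ j : Fin N, j ≤ i → ∀ φ outcomes,
      baseAngle G (Function.update ω i a) φ outcomes j = baseAngle G ω φ outcomes j :=
    fun j hj φ outcomes => baseAngle_congr G (fun j' hj' => by
      rw [Function.update_of_ne (ne_of_lt (lt_of_lt_of_le hj' hj))]) φ outcomes
  rw [hybrid, hop]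
  congr 1
  · funext j
    by_cases hj : j = i
    · subst hj
      simp [hybridMsg]
    · rw [Function.update_of_ne hj]
      have : (j : ℕ) ≠ i := fun h => hj (Fin.ext h)
      have h' : (j : ℕ) < i + 1 ↔ (j : ℕ) < i := by omega
      simp only [hybridMsg, h', Function.update_of_ne hj]
  · funext j φ reports outcomes
    by_cases hj : j = i
    · subst hj
      simp only [hybridAng, Nat.lt_succ_self, if_true, Function.update_self, withBase, delta_eq,
        hupd j le_rfl, add_assoc]
    · rw [Function.update_of_ne hj]
      have : (j : ℕ) ≠ i := fun h => hj (Fin.ext h)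
      have h' : (j : ℕ) < i + 1 ↔ (j : ℕ) < i := by omega
      simp only [hybridAng, h', Function.update_of_ne hj]
      split_ifs with hlt
      · rw [delta_eq, delta_eq, Function.update_of_ne hj, hupd j (le_of_lt hlt)]
      · rfl

/-- Here the honest coins of qubit `i` are not used at all, its pad occurring at most in angles that
are already ideal. -/
theorem hybrid_update (second : Bool) (i : Fin N) (ω : Fin N → QubitCoins P)
    (μ : Fin N → IdealCoins P) (a : QubitCoins P) (b : IdealCoins P) :
    hybrid G second i (Function.update ω i a) (Function.update μ i b) =
      hop G second i ω μ (b.1.1.enc ++ b.1.2.enc) fun _ _ _ => b.2 := by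
  have hupd : ∀ j : Fin N, j ≤ i → ∀ φ outcomes,
      baseAngle G (Function.update ω i a) φ outcomes j = baseAngle G ω φ outcomes j :=
    fun j hj φ outcomes => baseAngle_congr G (fun j' hj' => by
      rw [Function.update_of_ne (ne_of_lt (lt_of_lt_of_le hj' hj))]) φ outcomes
  rw [hybrid, hop]
  congr 1
  · funext j
    by_cases hj : j = i
    · subst hj
      simp [hybridMsg]
    · rw [Function.update_of_ne hj]
      simp only [hybridMsg, Function.update_of_ne hj]
  · funext j φ reports outcomes
    by_cases hj : j = i
    · subst hj
      simp [hybridAng]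
    · rw [Function.update_of_ne hj]
      simp only [hybridAng, Function.update_of_ne hj]
      split_ifs with hlt
      · rw [delta_eq, delta_eq, Function.update_of_ne hj, hupd j (le_of_lt hlt)]
      · rfl

/-! ### Circuits for the challengers -/

/-- All trapdoors are ternary. -/
def TernaryKeys (ω : Fin N → QubitCoins P) : Prop :=
  ∀ j, (ω j).key.κ₁.Ternary ∧ (ω j).key.κ₂.Ternary

theorem ternaryKeys_of_mem_support {ω : Fin N → QubitCoins P}
    (h : ω ∈ (iid (qubitCoins P) N).support) : TernaryKeys ω := fun j => by
  have hj := mem_support_iid _ h j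
  simp only [qubitCoins, QFParams.gen8, PMF.mem_support_bind_iff, PMF.mem_support_pure_iff] at hj
  obtain ⟨key, ⟨κ₁, h₁, κ₂, h₂, u₁, _, u₂, _, rfl⟩, r, _, hω⟩ := hj
  rw [hω]
  exact ⟨QFParams.Key.ternary_of_mem_support h₁, QFParams.Key.ternary_of_mem_support h₂⟩

/-- The bits of a message that contains an LWE challenge. -/
def messageBits (L : ℕ) : Set (View → Bool) :=
  (⋃ j < L, ({chBit j} ∪ {fun x => xor (chBit j x) true})) ∪ ({fun _ => true} ∪ {fun _ => false})

theorem computes_messageBits (L T J : ℕ) :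
    Computes (viewBits L T J) (messageBits L) (L * 4 + 2) := by
  refine (Computes.iUnion _ L fun j hj => ?_).union ((Computes.const true).union (Computes.const false))
  have h : Computes (viewBits L T J) {chBit j} 1 := Computes.load (Or.inl ⟨j, hj, rfl⟩)
  exact h.union (h.xor (Computes.const true))

theorem listIn_const (L : ℕ) (l : List Bool) : ListIn (messageBits L) fun _ : View => l := by
  refine ⟨l.map fun b _ => b, fun f hf => ?_, fun x => by simp [Function.comp_def]⟩
  obtain ⟨b, _, rfl⟩ := List.mem_map.1 hf
  cases b
  · exact Or.inr (Or.inr rfl)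
  · exact Or.inr (Or.inl rfl)

theorem listIn_addBit (d : Bool) :
    ListIn (messageBits P.messageLen) fun x : View => P.addBit d x.1 := by
  refine ListIn.ofFn (fun (j : Fin P.messageLen) (x : View) => xor (x.1.getD j false)
    (d && decide ((j : ℕ) = P.m * (P.n * P.k) + (P.k - 1)))) fun j => Or.inl ?_
  simp only [Set.mem_iUnion]
  refine ⟨j, j.2, ?_⟩
  cases h : d && decide ((j : ℕ) = P.m * (P.n * P.k) + (P.k - 1))
  · left
    simp only [Bool.xor_false]
    rfl
  · right
    rfl

variable (P N) in
/-- Size of the circuits for the LWE distinguishers obtained from an adversary of size `a`. -/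
def hopSize (a : ℕ) : ℕ :=
  simSize a P.messageLen (a + 6 * N + N * P.report8Len) (P.messageLen * 4 + 2 + deltaCost P N + 3)

/-- An adversary in a game with an LWE challenge in place of a key is an LWE distinguisher. -/
theorem exists_simulate_hop (C : QCircuit) (hP : 4 * (P.mbar + 1) * P.bnd < 2 ^ P.k)
    (second : Bool) (i : Fin N) {ω : Fin N → QubitCoins P} (hω : TernaryKeys ω)
    (μ : Fin N → IdealCoins P) (l : List Bool → List Bool)
    (hl : ListIn (messageBits P.messageLen) fun x : View => l x.1)
    {κ : P.Key} (hκ : κ.Ternary) (u : Bool) (g : Bool → Bool → Zq 3) :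
    ∃ D : QCircuit, D.size ≤ hopSize P N C.size ∧ ∀ ch, D.outProb (fun _ => ch) true =
      C.outProb (hop G second i ω μ (l ch) (withBase G i ω fun report =>
        g (κ.valueBitOf report u) (report.getD (2 * P.reportLen + 1) false))) true := by
  set η := withBase G i ω fun report =>
        g (κ.valueBitOf report u) (report.getD (2 * P.reportLen + 1) false) with hη
  set num := if second then 1 else 0 with hnum
  have hnum1 : num ≤ 1 := by rw [hnum]; split_ifs <;> omega
  refine C.exists_simulate (by omega) (fun ch => hop G second i ω μ (l ch) η)
    (fun t ht => ?_) true
  set T := C.prog.length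
  set J := C.size + 6 * N + N * P.report8Len
  cases t with
  | zero =>
    have hmsg : ListIn (messageBits P.messageLen) fun x : View =>
        (List.ofFn (Function.update (hybridMsg i ω μ) i (l x.1))).flatten := by
      refine ListIn.flatten_ofFn
        (fun j (x : View) => Function.update (hybridMsg i ω μ) i (l x.1) j) fun j => ?_
      by_cases hj : j = i
      · subst hj
        simpa using hl
      · simp only [Function.update_of_ne hj]
        exact listIn_const _ _
    obtain ⟨fs, h1, h2⟩ := hmsg
    refine ⟨fs, (computes_messageBits P.messageLen T J).mono subset_rfl h1 (by omega),
      fun ch hist hlen => ?_⟩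
    obtain ⟨p, rfl⟩ := List.length_eq_one_iff.1 hlen
    exact h2 (ch, [p])
  | succ t =>
    -- The history now consists of `t + 2` messages, so the angle of qubit `t` is due, if there is
    -- such a qubit.
    by_cases htN : t < N
    · have hang : Computes (viewBits P.messageLen T J) (bitsOf fun x =>
          Function.update (hybridAng G i ω μ) i η ⟨t, htN⟩ (decPattern N num (x.2.getD 0 []))
            (x.2.getD 1 []) (x.2.drop 2)) (deltaCost P N + 3) := by
        -- There are three kinds of qubits: the qubit `i`, with the angle under study; the earlier
        -- ones, decoded with hardwired trapdoors; the later ones, whose angles are constants.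
        by_cases hti : (⟨t, htN⟩ : Fin N) = i
        · subst hti
          simp only [Function.update_self]
          exact (computes_reportAngle G hP (fun a B₂ _ _ s₂ => a + g B₂ s₂) hκ hκ u u ω ⟨t, htN⟩
            num hnum1 ht (by omega) (by omega)).mono_size (by omega)
        · simp only [Function.update_of_ne hti, hybridAng]
          by_cases hlt : t < i
          · simp only [hlt, if_true]
            exact (computes_reportAngle G hP (fun a B₂ C₂ s₁ s₂ =>
              a + angleFn (ω ⟨t, htN⟩).key.κ₁.d₀ (ω ⟨t, htN⟩).key.κ₂.d₀ B₂ C₂ s₁ s₂ +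
                if (ω ⟨t, htN⟩).r then 4 else 0) (hω _).1 (hω _).2 (ω ⟨t, htN⟩).key.u₁
                (ω ⟨t, htN⟩).key.u₂ ω ⟨t, htN⟩ num hnum1 ht (by omega) (by omega)).mono_size
              (by omega)
          · simp only [hlt, if_false]
            exact (Computes.zconst _).mono_size (by omega)
      refine ⟨List.ofFn fun b : Fin 3 => fun x => (Function.update (hybridAng G i ω μ) i η ⟨t, htN⟩
        (decPattern N num (x.2.getD 0 [])) (x.2.getD 1 []) (x.2.drop 2)).val.testBit b,
        hang.mono subset_rfl (fun f hf => ?_) (by omega), fun ch hist hlen => ?_⟩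
      · obtain ⟨b, rfl⟩ := (List.mem_ofFn' _ _).1 hf
        exact mem_bitsOf _ b.2
      · match hist with
        | p :: r :: o =>
          have ho : o.length = t := by simpa using hlen
          subst ho
          simp only [hop, gameResponder]
          rw [dif_pos htN, List.map_ofFn]
          rfl
    · refine ⟨[], Computes.empty.mono subset_rfl (by simp) (by omega), fun ch hist hlen => ?_⟩
      match hist with
      | p :: r :: o =>
        have ho : o.length = t := by simpa using hlen
        simp only [hop, gameResponder]
        rw [dif_neg (by omega)]
        rfl

end QFUBQC

/-! ### One hop -/

/-- Coordinates of two sequences of independent samples may be sampled again. -/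
theorem expect_iid_update₂ {α β : Type} (p : PMF α) (p' : PMF β) {N : ℕ} (i : Fin N)
    {f : (Fin N → α) → (Fin N → β) → ℝ} (hf : ∀ ω μ, f ω μ ∈ Set.Icc (0 : ℝ) 1) :
    (expect (iid p N) fun ω => expect (iid p' N) fun μ => f ω μ) =
      expect (iid p N) fun ω => expect (iid p' N) fun μ => expect p fun a => expect p' fun b =>
        f (Function.update ω i a) (Function.update μ i b) := by
  rw [expect_iid_update p i fun ω => expect_mem _ fun μ => hf _ _]
  congr 1
  funext ω
  rw [expect_comm _ p fun μ a => expect_mem _ fun b => hf _ _]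
  congr 1
  funext a
  exact expect_iid_update p' i fun μ => hf _ _

namespace QFUBQC

variable {P : QFParams} {N : ℕ} (G : FlowGraph N)

theorem expect_qubitCoins {f : QubitCoins P → ℝ} (hf : ∀ a, f a ∈ Set.Icc (0 : ℝ) 1) :
    expect (qubitCoins P) f =
      expect P.gen fun κ₁ => expect coin fun u₁ => expect P.gen fun κ₂ => expect coin fun u₂ =>
        expect coin fun r => f ⟨⟨κ₁, κ₂, u₁, u₂⟩, r⟩ := by
  have hr : ∀ key, (expect coin fun r => f ⟨key, r⟩) ∈ Set.Icc (0 : ℝ) 1 :=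
    fun key => expect_mem _ fun r => hf _
  simp only [qubitCoins, QFParams.gen8, expect_bind _ _ hf, expect_bind _ _ hr, expect_pure]
  congr 1
  funext κ₁
  exact expect_comm _ _ fun κ₂ u₁ => expect_mem _ fun u₂ => hr _

/-- Probability that the output is `true` with the message `l` for the qubit `i` and the summand
`θ` of its angle. -/
def hopProb (C : QCircuit) (second : Bool) (i : Fin N) (ω : Fin N → QubitCoins P)
    (μ : Fin N → IdealCoins P) (l : List Bool) (θ : List Bool → Zq 3) : ℝ :=
  C.outProb (hop G second i ω μ l (withBase G i ω θ)) true

section Hop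

variable (C : QCircuit) (second : Bool) (i : Fin N) (ω : Fin N → QubitCoins P)
  (μ : Fin N → IdealCoins P)

theorem hopProb_mem (l : List Bool) (θ : List Bool → Zq 3) :
    hopProb G C second i ω μ l θ ∈ Set.Icc (0 : ℝ) 1 := C.outProb_mem _ _

/-- A uniform bit that is used only for the angle may be flipped, depending on the report. -/
theorem expect_coin_hopProb (l : List Bool) (θ θ' : Bool → List Bool → Zq 3)
    (h : ∀ report, ∃ b, ∀ x, θ x report = θ' (xor x b) report) :
    (expect coin fun x => hopProb G C second i ω μ l (θ x)) =
      expect coin fun x => hopProb G C second i ω μ l (θ' x) := by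
  refine avg_outProb_gameResponder C second _ _ i (fun x => withBase G i ω (θ x))
    (fun x => withBase G i ω (θ' x)) fun φ reports outcomes => ?_
  obtain ⟨b, hb⟩ := h (reports.drop (i * P.report8Len))
  refine ⟨if b then Equiv.boolNot else Equiv.refl _, fun x => ?_⟩
  simp only [withBase, hb]
  cases b <;> cases x <;> rfl

/-- The angle that is composed of three bits. -/
def bitsAngle (r d₂ d₁ : Bool) : Zq 3 :=
  (if d₂ then 2 else 0) + (if d₁ then 1 else 0) + if r then 4 else 0

theorem bitsAngle_bijective :
    Function.Bijective fun x : Bool × Bool × Bool => bitsAngle x.1 x.2.1 x.2.2 := by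
  decide

/-- Three uniform bits are the binary digits of a uniform element of `Zq 3`; translation by the base
angle keeps it uniform, and this removes the pattern. -/
theorem expect_coins_hopProb (l : List Bool) :
    (expect coin fun r => expect coin fun d₂ => expect coin fun d₁ =>
        hopProb G C second i ω μ l fun _ => bitsAngle r d₂ d₁) =
      avg (Zq 3) fun z => C.outProb (hop G second i ω μ l fun _ _ _ => z) true := by
  have h := avg_outProb_gameResponder C second (Function.update (hybridMsg i ω μ) i l)
    (hybridAng G i ω μ) i
    (fun (x : Bool × Bool × Bool) => withBase G i ω fun _ => bitsAngle x.1 x.2.1 x.2.2)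
    (fun z _ _ _ => z) fun φ reports outcomes =>
      ⟨(Equiv.ofBijective _ bitsAngle_bijective).trans
        (Equiv.addLeft (baseAngle G ω φ outcomes i)), fun x => rfl⟩
  rw [avg_prod] at h
  simp only [avg_prod] at h
  exact h

/-- The summand of the angle when the second key is not used. -/
def halfAngle (κ : P.Key) (u r d : Bool) (report : List Bool) : Zq 3 :=
  bitsAngle r (xor d (xor (κ.valueBitOf report u) (report.getD (2 * P.reportLen + 1) false) &&
    κ.d₀)) κ.d₀

/-- The pad `r` absorbs `L₁`, the only term that contains the value bit of the second instance. From
`κ₂` only the message and the basis bit survive, and `u₂` disappears. -/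
theorem expect_hop_eq :
    (expect (qubitCoins P) fun a => C.outProb (hop G second i ω μ a.key.message
        (withBase G i ω fun report => a.key.angle report + if a.r then 4 else 0)) true) =
      expect P.gen fun κ₁ => expect coin fun u => expect coin fun r => expect P.gen fun κ₂ =>
        hopProb G C second i ω μ (κ₁.message ++ κ₂.message) (halfAngle κ₁ u r κ₂.d₀) := by
  rw [expect_qubitCoins fun a => C.outProb_mem _ _]
  congr 1
  funext κ₁
  congr 1
  funext u₁
  rw [expect_comm coin P.gen fun r κ₂ => hopProb_mem G C second i ω μ _ _]
  congr 1
  funext κ₂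
  refine Eq.trans ?_ (expect_const coin _)
  congr 1
  funext u₂
  refine expect_coin_hopProb G C second i ω μ (κ₁.message ++ κ₂.message)
    (fun r report => QFParams.Key8.angle ⟨κ₁, κ₂, u₁, u₂⟩ report + if r then 4 else 0)
    (fun r => halfAngle κ₁ u₁ r κ₂.d₀) fun report => ?_
  refine ⟨xor (xor (κ₂.valueBitOf (report.drop P.reportLen) u₂)
      (κ₁.valueBitOf report u₁)) (κ₁.d₀ && xor (report.getD (2 * P.reportLen) false)
        (report.getD (2 * P.reportLen + 1) false)), fun r => ?_⟩
  simp only [halfAngle, bitsAngle, QFParams.Key8.angle]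
  generalize xor (xor _ _) (κ₁.d₀ && _) = L₁
  have h4 : ∀ L r : Bool, ((if L then 4 else 0) + if r then 4 else 0 : Zq 3) =
      if xor r L then 4 else 0 := by decide
  rw [← h4]
  ring

/-- Once its ciphertext is uniform, the bit `d` of the second instance is a fresh coin and pads
`L₂`. The value bit of `κ`, and with it the trapdoor, is gone. -/
theorem expect_halfAngle (κ : P.Key) (u r : Bool) (x : Strings P) :
    (expect coin fun d => hopProb G C second i ω μ (κ.message ++ x.enc) (halfAngle κ u r d)) =
      expect coin fun d => hopProb G C second i ω μ (κ.message ++ x.enc) fun _ =>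
        bitsAngle r d κ.d₀ :=
  expect_coin_hopProb G C second i ω μ _ _ (fun d _ => bitsAngle r d κ.d₀) fun _ => ⟨_, fun _ => rfl⟩

/-- After the masking of `L₂` the bit `u` is idle, and the expectations are reordered so that `κ` is
drawn last, ready for its own replacement. -/
theorem expect_second_uniform :
    (expect P.gen fun κ => expect coin fun u => expect coin fun r =>
        avg (Matrix (Fin P.m) (Fin P.n) (Zq P.k)) fun M => avg (Fin P.m → Zq P.k) fun y =>
          expect coin fun d => hopProb G C second i ω μ (κ.message ++ (encMat M ++ encVec y))
            (halfAngle κ u r d)) =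
      avg (Strings P) fun x => expect coin fun r => expect coin fun d => expect P.gen fun κ =>
        hopProb G C second i ω μ (κ.message ++ x.enc) fun _ => bitsAngle r d κ.d₀ := by
  have hq := hopProb_mem G C second i ω μ
  refine Eq.trans ?_ (expect_comm P.gen (PMF.uniformOfFintype (Strings P))
    (f := fun κ x => expect coin fun r => expect coin fun d =>
      hopProb G C second i ω μ (κ.message ++ x.enc) fun _ => bitsAngle r d κ.d₀)
    fun κ x => expect_mem _ fun r => expect_mem _ fun d => hq _ _) |>.trans ?_
  · congr 1
    funext κ
    refine Eq.trans ?_ (expect_comm (PMF.uniformOfFintype (Strings P)) coin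
      (f := fun x r => expect coin fun d =>
        hopProb G C second i ω μ (κ.message ++ x.enc) fun _ => bitsAngle r d κ.d₀)
      fun x r => expect_mem _ fun d => hq _ _).symm
    refine Eq.trans ?_ (expect_const coin _)
    congr 1
    funext u
    congr 1
    funext r
    refine Eq.trans ?_ (avg_prod _).symm
    congr 1
    funext M
    congr 1
    funext y
    exact expect_halfAngle G C second i ω μ κ u r (M, y)
  · congr 1
    funext x
    rw [expect_comm P.gen coin fun κ r => expect_mem _ fun d => hq _ _]
    congr 1
    funext r
    exact expect_comm P.gen coin fun κ d => hq _ _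

/-- The three bits of the angle are now independent of both strings and of each other, so together
they are a uniform angle. -/
theorem expect_both_uniform :
    (avg (Strings P) fun x => expect coin fun r => expect coin fun d =>
        avg (Matrix (Fin P.m) (Fin P.n) (Zq P.k)) fun M => avg (Fin P.m → Zq P.k) fun y =>
          expect coin fun d₁ => hopProb G C second i ω μ ((encMat M ++ encVec y) ++ x.enc) fun _ =>
            bitsAngle r d d₁) =
      avg (IdealCoins P) fun b =>
        C.outProb (hop G second i ω μ (b.1.1.enc ++ b.1.2.enc) fun _ _ _ => b.2) true := by
  have hq := hopProb_mem G C second i ω μ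
  have h := avg_prod (α := Strings P × Strings P) (β := Zq 3) fun b =>
    C.outProb (hop G second i ω μ (b.1.1.enc ++ b.1.2.enc) fun _ _ _ => b.2) true
  have h' := avg_prod (α := Strings P) (β := Strings P) fun p => avg (Zq 3) fun z =>
    C.outProb (hop G second i ω μ (p.1.enc ++ p.2.enc) fun _ _ _ => z) true
  refine Eq.trans (Eq.trans ?_ (expect_comm (PMF.uniformOfFintype (Strings P))
    (PMF.uniformOfFintype (Strings P)) (f := fun x' x => avg (Zq 3) fun z =>
      C.outProb (hop G second i ω μ (Strings.enc x' ++ Strings.enc x) fun _ _ _ => z) true)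
    fun x' x => expect_mem _ fun z => C.outProb_mem _ _).symm) (h'.symm.trans h.symm)
  congr 1
  funext x
  simp only [← expect_coins_hopProb]
  refine Eq.trans ?_ (expect_comm (PMF.uniformOfFintype (Strings P)) coin
    (f := fun x' r => expect coin fun d => expect coin fun d₁ =>
      hopProb G C second i ω μ (Strings.enc x' ++ x.enc) fun _ => bitsAngle r d d₁)
    fun x' r => expect_mem _ fun d => expect_mem _ fun d₁ => hq _ _).symm
  congr 1
  funext r
  refine Eq.trans ?_ (expect_comm (PMF.uniformOfFintype (Strings P)) coin
    (f := fun x' d => expect coin fun d₁ =>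
      hopProb G C second i ω μ (Strings.enc x' ++ x.enc) fun _ => bitsAngle r d d₁)
    fun x' d => expect_mem _ fun d₁ => hq _ _).symm
  congr 1
  funext d
  exact (avg_prod (α := Matrix (Fin P.m) (Fin P.n) (Zq P.k)) (β := Fin P.m → Zq P.k) fun x' =>
    expect coin fun d₁ =>
      hopProb G C second i ω μ (Strings.enc x' ++ x.enc) fun _ => bitsAngle r d d₁).symm

variable {ω} {ε : ℝ}

/-- The first key, `u` and `r` are fixed before the challenge is embedded as the second key; the
distinguisher knows the trapdoor of `κ` and can evaluate `halfAngle`. -/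
theorem abs_second_key_sub_le (hP : 4 * (P.mbar + 1) * P.bnd < 2 ^ P.k)
    (hε : ∀ D : QCircuit, D.size ≤ hopSize P N C.size → lweAdvantage P.n P.k P.m P.χ D ≤ ε)
    (hω : TernaryKeys ω) :
    |(expect P.gen fun κ₁ => expect coin fun u => expect coin fun r => expect P.gen fun κ₂ =>
        hopProb G C second i ω μ (κ₁.message ++ κ₂.message) (halfAngle κ₁ u r κ₂.d₀)) -
      expect P.gen fun κ => expect coin fun u => expect coin fun r =>
        avg (Matrix (Fin P.m) (Fin P.n) (Zq P.k)) fun M => avg (Fin P.m → Zq P.k) fun y =>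
          expect coin fun d => hopProb G C second i ω μ (κ.message ++ (encMat M ++ encVec y))
            (halfAngle κ u r d)| ≤ P.hopError ε := by
  have hq := hopProb_mem G C second i ω μ
  refine abs_expect_sub_le _ (fun κ => expect_mem _ fun u => expect_mem _ fun r =>
    expect_mem _ fun κ₂ => hq _ _) (fun κ => expect_mem _ fun u => expect_mem _ fun r =>
      expect_mem _ fun M => expect_mem _ fun y => expect_mem _ fun d => hq _ _) fun κ hκ => ?_
  refine abs_expect_sub_le _ (fun u => expect_mem _ fun r => expect_mem _ fun κ₂ => hq _ _)
    (fun u => expect_mem _ fun r => expect_mem _ fun M => expect_mem _ fun y =>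
      expect_mem _ fun d => hq _ _) fun u _ => ?_
  refine abs_expect_sub_le _ (fun r => expect_mem _ fun κ₂ => hq _ _)
    (fun r => expect_mem _ fun M => expect_mem _ fun y => expect_mem _ fun d => hq _ _) fun r _ => ?_
  refine P.abs_expect_gen_sub_le hε
    (fun l d => hopProb G C second i ω μ (κ.message ++ l) (halfAngle κ u r d))
    (fun l d => hq _ _) fun d => ?_
  exact exists_simulate_hop G C hP second i hω μ (fun ch => κ.message ++ P.addBit d ch)
    ((listIn_const _ _).append (listIn_addBit d)) (QFParams.Key.ternary_of_mem_support hκ) u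
    fun B₂ s₂ => bitsAngle r (xor d (xor B₂ s₂ && κ.d₀)) κ.d₀

theorem abs_first_key_sub_le (hP : 4 * (P.mbar + 1) * P.bnd < 2 ^ P.k)
    (hε : ∀ D : QCircuit, D.size ≤ hopSize P N C.size → lweAdvantage P.n P.k P.m P.χ D ≤ ε)
    (hω : TernaryKeys ω) :
    |(avg (Strings P) fun x => expect coin fun r => expect coin fun d => expect P.gen fun κ =>
        hopProb G C second i ω μ (κ.message ++ x.enc) fun _ => bitsAngle r d κ.d₀) -
      avg (Strings P) fun x => expect coin fun r => expect coin fun d =>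
        avg (Matrix (Fin P.m) (Fin P.n) (Zq P.k)) fun M => avg (Fin P.m → Zq P.k) fun y =>
          expect coin fun d₁ => hopProb G C second i ω μ ((encMat M ++ encVec y) ++ x.enc) fun _ =>
            bitsAngle r d d₁| ≤ P.hopError ε := by
  have hq := hopProb_mem G C second i ω μ
  refine abs_expect_sub_le _ (fun x => expect_mem _ fun r => expect_mem _ fun d =>
    expect_mem _ fun κ => hq _ _) (fun x => expect_mem _ fun r => expect_mem _ fun d =>
      expect_mem _ fun M => expect_mem _ fun y => expect_mem _ fun d₁ => hq _ _) fun x _ => ?_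
  refine abs_expect_sub_le _ (fun r => expect_mem _ fun d => expect_mem _ fun κ => hq _ _)
    (fun r => expect_mem _ fun d => expect_mem _ fun M => expect_mem _ fun y =>
      expect_mem _ fun d₁ => hq _ _) fun r _ => ?_
  refine abs_expect_sub_le _ (fun d => expect_mem _ fun κ => hq _ _)
    (fun d => expect_mem _ fun M => expect_mem _ fun y => expect_mem _ fun d₁ => hq _ _) fun d _ => ?_
  refine P.abs_expect_gen_sub_le hε
    (fun l d₁ => hopProb G C second i ω μ (l ++ x.enc) fun _ => bitsAngle r d d₁)
    (fun l d₁ => hq _ _) fun d₁ => ?_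
  exact exists_simulate_hop G C hP second i hω μ (fun ch => P.addBit d₁ ch ++ x.enc)
    -- The summand of the angle is constant here, so the key and the bit supplied are placeholders,
    -- of which only the ternary trapdoor is required.
    ((listIn_addBit d₁).append (listIn_const _ _)) (hω i).1 false fun _ _ => bitsAngle r d d₁

/-- The keys and the angle of a qubit may be replaced by uniform ones. -/
theorem abs_hop_sub_le (hP : 4 * (P.mbar + 1) * P.bnd < 2 ^ P.k)
    (hε : ∀ D : QCircuit, D.size ≤ hopSize P N C.size → lweAdvantage P.n P.k P.m P.χ D ≤ ε)
    (hω : TernaryKeys ω) :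
    |(expect (qubitCoins P) fun a => C.outProb (hop G second i ω μ a.key.message
        (withBase G i ω fun report => a.key.angle report + if a.r then 4 else 0)) true) -
      avg (IdealCoins P) fun b =>
        C.outProb (hop G second i ω μ (b.1.1.enc ++ b.1.2.enc) fun _ _ _ => b.2) true| ≤
      2 * P.hopError ε := by
  have h1 := abs_second_key_sub_le G C second i μ hP hε hω
  have h2 := abs_first_key_sub_le G C second i μ hP hε hω
  rw [expect_second_uniform] at h1
  rw [expect_both_uniform] at h2
  rw [expect_hop_eq, two_mul]
  exact (abs_sub_le _ _ _).trans (add_le_add h1 h2)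

end Hop

/-! ### The sequence of hybrids -/

/-- Probability that the output is `true` in a hybrid game. -/
def hybridProb (C : QCircuit) (second : Bool) (i : ℕ) : ℝ :=
  expect (iid (qubitCoins P) N) fun ω => expect (iid (PMF.uniformOfFintype (IdealCoins P)) N)
    fun μ => C.outProb (hybrid G second i ω μ) true

theorem abs_hybridProb_succ_sub_le (C : QCircuit) (hP : 4 * (P.mbar + 1) * P.bnd < 2 ^ P.k) {ε : ℝ}
    (hε : ∀ D : QCircuit, D.size ≤ hopSize P N C.size → lweAdvantage P.n P.k P.m P.χ D ≤ ε)
    (second : Bool) {i : ℕ} (hi : i < N) :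
    |hybridProb (P := P) G C second (i + 1) - hybridProb (P := P) G C second i| ≤
      2 * P.hopError ε := by
  have hq : ∀ j (ω : Fin N → QubitCoins P) μ,
      C.outProb (hybrid G second j ω μ) true ∈ Set.Icc (0 : ℝ) 1 := fun j ω μ => C.outProb_mem _ _
  rw [hybridProb, hybridProb, expect_iid_update₂ _ _ ⟨i, hi⟩ (hq _),
    expect_iid_update₂ _ _ ⟨i, hi⟩ (hq _)]
  refine abs_expect_sub_le _
    (fun ω => expect_mem _ fun μ => expect_mem _ fun a => expect_mem _ fun b => hq _ _ _)
    (fun ω => expect_mem _ fun μ => expect_mem _ fun a => expect_mem _ fun b => hq _ _ _)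
    fun ω hω => ?_
  refine abs_expect_sub_le _ (fun μ => expect_mem _ fun a => expect_mem _ fun b => hq _ _ _)
    (fun μ => expect_mem _ fun a => expect_mem _ fun b => hq _ _ _) fun μ _ => ?_
  have h1 := hybrid_succ_update G second ⟨i, hi⟩ ω μ
  have h2 := hybrid_update G second ⟨i, hi⟩ ω μ
  simp only at h1 h2
  simp only [h1, h2, expect_const]
  exact abs_hop_sub_le G C second ⟨i, hi⟩ μ hP hε (ternaryKeys_of_mem_support hω)

theorem abs_hybridProb_sub_zero_le (C : QCircuit) (hP : 4 * (P.mbar + 1) * P.bnd < 2 ^ P.k) {ε : ℝ}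
    (hε : ∀ D : QCircuit, D.size ≤ hopSize P N C.size → lweAdvantage P.n P.k P.m P.χ D ≤ ε)
    (second : Bool) : ∀ i ≤ N,
    |hybridProb (P := P) G C second i - hybridProb (P := P) G C second 0| ≤
      i * (2 * P.hopError ε)
  | 0, _ => by simp
  | i + 1, hi => by
    have h := abs_hybridProb_sub_zero_le C hP hε second i (by omega)
    have h' := abs_hybridProb_succ_sub_le G C hP hε second (Nat.lt_of_succ_le hi)
    calc _ ≤ _ := abs_sub_le _ (hybridProb (P := P) G C second i) _
      _ ≤ _ := add_le_add h' h
      _ = _ := by push_cast; ring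

theorem hybridProb_card (C : QCircuit) (second : Bool) :
    hybridProb (P := P) G C second N =
      expect (iid (qubitCoins P) N) fun ω =>
        C.outProb (blindnessChallenger (client P G) second ω) true := by
  refine congrArg _ (funext fun ω => ?_)
  have h : ∀ μ : Fin N → IdealCoins P, hybrid G second N ω μ =
      blindnessChallenger (client P G) second ω := fun μ => by
    rw [blindnessChallenger_client, hybrid]
    congr 1
    · funext j
      simp [hybridMsg]
    · funext j φ reports outcomes
      exact if_pos j.2
  refine Eq.trans ?_ (expect_const (iid (PMF.uniformOfFintype (IdealCoins P)) N) _)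
  exact congrArg _ (funext fun μ => by rw [h μ])

theorem hybridProb_zero (C : QCircuit) :
    hybridProb (P := P) G C true 0 = hybridProb (P := P) G C false 0 := by
  rw [hybridProb, hybridProb]
  have h : ∀ (ω : Fin N → QubitCoins P) μ, hybrid G true 0 ω μ = hybrid G false 0 ω μ :=
    fun ω μ => by
    funext hist
    match hist with
    | [] => rfl
    | [_] => rfl
    | _ :: _ :: _ => simp only [hybrid, gameResponder, hybridAng, Nat.not_lt_zero, if_false]
  simp only [h]

/-- The winning probability is `1/2` plus half the difference of the acceptance probabilities for
the two patterns. Both are joined by `N` hops to hybrid `0`, where they coincide, so half the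
difference is at most the cost of one such path. -/
theorem blindnessWinProb_le (C : QCircuit) (hP : 4 * (P.mbar + 1) * P.bnd < 2 ^ P.k) {ε : ℝ}
    (hε : ∀ D : QCircuit, D.size ≤ hopSize P N C.size → lweAdvantage P.n P.k P.m P.χ D ≤ ε) :
    blindnessWinProb (client P G) C ≤ 1 / 2 + N * (2 * P.hopError ε) := by
  have h1 := abs_hybridProb_sub_zero_le G C hP hε true N le_rfl
  have h2 := abs_hybridProb_sub_zero_le G C hP hε false N le_rfl
  have h3 : blindnessWinProb (client P G) C = (hybridProb (P := P) G C true N +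
      (1 - hybridProb (P := P) G C false N)) / 2 := by
    have h : ∀ S, C.outProb S false = 1 - C.outProb S true := fun S => by
      linarith [C.outProb_true_add_false S]
    rw [blindnessWinProb, expect_coin, hybridProb_card, hybridProb_card]
    simp only [h]
    rw [expect_one_sub _ fun ω => C.outProb_mem _ _]
    rfl
  rw [h3]
  rw [hybridProb_zero] at h1
  have h4 := (abs_le.1 h1).2
  have h5 := (abs_le.1 h2).1
  linarith

end QFUBQC

/-! ### Asymptotics of the reduction -/

theorem polyBounded_hopSize {P : ℕ → QFParams} (hn : PolyBounded fun sec => (P sec).n)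
    (hk : PolyBounded fun sec => (P sec).k) (hm : PolyBounded fun sec => (P sec).mbar) {N : ℕ → ℕ}
    (hN : PolyBounded N) {a : ℕ → ℕ} (ha : PolyBounded a) :
    PolyBounded fun sec => QFUBQC.hopSize (P sec) (N sec) (a sec) := by
  simp only [QFUBQC.hopSize, simSize, QFUBQC.deltaCost, QFUBQC.baseCost, angleCost, decCost, addCost,
    QFParams.valueCost, QFParams.candidateCost, QFParams.flagCost, QFParams.dotCost,
    QFParams.shiftCost, QFParams.untrapCost, QFParams.secretCost, QFParams.errorCost, mulCost,
    QFParams.messageLen, QFParams.report8Len, QFParams.reportLen, QFParams.preimLen, QFParams.m]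
  repeat' first
    | with_reducible exact PolyBounded.const _
    | with_reducible assumption
    | with_reducible apply PolyBounded.add
    | with_reducible apply PolyBounded.mul

end

theorem mainTheorem4 (P : ℕ → QFParams)
    (hn : PolyBounded fun sec => (P sec).n) (hk : PolyBounded fun sec => (P sec).k)
    (hm : PolyBounded fun sec => (P sec).mbar)
    (hP : ∀ sec, (P sec).Admissible sec)
    (hLWE : LWEHard (fun sec => (P sec).n) (fun sec => (P sec).k) (fun sec => (P sec).χ))
    (N : ℕ → ℕ) (hN : PolyBounded N) (G : (sec : ℕ) → FlowGraph (N sec)) :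
    AdaptivelyBlind fun sec => QFUBQC.client (P sec) (G sec) := by
  intro A hA
  have hnk := hn.mul hk
  -- All distinguishers of the reduction, for every hop and all hardwired coins, have size at most
  -- `hopSize` for the size of the adversary, so a single `ε` serves them all.
  obtain ⟨ε, hε, hD⟩ := hLWE.exists_uniform_bound (m := fun sec => (P sec).m) (hm.add hnk)
    (polyBounded_hopSize hn hk hm hN hA)
  have hr1 : Real.sqrt (1 / 2) < 1 := by
    rw [Real.sqrt_lt' one_pos]
    norm_num
  have hhash : Negligible fun sec => hashError (2 ^ ((P sec).n * (P sec).k)) (P sec).mbar := by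
    refine (negligible_pow (Real.sqrt_nonneg (1 / 2)) hr1).mono fun sec => ?_
    rw [abs_of_nonneg (pow_nonneg (Real.sqrt_nonneg _) _), hashError, abs_of_nonneg (Real.sqrt_nonneg _)]
    exact hashError_le (hP sec).1
  refine ⟨fun sec => N sec * (2 * (P sec).hopError (ε sec)), ?_, fun sec => ?_⟩
  · exact ((hε.add (hhash.polyBounded_mul hnk)).const_mul 2).polyBounded_mul hN
  · exact QFUBQC.blindnessWinProb_le (G sec) (A sec) (hP sec).2 (hD sec)
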